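/- **Consistency of the logic $\mathcal G$.** *Syntax.* Types are generated from base types and a type $nt$ by $\to$ (the type $o$ of formulas is kept apart; types and argument types below do not contain $o$). Terms are simply typed $\lambda$-terms built from variables, a set $\mathcal K$ of typed constants containing $z:nt$ and $s:nt\to nt$, and, for every type, an infinite set of *nominal constants*; $\mathcal C$ is the collection of all nominal constants, and $\beta\eta$-convertible terms are identified. Formulas are built from $\top,\bot$, atomic formulas $p\,t_1\cdots t_n$ ($p$ a typed predicate symbol), atoms $\mathrm{nat}\,t$ ($t:nt$, $\mathrm{nat}$ a distinguished predicate), $\land,\lor,\supset$, and quantifiers $\forall_\tau,\exists_\tau,\nabla_\tau$ for all types $\tau$. $\mathrm{supp}(B)$ is the (finite) set of nominal constants appearing in $B$. A permutation $\pi$ is a type-preserving bijection of $\mathcal C$ moving finitely many constants; $\pi.B$ is its action on $B$. *Definitions.* A definition $\mathcal D$ is a (possibly infinite) set of clauses $\forall\vec x.(\nabla\vec z.H)\triangleq B$, where $H$ is atomic with predicate other than $\mathrm{nat}$, the free variables of $\nabla\vec z.H$ are among $\vec x$, those of $B$ are free in $\nabla\vec z.H$, and no nominal constant appears in $H$ or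 $B$. $\mathcal D$ is *stratified*: natural numbers $\mathrm{lvl}(p)$ can be assigned to the predicates (including $\mathrm{nat}$) so that $\mathrm{lvl}(B)\le\mathrm{lvl}(H)$ for every clause, where $\mathrm{lvl}(p\,\vec t)=\mathrm{lvl}(p)$, $\mathrm{lvl}(\top)=\mathrm{lvl}(\bot)=0$, $\mathrm{lvl}(B\land C)=\mathrm{lvl}(B\lor C)=\max(\mathrm{lvl}\,B,\mathrm{lvl}\,C)$, $\mathrm{lvl}(B\supset C)=\max(\mathrm{lvl}\,B+1,\mathrm{lvl}\,C)$, and quantifiers do not change the level. *Provability.* A sequent $\Sigma:\Gamma\vdash C$ consists of a signature $\Sigma$ of typed variables, a multiset $\Gamma$ of formulas and a formula $C$, all with free variables in $\Sigma$. Derivability is the least relation closed under the following rules (premises $\Rightarrow$ conclusion; $\Sigma$ is omitted where it does not change). - $id_\pi$: $\Gamma,B\vdash B'$ if $\pi.B=\pi'.B'$ for some permutations $\pi,\pi'$. Cut: $\Gamma\vdash B$ and $B,\Delta\vdash C\Rightarrow\Gamma,\Delta\vdash C$. Contraction: $\Gamma,B,B\vdash C\Rightarrow\Gamma,B\vdash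 C$. - $\Gamma,\bot\vdash C$; $\Gamma\vdash\top$; $\Gamma,B\vdash C$ and $\Gamma,D\vdash C\Rightarrow\Gamma,B\lor D\vdash C$; $\Gamma\vdash B_i\Rightarrow\Gamma\vdash B_1\lor B_2$; $\Gamma,B_i\vdash C\Rightarrow\Gamma,B_1\land B_2\vdash C$; $\Gamma\vdash B$ and $\Gamma\vdash D\Rightarrow\Gamma\vdash B\land D$; $\Gamma\vdash B$ and $\Gamma,D\vdash C\Rightarrow\Gamma,B\supset D\vdash C$; $\Gamma,B\vdash D\Rightarrow\Gamma\vdash B\supset D$. - For any term $t:\tau$ over $\Sigma,\mathcal K,\mathcal C$: $\Gamma,B[t/x]\vdash C\Rightarrow\Gamma,\forall_\tau x.B\vdash C$, and $\Gamma\vdash B[t/x]\Rightarrow\Gamma\vdash\exists_\tau x.B$. With $\vec c$ a listing of $\mathrm{supp}(B)$ and $h\notin\Sigma$ a variable of suitable type: $\Sigma,h:\Gamma\vdash B[h\,\vec c/x]\Rightarrow\Sigma:\Gamma\vdash\forall x.B$, and $\Sigma,h:\Gamma,B[h\,\vec c/x]\vdash C\Rightarrow\Sigma:\Gamma,\exists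 x.B\vdash C$. With $a\notin\mathrm{supp}(B)$ a nominal constant of suitable type: $\Gamma,B[a/x]\vdash C\Rightarrow\Gamma,\nabla x.B\vdash C$, and $\Gamma\vdash B[a/x]\Rightarrow\Gamma\vdash\nabla x.B$. - $\Gamma\vdash\mathrm{nat}\,z$; $\Gamma\vdash\mathrm{nat}\,N\Rightarrow\Gamma\vdash\mathrm{nat}\,(s\,N)$; and, for any invariant $I$ of type $nt\to o$ without free variables: $\;\vdash I\,z$, and $x:I\,x\vdash I\,(s\,x)$, and $\Sigma:\Gamma,I\,N\vdash C\Rightarrow\Sigma:\Gamma,\mathrm{nat}\,N\vdash C$. - Let $A=p\,\vec t$ be atomic, $p\neq\mathrm{nat}$, and $\vec a$ a listing of $\mathrm{supp}(A)$. For a clause $\forall\vec x.(\nabla\vec z.H)\triangleq B$ let $\vec c$ be distinct nominal constants, of the types of $\vec z$, outside the supports of $A$, of $\Gamma$ and (for $\mathrm{def}\mathcal L$) of $C$; let $\Sigma',\Gamma',A',C'$ result from $\Sigma,\Gamma,A,C$ by replacing each $h\in\Sigma$ by $h'\,\vec c$ with $h'$ a new variable; and let $H'=H[h_i\,\vec a/x_i,\vec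 c/\vec z]$, $B'=B[h_i\,\vec a/x_i]$ with $h_i$ new variables not in $\Sigma'$. - $\mathrm{def}\mathcal L$: $\Sigma:A,\Gamma\vdash C$ follows from the set of all premises $\Sigma'\theta:(\pi.B')\theta,\Gamma'\theta\vdash C'\theta$, for all clauses of $\mathcal D$ (with a choice of $\vec c$ for each), all permutations $\pi$ of $\vec a\vec c$, and all substitutions $\theta$ without nominal constants in their range such that $(\pi.H')\theta=A'\theta$; here $\Sigma'\theta$ is any signature over which the terms of $\theta$ are formed. - $\mathrm{def}\mathcal R$: $\Sigma:\Gamma\vdash A$ follows from $\Sigma':\Gamma'\vdash(\pi.B')\theta$, for any one clause of $\mathcal D$, one permutation $\pi$ of $\vec a\vec c$, and one substitution $\theta$ of terms over $\Sigma'$ for the free variables of $H'$, without nominal constants in its range, such that $(\pi.H')\theta=A'$. A formula $A$ over $\Sigma$ is *provable* if $\Sigma:\ \vdash A$ is derivable. **Statement.** For every such language, every stratified definition $\mathcal D$, every signature $\Sigma$ and every formula $A$ over $\Sigma$, it is not the case that both $A$ and $A\supset\bot$ are provable in $\mathcal G$. -/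

import Mathlib

universe u

namespace GLogic

/-! ### Types and languages -/

/-- Simple types that do not contain the type of formulas. `nt` is the type of natural numbers. -/
inductive Ty (S : Type u) : Type u
  | nt : Ty S
  | base : S → Ty S
  | arr : Ty S → Ty S → Ty S

/-- The non-logical vocabulary: base types, the (non-nominal) constants other than `z` and `s`,
the predicate symbols other than `nat` with the list of types of their arguments, and, for every
type, an infinite collection of nominal constants. -/
structure Lang where
  Srt : Type u
  Con : Type u
  conTy : Con → Ty Srt
  Pred : Type u
  arity : Pred → List (Ty Srt)
  Nom : Ty Srt → Type u
  nom_infinite : ∀ τ, Infinite (Nom τ)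

abbrev Lang.Typ (L : Lang.{u}) : Type u := Ty L.Srt

/-- Signatures of variables; a variable is a position in the signature. -/
abbrev Lang.Ctx (L : Lang.{u}) : Type u := List L.Typ

/-- A nominal constant together with its type. -/
abbrev Lang.Nominal (L : Lang.{u}) : Type u := Σ τ : L.Typ, L.Nom τ

/-- `Var Γ τ`: the variables of type `τ` in the signature `Γ`. -/
inductive Var {T : Type u} : List T → T → Type u
  | here {Γ : List T} {τ : T} : Var (τ :: Γ) τ
  | there {Γ : List T} {σ τ : T} : Var Γ τ → Var (σ :: Γ) τ

/-- The variable at the same position in the signature obtained by applying `f` to all types. -/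
def Var.map {T : Type u} (f : T → T) : {Γ : List T} → {τ : T} → Var Γ τ → Var (Γ.map f) (f τ)
  | _, _, .here => .here
  | _, _, .there x => .there (x.map f)

/-- A variable of `Γ`, seen as a variable of `Θ ++ Γ`. -/
def Var.inr {T : Type u} : {Γ : List T} → {τ : T} → (Θ : List T) → Var Γ τ → Var (Θ ++ Γ) τ
  | _, _, [], x => x
  | _, _, _ :: Θ, x => .there (x.inr Θ)

/-! ### Preterms and conversion -/

/-- Well-typed preterms, in de Bruijn style (so that alpha-conversion is equality). -/
inductive Raw (L : Lang.{u}) : L.Ctx → L.Typ → Type u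
  | var {Γ : L.Ctx} {τ : L.Typ} : Var Γ τ → Raw L Γ τ
  | con {Γ : L.Ctx} (k : L.Con) : Raw L Γ (L.conTy k)
  | zero {Γ : L.Ctx} : Raw L Γ .nt
  | succ {Γ : L.Ctx} : Raw L Γ (.arr .nt .nt)
  | nom {Γ : L.Ctx} {τ : L.Typ} : L.Nom τ → Raw L Γ τ
  | lam {Γ : L.Ctx} {σ τ : L.Typ} : Raw L (σ :: Γ) τ → Raw L Γ (.arr σ τ)
  | app {Γ : L.Ctx} {σ τ : L.Typ} : Raw L Γ (.arr σ τ) → Raw L Γ σ → Raw L Γ τ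

variable {L : Lang.{u}}

abbrev Ren (L : Lang.{u}) (Γ Δ : L.Ctx) : Type u := ∀ ⦃τ : L.Typ⦄, Var Γ τ → Var Δ τ

def Ren.lift {Γ Δ : L.Ctx} (r : Ren L Γ Δ) (σ : L.Typ) : Ren L (σ :: Γ) (σ :: Δ)
  | _, .here => .here
  | _, .there x => .there (r x)

def Raw.rename : {Γ Δ : L.Ctx} → {τ : L.Typ} → Ren L Γ Δ → Raw L Γ τ → Raw L Δ τ
  | _, _, _, r, .var x => .var (r x)
  | _, _, _, _, .con k => .con k
  | _, _, _, _, .zero => .zero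
  | _, _, _, _, .succ => .succ
  | _, _, _, _, .nom a => .nom a
  | _, _, _, r, .lam t => .lam (t.rename (r.lift _))
  | _, _, _, r, .app t u => .app (t.rename r) (u.rename r)

def Raw.weaken {Γ : L.Ctx} {τ : L.Typ} (σ : L.Typ) (t : Raw L Γ τ) : Raw L (σ :: Γ) τ :=
  t.rename (fun _ x => .there x)

abbrev RawSub (L : Lang.{u}) (Γ Δ : L.Ctx) : Type u := ∀ ⦃τ : L.Typ⦄, Var Γ τ → Raw L Δ τ

def RawSub.lift {Γ Δ : L.Ctx} (s : RawSub L Γ Δ) (σ : L.Typ) : RawSub L (σ :: Γ) (σ :: Δ)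
  | _, .here => .var .here
  | _, .there x => (s x).weaken σ

/-- Simultaneous capture-avoiding substitution. -/
def Raw.subst : {Γ Δ : L.Ctx} → {τ : L.Typ} → Raw L Γ τ → RawSub L Γ Δ → Raw L Δ τ
  | _, _, _, .var x, s => s x
  | _, _, _, .con k, _ => .con k
  | _, _, _, .zero, _ => .zero
  | _, _, _, .succ, _ => .succ
  | _, _, _, .nom a, _ => .nom a
  | _, _, _, .lam t, s => .lam (t.subst (s.lift _))
  | _, _, _, .app t u, s => .app (t.subst s) (u.subst s)

/-- `u` for the first variable, the other variables unchanged. -/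
def RawSub.single {Γ : L.Ctx} {σ : L.Typ} (u : Raw L Γ σ) : RawSub L (σ :: Γ) Γ
  | _, .here => u
  | _, .there x => .var x

/-- Beta-eta-conversion. -/
inductive Conv : {Γ : L.Ctx} → {τ : L.Typ} → Raw L Γ τ → Raw L Γ τ → Prop
  | refl {Γ : L.Ctx} {τ : L.Typ} (t : Raw L Γ τ) : Conv t t
  | symm {Γ : L.Ctx} {τ : L.Typ} {t t' : Raw L Γ τ} : Conv t t' → Conv t' t
  | trans {Γ : L.Ctx} {τ : L.Typ} {t t' t'' : Raw L Γ τ} : Conv t t' → Conv t' t'' → Conv t t''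
  | lam {Γ : L.Ctx} {σ τ : L.Typ} {t t' : Raw L (σ :: Γ) τ} : Conv t t' → Conv t.lam t'.lam
  | app {Γ : L.Ctx} {σ τ : L.Typ} {t t' : Raw L Γ (.arr σ τ)} {u u' : Raw L Γ σ} :
      Conv t t' → Conv u u' → Conv (t.app u) (t'.app u')
  | beta {Γ : L.Ctx} {σ τ : L.Typ} (t : Raw L (σ :: Γ) τ) (u : Raw L Γ σ) :
      Conv (t.lam.app u) (t.subst (RawSub.single u))
  | eta {Γ : L.Ctx} {σ τ : L.Typ} (t : Raw L Γ (.arr σ τ)) :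
      Conv (((t.weaken σ).app (.var .here)).lam) t

/-- A permutation of nominal constants: type-preserving and moving finitely many constants. -/
structure NomPerm (L : Lang.{u}) : Type u where
  perm : ∀ τ : L.Typ, Equiv.Perm (L.Nom τ)
  finite : {a : L.Nominal | perm a.1 a.2 ≠ a.2}.Finite

def Raw.permute (π : NomPerm L) : {Γ : L.Ctx} → {τ : L.Typ} → Raw L Γ τ → Raw L Γ τ
  | _, _, .var x => .var x
  | _, _, .con k => .con k
  | _, _, .zero => .zero
  | _, _, .succ => .succ
  | _, τ, .nom a => .nom (π.perm τ a)
  | _, _, .lam t => .lam (t.permute π)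
  | _, _, .app t u => .app (t.permute π) (u.permute π)

/-- The nominal constant `a` appears in the preterm. -/
def Raw.HasNom (a : L.Nominal) : {Γ : L.Ctx} → {τ : L.Typ} → Raw L Γ τ → Prop
  | _, τ, .nom b => a = ⟨τ, b⟩
  | _, _, .lam t => t.HasNom a
  | _, _, .app t u => t.HasNom a ∨ u.HasNom a
  | _, _, _ => False

/-- The variable `x` appears free in the preterm. -/
def Raw.HasVar : {Γ : L.Ctx} → {σ τ : L.Typ} → Var Γ σ → Raw L Γ τ → Prop
  | _, σ, τ, x, .var y => (⟨σ, x⟩ : Σ ρ : L.Typ, Var _ ρ) = ⟨τ, y⟩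
  | _, _, _, x, .lam t => t.HasVar (.there x)
  | _, _, _, x, .app t u => t.HasVar x ∨ u.HasVar x
  | _, _, _, _, _ => False

/-! ### Conversion is compatible with renaming, permutation and substitution -/

theorem Raw.rename_rename {Γ : L.Ctx} {τ : L.Typ} (t : Raw L Γ τ) :
    ∀ {Δ Θ : L.Ctx} (r : Ren L Γ Δ) (r' : Ren L Δ Θ),
      (t.rename r).rename r' = t.rename (fun _ x => r' (r x)) := by
  induction t with
  | lam t ih =>
    intro Δ Θ r r'
    simp only [Raw.rename, ih]
    congr 2
    funext ρ x
    cases x <;> rfl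
  | app t u iht ihu => intro Δ Θ r r'; simp only [Raw.rename, iht, ihu]
  | _ => intros; rfl

theorem Raw.subst_rename {Γ : L.Ctx} {τ : L.Typ} (t : Raw L Γ τ) :
    ∀ {Δ Θ : L.Ctx} (r : Ren L Γ Δ) (s : RawSub L Δ Θ),
      (t.rename r).subst s = t.subst (fun _ x => s (r x)) := by
  induction t with
  | lam t ih =>
    intro Δ Θ r s
    simp only [Raw.rename, Raw.subst, ih]
    congr 2
    funext ρ x
    cases x <;> rfl
  | app t u iht ihu => intro Δ Θ r s; simp only [Raw.rename, Raw.subst, iht, ihu]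
  | _ => intros; rfl

theorem Raw.rename_subst {Γ : L.Ctx} {τ : L.Typ} (t : Raw L Γ τ) :
    ∀ {Δ Θ : L.Ctx} (s : RawSub L Γ Δ) (r : Ren L Δ Θ),
      (t.subst s).rename r = t.subst (fun _ x => (s x).rename r) := by
  induction t with
  | lam t ih =>
    intro Δ Θ s r
    simp only [Raw.rename, Raw.subst, ih]
    congr 2
    funext ρ x
    cases x with
    | here => rfl
    | there x => simp only [RawSub.lift, Raw.weaken, Raw.rename_rename]; rfl
  | app t u iht ihu => intro Δ Θ s r; simp only [Raw.rename, Raw.subst, iht, ihu]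
  | _ => intros; rfl

theorem Raw.subst_subst {Γ : L.Ctx} {τ : L.Typ} (t : Raw L Γ τ) :
    ∀ {Δ Θ : L.Ctx} (s : RawSub L Γ Δ) (s' : RawSub L Δ Θ),
      (t.subst s).subst s' = t.subst (fun _ x => (s x).subst s') := by
  induction t with
  | lam t ih =>
    intro Δ Θ s s'
    simp only [Raw.subst, ih]
    congr 2
    funext ρ x
    cases x with
    | here => rfl
    | there x =>
      simp only [RawSub.lift, Raw.weaken, Raw.subst_rename, Raw.rename_subst]
  | app t u iht ihu => intro Δ Θ s s'; simp only [Raw.subst, iht, ihu]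
  | _ => intros; rfl

theorem Raw.subst_var {Γ : L.Ctx} {τ : L.Typ} (t : Raw L Γ τ) :
    t.subst (fun _ x => .var x) = t := by
  induction t with
  | lam t ih =>
    simp only [Raw.subst]
    congr 1
    refine Eq.trans ?_ ih
    congr 1
    funext ρ x
    cases x <;> rfl
  | app t u iht ihu => simp only [Raw.subst, iht, ihu]
  | _ => rfl

theorem Conv.subst {Γ : L.Ctx} {τ : L.Typ} {t t' : Raw L Γ τ} (h : Conv t t') :
    ∀ {Δ : L.Ctx} (s : RawSub L Γ Δ), Conv (t.subst s) (t'.subst s) := by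
  induction h with
  | refl t => intro Δ s; exact .refl _
  | symm _ ih => intro Δ s; exact .symm (ih s)
  | trans _ _ ih ih' => intro Δ s; exact .trans (ih s) (ih' s)
  | lam _ ih => intro Δ s; exact .lam (ih _)
  | app _ _ ih ih' => intro Δ s; exact .app (ih s) (ih' s)
  | beta t u =>
    intro Δ s
    have e : (t.subst (RawSub.single u)).subst s
        = (t.subst (s.lift _)).subst (RawSub.single (u.subst s)) := by
      rw [Raw.subst_subst, Raw.subst_subst]
      congr 1
      funext ρ x
      cases x with
      | here => rfl
      | there x =>
        simp only [RawSub.lift, Raw.weaken, Raw.subst_rename]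
        exact (Raw.subst_var _).symm
    rw [e]
    exact .beta _ _
  | eta t =>
    intro Δ s
    have e : ∀ σ, (t.weaken σ).subst (s.lift σ) = (t.subst s).weaken σ := by
      intro σ
      simp only [Raw.weaken, Raw.subst_rename, Raw.rename_subst]
      rfl
    simp only [Raw.subst, e]
    exact .eta _

theorem Raw.rename_eq_subst {Γ Δ : L.Ctx} {τ : L.Typ} (t : Raw L Γ τ) (r : Ren L Γ Δ) :
    t.rename r = t.subst (fun _ x => .var (r x)) := by
  rw [← Raw.subst_var (t.rename r), Raw.subst_rename]

theorem Conv.rename {Γ Δ : L.Ctx} {τ : L.Typ} {t t' : Raw L Γ τ} (h : Conv t t')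
    (r : Ren L Γ Δ) : Conv (t.rename r) (t'.rename r) := by
  rw [Raw.rename_eq_subst, Raw.rename_eq_subst]
  exact h.subst _

theorem Raw.permute_rename (π : NomPerm L) {Γ : L.Ctx} {τ : L.Typ} (t : Raw L Γ τ) :
    ∀ {Δ : L.Ctx} (r : Ren L Γ Δ), (t.rename r).permute π = (t.permute π).rename r := by
  induction t with
  | lam t ih => intro Δ r; simp only [Raw.rename, Raw.permute, ih]
  | app t u iht ihu => intro Δ r; simp only [Raw.rename, Raw.permute, iht, ihu]
  | _ => intros; rfl

theorem Raw.permute_subst (π : NomPerm L) {Γ : L.Ctx} {τ : L.Typ} (t : Raw L Γ τ) :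
    ∀ {Δ : L.Ctx} (s : RawSub L Γ Δ),
      (t.subst s).permute π = (t.permute π).subst (fun _ x => (s x).permute π) := by
  induction t with
  | lam t ih =>
    intro Δ s
    simp only [Raw.subst, Raw.permute, ih]
    congr 2
    funext ρ x
    cases x with
    | here => rfl
    | there x => simp only [RawSub.lift, Raw.weaken, Raw.permute_rename]
  | app t u iht ihu => intro Δ s; simp only [Raw.subst, Raw.permute, iht, ihu]
  | _ => intros; rfl

theorem Conv.permute (π : NomPerm L) {Γ : L.Ctx} {τ : L.Typ} {t t' : Raw L Γ τ}
    (h : Conv t t') : Conv (t.permute π) (t'.permute π) := by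
  induction h with
  | refl t => exact .refl _
  | symm _ ih => exact .symm ih
  | trans _ _ ih ih' => exact .trans ih ih'
  | lam _ ih => exact .lam ih
  | app _ _ ih ih' => exact .app ih ih'
  | beta t u =>
    have e : (fun ρ x => (RawSub.single u (τ := ρ) x).permute π)
        = RawSub.single (u.permute π) := by
      funext ρ x
      cases x <;> rfl
    rw [Raw.permute_subst, e]
    exact .beta _ _
  | eta t =>
    simp only [Raw.permute, Raw.weaken, Raw.permute_rename]
    exact .eta _

theorem Conv.subst_congr {Γ : L.Ctx} {τ : L.Typ} (t : Raw L Γ τ) :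
    ∀ {Δ : L.Ctx} {s s' : RawSub L Γ Δ}, (∀ ⦃σ⦄ (x : Var Γ σ), Conv (s x) (s' x)) →
      Conv (t.subst s) (t.subst s') := by
  induction t with
  | var x => intro Δ s s' h; exact h x
  | lam t ih =>
    intro Δ s s' h
    refine .lam (ih ?_)
    intro σ x
    cases x with
    | here => exact .refl _
    | there x => exact (h x).rename _
  | app t u iht ihu => intro Δ s s' h; exact .app (iht h) (ihu h)
  | _ => intros; exact .refl _

/-! ### Terms -/

instance convSetoid (L : Lang.{u}) (Γ : L.Ctx) (τ : L.Typ) : Setoid (Raw L Γ τ) where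
  r := Conv
  iseqv := ⟨Conv.refl, Conv.symm, Conv.trans⟩

/-- Terms of type `τ` over the signature `Γ`, convertible terms being identified. -/
def Tm (L : Lang.{u}) (Γ : L.Ctx) (τ : L.Typ) : Type u := Quotient (convSetoid L Γ τ)

namespace Tm

def mk {Γ : L.Ctx} {τ : L.Typ} (t : Raw L Γ τ) : Tm L Γ τ := Quotient.mk _ t

def var {Γ : L.Ctx} {τ : L.Typ} (x : Var Γ τ) : Tm L Γ τ := mk (.var x)

def nom {Γ : L.Ctx} {τ : L.Typ} (a : L.Nom τ) : Tm L Γ τ := mk (.nom a)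

def zero {Γ : L.Ctx} : Tm L Γ .nt := mk .zero

def app {Γ : L.Ctx} {σ τ : L.Typ} : Tm L Γ (.arr σ τ) → Tm L Γ σ → Tm L Γ τ :=
  Quotient.map₂ Raw.app (fun _ _ h _ _ h' => Conv.app h h')

def succ {Γ : L.Ctx} (t : Tm L Γ .nt) : Tm L Γ .nt := app (mk .succ) t

def weaken {Γ : L.Ctx} {τ : L.Typ} (σ : L.Typ) : Tm L Γ τ → Tm L (σ :: Γ) τ :=
  Quotient.map (Raw.weaken σ) (fun _ _ h => Conv.rename h _)

def permute (π : NomPerm L) {Γ : L.Ctx} {τ : L.Typ} : Tm L Γ τ → Tm L Γ τ :=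
  Quotient.map (Raw.permute π) (fun _ _ h => Conv.permute π h)

/-- The nominal constants appearing in a term; as convertible terms are identified, these are the
ones that appear in all representatives (equivalently, in the normal form). -/
def supp {Γ : L.Ctx} {τ : L.Typ} (t : Tm L Γ τ) : Set L.Nominal :=
  {a | ∀ r : Raw L Γ τ, mk r = t → r.HasNom a}

/-- The variable `x` is free in the term `t`, that is, in all its representatives. -/
def HasVar {Γ : L.Ctx} {σ τ : L.Typ} (x : Var Γ σ) (t : Tm L Γ τ) : Prop :=
  ∀ r : Raw L Γ τ, mk r = t → r.HasVar x

end Tm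

/-- Substitutions from the variables of `Γ` to terms over `Δ`. -/
abbrev Sub (L : Lang.{u}) (Γ Δ : L.Ctx) : Type u := ∀ ⦃τ : L.Typ⦄, Var Γ τ → Tm L Δ τ

namespace Sub

def lift {Γ Δ : L.Ctx} (s : Sub L Γ Δ) (σ : L.Typ) : Sub L (σ :: Γ) (σ :: Δ)
  | _, .here => Tm.var .here
  | _, .there x => (s x).weaken σ

/-- `u` for the first variable and `s` for the others. -/
def cons {Γ Δ : L.Ctx} {σ : L.Typ} (u : Tm L Δ σ) (s : Sub L Γ Δ) : Sub L (σ :: Γ) Δ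
  | _, .here => u
  | _, .there x => s x

def empty (Δ : L.Ctx) : Sub L [] Δ := fun _ x => nomatch x

/-- The inclusion of a signature into its extension by one variable. -/
def wk (Γ : L.Ctx) (σ : L.Typ) : Sub L Γ (σ :: Γ) := fun _ x => Tm.var (.there x)

def single {Γ : L.Ctx} {σ : L.Typ} (u : Tm L Γ σ) : Sub L (σ :: Γ) Γ :=
  cons u (fun _ x => Tm.var x)

/-- `s` on the variables of `Θ` and `s'` on those of `Γ`. -/
def append {Γ Δ : L.Ctx} : {Θ : L.Ctx} → Sub L Θ Δ → Sub L Γ Δ → Sub L (Θ ++ Γ) Δ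
  | [], _, s' => s'
  | _ :: _, s, s' => cons (s .here) (append (fun _ x => s (.there x)) s')

end Sub

noncomputable def Tm.subst {Γ Δ : L.Ctx} {τ : L.Typ} (t : Tm L Γ τ) (s : Sub L Γ Δ) : Tm L Δ τ :=
  Quotient.map (fun r : Raw L Γ τ => r.subst (fun _ x => (s x).out))
    (fun _ _ h => Conv.subst h _) t

/-- Substitution does not depend on the representatives. -/
theorem Tm.subst_mk {Γ Δ : L.Ctx} {τ : L.Typ} (t : Raw L Γ τ) (s : RawSub L Γ Δ) :
    (Tm.mk t).subst (fun _ x => Tm.mk (s x)) = Tm.mk (t.subst s) :=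
  Quotient.sound (Conv.subst_congr t fun _ x => Quotient.exact (Quotient.out_eq (Tm.mk (s x))))

/-! ### Formulas -/

/-- Formulas over a signature: normal forms of terms of the type of formulas. -/
inductive Formula (L : Lang.{u}) : L.Ctx → Type u
  | top {Γ : L.Ctx} : Formula L Γ
  | bot {Γ : L.Ctx} : Formula L Γ
  | nat {Γ : L.Ctx} : Tm L Γ .nt → Formula L Γ
  | atom {Γ : L.Ctx} (p : L.Pred) :
      (∀ i : Fin (L.arity p).length, Tm L Γ ((L.arity p).get i)) → Formula L Γ
  | and {Γ : L.Ctx} : Formula L Γ → Formula L Γ → Formula L Γ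
  | or {Γ : L.Ctx} : Formula L Γ → Formula L Γ → Formula L Γ
  | imp {Γ : L.Ctx} : Formula L Γ → Formula L Γ → Formula L Γ
  | all {Γ : L.Ctx} (τ : L.Typ) : Formula L (τ :: Γ) → Formula L Γ
  | ex {Γ : L.Ctx} (τ : L.Typ) : Formula L (τ :: Γ) → Formula L Γ
  | nabla {Γ : L.Ctx} (τ : L.Typ) : Formula L (τ :: Γ) → Formula L Γ

namespace Formula

noncomputable def subst : {Γ Δ : L.Ctx} → Formula L Γ → Sub L Γ Δ → Formula L Δ
  | _, _, .top, _ => .top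
  | _, _, .bot, _ => .bot
  | _, _, .nat t, s => .nat (t.subst s)
  | _, _, .atom p t, s => .atom p (fun i => (t i).subst s)
  | _, _, .and B C, s => .and (B.subst s) (C.subst s)
  | _, _, .or B C, s => .or (B.subst s) (C.subst s)
  | _, _, .imp B C, s => .imp (B.subst s) (C.subst s)
  | _, _, .all τ B, s => .all τ (B.subst (s.lift τ))
  | _, _, .ex τ B, s => .ex τ (B.subst (s.lift τ))
  | _, _, .nabla τ B, s => .nabla τ (B.subst (s.lift τ))

/-- `B[t/x]` for the first variable `x`. -/
noncomputable def inst {Γ : L.Ctx} {τ : L.Typ} (B : Formula L (τ :: Γ)) (t : Tm L Γ τ) :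
    Formula L Γ :=
  B.subst (Sub.single t)

/-- The same formula over a signature with one more variable. -/
noncomputable def weaken {Γ : L.Ctx} (σ : L.Typ) (B : Formula L Γ) : Formula L (σ :: Γ) :=
  B.subst (Sub.wk Γ σ)

def permute (π : NomPerm L) : {Γ : L.Ctx} → Formula L Γ → Formula L Γ
  | _, .top => .top
  | _, .bot => .bot
  | _, .nat t => .nat (t.permute π)
  | _, .atom p t => .atom p (fun i => (t i).permute π)
  | _, .and B C => .and (B.permute π) (C.permute π)
  | _, .or B C => .or (B.permute π) (C.permute π)
  | _, .imp B C => .imp (B.permute π) (C.permute π)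
  | _, .all τ B => .all τ (B.permute π)
  | _, .ex τ B => .ex τ (B.permute π)
  | _, .nabla τ B => .nabla τ (B.permute π)

/-- The nominal constants appearing in a formula. -/
def supp : {Γ : L.Ctx} → Formula L Γ → Set L.Nominal
  | _, .top => ∅
  | _, .bot => ∅
  | _, .nat t => t.supp
  | _, .atom _ t => {a | ∃ i, a ∈ (t i).supp}
  | _, .and B C => B.supp ∪ C.supp
  | _, .or B C => B.supp ∪ C.supp
  | _, .imp B C => B.supp ∪ C.supp
  | _, .all _ B => B.supp
  | _, .ex _ B => B.supp
  | _, .nabla _ B => B.supp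

/-- The variable `x` is free in the formula. -/
def HasVar : {Γ : L.Ctx} → {σ : L.Typ} → Var Γ σ → Formula L Γ → Prop
  | _, _, _, .top => False
  | _, _, _, .bot => False
  | _, _, x, .nat t => t.HasVar x
  | _, _, x, .atom _ t => ∃ i, (t i).HasVar x
  | _, _, x, .and B C => B.HasVar x ∨ C.HasVar x
  | _, _, x, .or B C => B.HasVar x ∨ C.HasVar x
  | _, _, x, .imp B C => B.HasVar x ∨ C.HasVar x
  | _, _, x, .all _ B => B.HasVar (.there x)
  | _, _, x, .ex _ B => B.HasVar (.there x)
  | _, _, x, .nabla _ B => B.HasVar (.there x)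

/-- The level of a formula, given the level of each predicate symbol and of `nat`. -/
def level (lvl : L.Pred → ℕ) (lvlNat : ℕ) : {Γ : L.Ctx} → Formula L Γ → ℕ
  | _, .top => 0
  | _, .bot => 0
  | _, .nat _ => lvlNat
  | _, .atom p _ => lvl p
  | _, .and B C => max (B.level lvl lvlNat) (C.level lvl lvlNat)
  | _, .or B C => max (B.level lvl lvlNat) (C.level lvl lvlNat)
  | _, .imp B C => max (B.level lvl lvlNat + 1) (C.level lvl lvlNat)
  | _, .all _ B => B.level lvl lvlNat
  | _, .ex _ B => B.level lvl lvlNat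
  | _, .nabla _ B => B.level lvl lvlNat

end Formula

/-! ### Raising -/

/-- A list of nominal constants of the given types. -/
inductive NomList (L : Lang.{u}) : List L.Typ → Type u
  | nil : NomList L []
  | cons {α : L.Typ} {αs : List L.Typ} : L.Nom α → NomList L αs → NomList L (α :: αs)

namespace NomList

def toList : {αs : List L.Typ} → NomList L αs → List L.Nominal
  | _, .nil => []
  | _, .cons (α := α) a as => ⟨α, a⟩ :: as.toList

/-- The constants of the list, as a substitution for variables of the same types. -/
def toSub (Δ : L.Ctx) : {αs : List L.Typ} → NomList L αs → Sub L αs Δ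
  | _, .nil => Sub.empty Δ
  | _, .cons a as => Sub.cons (Tm.nom a) (as.toSub Δ)

/-- The list is a listing, without repetitions, of the set `S`. -/
def Lists {αs : List L.Typ} (c : NomList L αs) (S : Set L.Nominal) : Prop :=
  c.toList.Nodup ∧ ∀ a, a ∈ c.toList ↔ a ∈ S

end NomList

/-- The type `α₁ → ⋯ → αₙ → τ`. -/
def raiseTy {S : Type u} : List (Ty S) → Ty S → Ty S
  | [], τ => τ
  | α :: αs, τ => .arr α (raiseTy αs τ)

/-- The curried application `t c₁ ⋯ cₙ`. -/
def Tm.applyNoms {Γ : L.Ctx} {τ : L.Typ} :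
    {αs : List L.Typ} → NomList L αs → Tm L Γ (raiseTy αs τ) → Tm L Γ τ
  | _, .nil, t => t
  | _, .cons a as, t => Tm.applyNoms as (t.app (Tm.nom a))

/-- The signature in which every variable `h : τ` is replaced by a variable of raised type. -/
abbrev raiseCtx (αs : List L.Typ) (Γ : L.Ctx) : L.Ctx := Γ.map (raiseTy αs)

/-- The raising substitution, replacing each variable `h` by `h' c₁ ⋯ cₙ`. -/
def raiseSub {αs : List L.Typ} (c : NomList L αs) (Γ : L.Ctx) : Sub L Γ (raiseCtx αs Γ) :=
  fun _ x => Tm.applyNoms c (Tm.var (x.map (raiseTy αs)))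

/-! ### Definitions -/

/-- A definitional clause `∀ x⃗. (∇ z⃗. H) ≜ B`, where `x⃗`, `z⃗` have the types `vars`, `nabs` and
`H` is the atomic formula formed by `pred` and `args`. -/
structure Clause (L : Lang.{u}) : Type u where
  vars : List L.Typ
  nabs : List L.Typ
  pred : L.Pred
  args : ∀ i : Fin (L.arity pred).length, Tm L (nabs ++ vars) ((L.arity pred).get i)
  body : Formula L vars
  args_supp : ∀ i, (args i).supp = ∅
  body_supp : body.supp = ∅
  /-- The free variables of the body are free in the head. -/
  body_free : ∀ ⦃τ : L.Typ⦄ (x : Var vars τ), body.HasVar x → ∃ i, (args i).HasVar (x.inr nabs)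

namespace Clause

/-- The head `H` over the variables `z⃗, x⃗`. -/
def head (cl : Clause L) : Formula L (cl.nabs ++ cl.vars) := .atom cl.pred cl.args

/-- The head of the clause raised over `a⃗`, with `c⃗` for `z⃗`: `H[h⃗ a⃗ / x⃗, c⃗ / z⃗]`, over `h⃗`. -/
noncomputable def raisedHead (cl : Clause L) {αs : List L.Typ} (a : NomList L αs)
    (c : NomList L cl.nabs) : Formula L (raiseCtx αs cl.vars) :=
  cl.head.subst (Sub.append (c.toSub _) (raiseSub a cl.vars))

/-- The body of the clause raised over `a⃗`: `B[h⃗ a⃗ / x⃗]`, over `h⃗`. -/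
noncomputable def raisedBody (cl : Clause L) {αs : List L.Typ} (a : NomList L αs) :
    Formula L (raiseCtx αs cl.vars) :=
  cl.body.subst (raiseSub a cl.vars)

end Clause

/-- A definition (a set of clauses) is stratified if levels can be assigned to the predicates so
that the level of the body of each clause is at most the level of its head. -/
def Stratified (D : Set (Clause L)) : Prop :=
  ∃ (lvl : L.Pred → ℕ) (lvlNat : ℕ), ∀ cl ∈ D,
    cl.body.level lvl lvlNat ≤ cl.head.level lvl lvlNat

/-! ### Provability -/

/-- The union of the supports of the formulas in `Γ`. -/
def ctxSupp {S : L.Ctx} (Γ : Multiset (Formula L S)) : Set L.Nominal := {a | ∃ B ∈ Γ, a ∈ B.supp}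

/-- `c⃗` is a list of distinct nominal constants outside the set `X`. -/
def NomList.Fresh {αs : List L.Typ} (c : NomList L αs) (X : Set L.Nominal) : Prop :=
  c.toList.Nodup ∧ ∀ a ∈ c.toList, a ∉ X

/-- `π` is a permutation of the constants in `a⃗ c⃗`. -/
def NomPerm.Permutes {αs βs : List L.Typ} (π : NomPerm L) (a : NomList L αs) (c : NomList L βs) :
    Prop :=
  ∀ e : L.Nominal, π.perm e.1 e.2 ≠ e.2 → e ∈ a.toList ∨ e ∈ c.toList

/-- No nominal constant appears in the range of `θ`. -/
def Sub.NomFree {Γ Δ : L.Ctx} (θ : Sub L Γ Δ) : Prop :=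
  ∀ ⦃τ : L.Typ⦄ (x : Var Γ τ), (θ x).supp = ∅

/-- `Derivable D S Γ C`: the sequent `S : Γ ⊢ C` is derivable in the logic with definition `D`. -/
inductive Derivable (D : Set (Clause L)) :
    (S : L.Ctx) → Multiset (Formula L S) → Formula L S → Prop
  | id {S : L.Ctx} {Γ : Multiset (Formula L S)} {B B' : Formula L S} (π π' : NomPerm L) :
      B.permute π = B'.permute π' → Derivable D S (B ::ₘ Γ) B'
  | cut {S : L.Ctx} {Γ Δ : Multiset (Formula L S)} {C : Formula L S} (B : Formula L S) :
      Derivable D S Γ B → Derivable D S (B ::ₘ Δ) C → Derivable D S (Γ + Δ) C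
  | contrL {S : L.Ctx} {Γ : Multiset (Formula L S)} {B C : Formula L S} :
      Derivable D S (B ::ₘ B ::ₘ Γ) C → Derivable D S (B ::ₘ Γ) C
  | botL {S : L.Ctx} {Γ : Multiset (Formula L S)} {C : Formula L S} :
      Derivable D S (.bot ::ₘ Γ) C
  | topR {S : L.Ctx} {Γ : Multiset (Formula L S)} : Derivable D S Γ .top
  | orL {S : L.Ctx} {Γ : Multiset (Formula L S)} {B B' C : Formula L S} :
      Derivable D S (B ::ₘ Γ) C → Derivable D S (B' ::ₘ Γ) C →
        Derivable D S (.or B B' ::ₘ Γ) C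
  | orR₁ {S : L.Ctx} {Γ : Multiset (Formula L S)} {B B' : Formula L S} :
      Derivable D S Γ B → Derivable D S Γ (.or B B')
  | orR₂ {S : L.Ctx} {Γ : Multiset (Formula L S)} {B B' : Formula L S} :
      Derivable D S Γ B' → Derivable D S Γ (.or B B')
  | andL₁ {S : L.Ctx} {Γ : Multiset (Formula L S)} {B B' C : Formula L S} :
      Derivable D S (B ::ₘ Γ) C → Derivable D S (.and B B' ::ₘ Γ) C
  | andL₂ {S : L.Ctx} {Γ : Multiset (Formula L S)} {B B' C : Formula L S} :
      Derivable D S (B' ::ₘ Γ) C → Derivable D S (.and B B' ::ₘ Γ) C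
  | andR {S : L.Ctx} {Γ : Multiset (Formula L S)} {B B' : Formula L S} :
      Derivable D S Γ B → Derivable D S Γ B' → Derivable D S Γ (.and B B')
  | impL {S : L.Ctx} {Γ : Multiset (Formula L S)} {B B' C : Formula L S} :
      Derivable D S Γ B → Derivable D S (B' ::ₘ Γ) C → Derivable D S (.imp B B' ::ₘ Γ) C
  | impR {S : L.Ctx} {Γ : Multiset (Formula L S)} {B B' : Formula L S} :
      Derivable D S (B ::ₘ Γ) B' → Derivable D S Γ (.imp B B')
  | allL {S : L.Ctx} {Γ : Multiset (Formula L S)} {C : Formula L S} {τ : L.Typ}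
      {B : Formula L (τ :: S)} (t : Tm L S τ) :
      Derivable D S (B.inst t ::ₘ Γ) C → Derivable D S (.all τ B ::ₘ Γ) C
  | allR {S : L.Ctx} {Γ : Multiset (Formula L S)} {τ : L.Typ} {B : Formula L (τ :: S)}
      {αs : List L.Typ} (c : NomList L αs) :
      c.Lists B.supp →
      Derivable D (raiseTy αs τ :: S) (Γ.map (Formula.weaken (raiseTy αs τ)))
        (B.subst (Sub.cons (Tm.applyNoms c (Tm.var .here)) (Sub.wk S (raiseTy αs τ)))) →
      Derivable D S Γ (.all τ B)
  | nablaL {S : L.Ctx} {Γ : Multiset (Formula L S)} {C : Formula L S} {τ : L.Typ}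
      {B : Formula L (τ :: S)} (a : L.Nom τ) :
      (⟨τ, a⟩ : L.Nominal) ∉ B.supp →
      Derivable D S (B.inst (Tm.nom a) ::ₘ Γ) C → Derivable D S (.nabla τ B ::ₘ Γ) C
  | nablaR {S : L.Ctx} {Γ : Multiset (Formula L S)} {τ : L.Typ}
      {B : Formula L (τ :: S)} (a : L.Nom τ) :
      (⟨τ, a⟩ : L.Nominal) ∉ B.supp →
      Derivable D S Γ (B.inst (Tm.nom a)) → Derivable D S Γ (.nabla τ B)
  | exL {S : L.Ctx} {Γ : Multiset (Formula L S)} {C : Formula L S} {τ : L.Typ}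
      {B : Formula L (τ :: S)} {αs : List L.Typ} (c : NomList L αs) :
      c.Lists B.supp →
      Derivable D (raiseTy αs τ :: S)
        (B.subst (Sub.cons (Tm.applyNoms c (Tm.var .here)) (Sub.wk S (raiseTy αs τ))) ::ₘ
          Γ.map (Formula.weaken (raiseTy αs τ)))
        (C.weaken (raiseTy αs τ)) →
      Derivable D S (.ex τ B ::ₘ Γ) C
  | exR {S : L.Ctx} {Γ : Multiset (Formula L S)} {τ : L.Typ}
      {B : Formula L (τ :: S)} (t : Tm L S τ) :
      Derivable D S Γ (B.inst t) → Derivable D S Γ (.ex τ B)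
  /-- One premise for every clause, every permutation `π` of `a⃗ c⃗` and every `θ` (acting on the
  variables `h⃗` of the raised clause as `θ₁`, on those of the raised sequent as `θ₂`) with
  `(π.H')θ = A'θ`; `U` is the signature of the terms in the range of `θ`. -/
  | defL {S : L.Ctx} {Γ : Multiset (Formula L S)} {C : Formula L S} (p : L.Pred)
      (t : ∀ i : Fin (L.arity p).length, Tm L S ((L.arity p).get i))
      {αs : List L.Typ} (a : NomList L αs) (c : ∀ cl : Clause L, NomList L cl.nabs) :
      a.Lists (Formula.atom p t).supp →
      (∀ cl ∈ D, (c cl).Fresh ((Formula.atom p t).supp ∪ ctxSupp Γ ∪ C.supp)) →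
      (∀ cl ∈ D, ∀ (π : NomPerm L) (U : L.Ctx) (θ₁ : Sub L (raiseCtx αs cl.vars) U)
        (θ₂ : Sub L (raiseCtx cl.nabs S) U),
        π.Permutes a (c cl) → θ₁.NomFree → θ₂.NomFree →
        ((cl.raisedHead a (c cl)).permute π).subst θ₁
          = ((Formula.atom p t).subst (raiseSub (c cl) S)).subst θ₂ →
        Derivable D U
          (((cl.raisedBody a).permute π).subst θ₁ ::ₘ
            Γ.map (fun B => (B.subst (raiseSub (c cl) S)).subst θ₂))
          ((C.subst (raiseSub (c cl) S)).subst θ₂)) →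
      Derivable D S (.atom p t ::ₘ Γ) C
  /-- One clause, one `π` and one `θ` with `(π.H')θ = A'`. Only the terms that `θ` substitutes for
  the variables free in the head matter, and these must not contain nominal constants. -/
  | defR {S : L.Ctx} {Γ : Multiset (Formula L S)} (p : L.Pred)
      (t : ∀ i : Fin (L.arity p).length, Tm L S ((L.arity p).get i))
      {αs : List L.Typ} (a : NomList L αs) (cl : Clause L) (c : NomList L cl.nabs)
      (π : NomPerm L) (θ : Sub L (raiseCtx αs cl.vars) (raiseCtx cl.nabs S)) :
      a.Lists (Formula.atom p t).supp →
      cl ∈ D →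
      c.Fresh ((Formula.atom p t).supp ∪ ctxSupp Γ) →
      π.Permutes a c →
      (∀ ⦃τ : L.Typ⦄ (x : Var cl.vars τ), cl.head.HasVar (x.inr cl.nabs) →
        (θ (x.map (raiseTy αs))).supp = ∅) →
      ((cl.raisedHead a c).permute π).subst θ = (Formula.atom p t).subst (raiseSub c S) →
      Derivable D (raiseCtx cl.nabs S) (Γ.map (fun B => B.subst (raiseSub c S)))
        (((cl.raisedBody a).permute π).subst θ) →
      Derivable D S Γ (.atom p t)
  /-- The invariant `I` is a formula whose only free variable is the induction variable. -/
  | natL {S : L.Ctx} {Γ : Multiset (Formula L S)} {C : Formula L S} (I : Formula L [.nt])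
      (t : Tm L S .nt) :
      Derivable D [] 0 (I.inst Tm.zero) →
      Derivable D [.nt] {I} (I.subst (Sub.cons (Tm.succ (Tm.var .here)) (Sub.empty _))) →
      Derivable D S (I.subst (Sub.cons t (Sub.empty S)) ::ₘ Γ) C →
      Derivable D S (.nat t ::ₘ Γ) C
  | natR_zero {S : L.Ctx} {Γ : Multiset (Formula L S)} : Derivable D S Γ (.nat Tm.zero)
  | natR_succ {S : L.Ctx} {Γ : Multiset (Formula L S)} {t : Tm L S .nt} :
      Derivable D S Γ (.nat t) → Derivable D S Γ (.nat (Tm.succ t))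

/-- A formula over the signature `S` is provable if `S : ⊢ A` is derivable. -/
def Provable (D : Set (Clause L)) {S : L.Ctx} (A : Formula L S) : Prop := Derivable D S 0 A

end GLogic

namespace GLogic
variable {L : Lang.{u}}

/-! ### Simultaneous replacement of nominal constants and variables -/

/-! Consistency follows from soundness for a term model. Quantifiers range over closed terms, which
may contain nominal constants; `nat t` holds when `t` is a numeral; `∇x.B` holds when `B[a/x]` holds
for cofinitely many nominal constants `a`; the other atoms are read from a set `T` of closed atoms.
This is `Formula.Sat`.

The set `T` comes from stratification. `step D Y` maps `X` to the heads of clause instances whose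
body is true, antecedents of implications being read in `Y` and the rest in `X`, so it is monotone
in `X`. Iterating least fixed points level by level, with `Y` the preceding stage, gives the final
truth value of each atom at the stage of its level. The result satisfies `T = step D T T` and is
closed under permutations, because clauses contain no nominal constants
(`Stratified.exists_interpretation`).

A variable of a signature stands for a term without the nominal constants at hand; dependence on
these is expressed by raising. Accordingly a sequent is `Valid` if it is true under all closing
substitutions whose range avoids some finite set of constants. Equivariance of truth
(`Formula.sat_permute`) makes the choice of that set immaterial: it may always be taken to be the
support of the sequent (`Valid.sat`), since offending constants of the substitution can be renamed
away by a permutation fixing that support (`NomPerm.exists_avoiding`).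

`Derivable.valid` checks the rules. For `id_π` one avoids the constants that are moved. For `∀` on
the right and `∃` on the left every closed term is, up to such a renaming, of the form `h c⃗` with
`h` avoiding the given set (`Formula.exists_raised_witness`). For `∇` one fresh constant is as good
as any other (`Formula.sat_nabla_iff`). The rule `defR` produces a clause instance, hence an element
of `step D T T`. The rule `defL` is the hard one: a ground clause instance making the atom true has
to be lifted to a unifier free of nominal constants. To this end the instance is renamed, its stray
constants become variables of a new signature, and the remaining constants are abstracted by
raising.

If `A` and `A ⊃ ⊥` were both provable, `⊥` would be valid, which is impossible because every type
contains nominal constants outside any finite set, so an avoiding closing substitution exists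
(`not_valid_bot`). -/

abbrev NomSub (L : Lang.{u}) (Δ : L.Ctx) : Type u := ∀ ⦃τ : L.Typ⦄, L.Nom τ → Raw L Δ τ

/-- Replace the nominal constants according to `f` and the variables according to `s`. -/
def Raw.gsub : {Γ Δ : L.Ctx} → {τ : L.Typ} → Raw L Γ τ → NomSub L Δ → RawSub L Γ Δ → Raw L Δ τ
  | _, _, _, .var x, _, s => s x
  | _, _, _, .con k, _, _ => .con k
  | _, _, _, .zero, _, _ => .zero
  | _, _, _, .succ, _, _ => .succ
  | _, _, _, .nom a, f, _ => f a
  | _, _, _, .lam t, f, s => .lam (t.gsub (fun _ a => (f a).weaken _) (s.lift _))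
  | _, _, _, .app t u, f, s => .app (t.gsub f s) (u.gsub f s)

theorem Raw.gsub_rename {Γ : L.Ctx} {τ : L.Typ} (t : Raw L Γ τ) :
    ∀ {Δ Θ : L.Ctx} (r : Ren L Γ Δ) (f : NomSub L Θ) (s : RawSub L Δ Θ),
      (t.rename r).gsub f s = t.gsub f (fun _ x => s (r x)) := by
  induction t with
  | lam t ih =>
    intro Δ Θ r f s
    simp only [Raw.rename, Raw.gsub, ih]
    congr 2
    funext ρ x
    cases x <;> rfl
  | app t u iht ihu => intro Δ Θ r f s; simp only [Raw.rename, Raw.gsub, iht, ihu]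
  | _ => intros; rfl

theorem Raw.rename_gsub {Γ : L.Ctx} {τ : L.Typ} (t : Raw L Γ τ) :
    ∀ {Δ Θ : L.Ctx} (f : NomSub L Δ) (s : RawSub L Γ Δ) (r : Ren L Δ Θ),
      (t.gsub f s).rename r = t.gsub (fun _ a => (f a).rename r) (fun _ x => (s x).rename r) := by
  induction t with
  | lam t ih =>
    intro Δ Θ f s r
    simp only [Raw.rename, Raw.gsub, ih]
    congr 2
    · funext ρ a
      simp only [Raw.weaken, Raw.rename_rename]; rfl
    · funext ρ x
      cases x with
      | here => rfl
      | there x => simp only [RawSub.lift, Raw.weaken, Raw.rename_rename]; rfl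
  | app t u iht ihu => intro Δ Θ f s r; simp only [Raw.rename, Raw.gsub, iht, ihu]
  | _ => intros; rfl

theorem Raw.gsub_gsub {Γ : L.Ctx} {τ : L.Typ} (t : Raw L Γ τ) :
    ∀ {Δ Θ : L.Ctx} (f : NomSub L Δ) (s : RawSub L Γ Δ) (f' : NomSub L Θ) (s' : RawSub L Δ Θ),
      (t.gsub f s).gsub f' s' =
        t.gsub (fun _ a => (f a).gsub f' s') (fun _ x => (s x).gsub f' s') := by
  induction t with
  | lam t ih =>
    intro Δ Θ f s f' s'
    simp only [Raw.gsub, ih]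
    congr 2
    · funext ρ a
      simp only [Raw.weaken, Raw.gsub_rename, Raw.rename_gsub]; rfl
    · funext ρ x
      cases x with
      | here => rfl
      | there x =>
        simp only [RawSub.lift, Raw.weaken, Raw.gsub_rename, Raw.rename_gsub]
  | app t u iht ihu => intro Δ Θ f s f' s'; simp only [Raw.gsub, iht, ihu]
  | _ => intros; rfl

/-- This turns the absence of a constant or variable from a chosen representative into an equality
of terms. -/
theorem Raw.gsub_congr {Γ : L.Ctx} {τ : L.Typ} (t : Raw L Γ τ) :
    ∀ {Δ : L.Ctx} {f f' : NomSub L Δ} {s s' : RawSub L Γ Δ},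
      (∀ ⦃σ⦄ (a : L.Nom σ), t.HasNom ⟨σ, a⟩ → f a = f' a) →
      (∀ ⦃σ⦄ (x : Var Γ σ), t.HasVar x → s x = s' x) → t.gsub f s = t.gsub f' s' := by
  induction t with
  | var x => intro Δ f f' s s' _ h; exact h x rfl
  | nom a => intro Δ f f' s s' h _; exact h a rfl
  | lam t ih =>
    intro Δ f f' s s' hf hs
    simp only [Raw.gsub]
    congr 1
    refine ih (fun ρ a ha => by rw [hf a ha]) (fun ρ x hx => ?_)
    cases x with
    | here => rfl
    | there x => simp only [RawSub.lift]; rw [hs x hx]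
  | app t u iht ihu =>
    intro Δ f f' s s' hf hs
    simp only [Raw.gsub]
    rw [iht (fun _ a h => hf a (.inl h)) (fun _ x h => hs x (.inl h)),
      ihu (fun _ a h => hf a (.inr h)) (fun _ x h => hs x (.inr h))]
  | _ => intros; rfl

/-- Substitution and permutation are both instances of `gsub`, so `Raw.gsub_gsub` supplies the
composition laws for mixtures of them. -/
theorem Raw.subst_eq_gsub {Γ : L.Ctx} {τ : L.Typ} (t : Raw L Γ τ) :
    ∀ {Δ : L.Ctx} (s : RawSub L Γ Δ), t.subst s = t.gsub (fun _ a => .nom a) s := by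
  induction t with
  | lam t ih => intro Δ s; simp only [Raw.subst, Raw.gsub, ih]; rfl
  | app t u iht ihu => intro Δ s; simp only [Raw.subst, Raw.gsub, iht, ihu]
  | _ => intros; rfl

theorem Raw.permute_eq_gsub (π : NomPerm L) {Γ : L.Ctx} {τ : L.Typ} (t : Raw L Γ τ) :
    t.permute π = t.gsub (fun τ a => .nom (π.perm τ a)) (fun _ x => .var x) := by
  induction t with
  | lam t ih =>
    simp only [Raw.permute, Raw.gsub, ih]
    congr 2
    funext ρ x
    cases x <;> rfl
  | app t u iht ihu => simp only [Raw.permute, Raw.gsub, iht, ihu]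
  | _ => rfl

theorem Raw.gsub_id {Γ : L.Ctx} {τ : L.Typ} (t : Raw L Γ τ) :
    t.gsub (fun _ a => .nom a) (fun _ x => .var x) = t := by
  rw [← Raw.subst_eq_gsub, Raw.subst_var]

/-- Nominal constants are inert for beta and eta, so putting arbitrary terms for them respects
conversion. This is what later allows constants of a term, not only of a preterm, to be exchanged
for variables. -/
theorem Conv.gsub {Γ : L.Ctx} {τ : L.Typ} {t t' : Raw L Γ τ} (h : Conv t t') :
    ∀ {Δ : L.Ctx} (f : NomSub L Δ) (s : RawSub L Γ Δ), Conv (t.gsub f s) (t'.gsub f s) := by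
  induction h with
  | refl t => intro Δ f s; exact .refl _
  | symm _ ih => intro Δ f s; exact .symm (ih f s)
  | trans _ _ ih ih' => intro Δ f s; exact .trans (ih f s) (ih' f s)
  | lam _ ih => intro Δ f s; exact .lam (ih _ _)
  | app _ _ ih ih' => intro Δ f s; exact .app (ih f s) (ih' f s)
  | beta t u =>
    intro Δ f s
    have e : (t.subst (RawSub.single u)).gsub f s
        = (t.gsub (fun _ a => (f a).weaken _) (s.lift _)).subst (RawSub.single (u.gsub f s)) := by
      rw [Raw.subst_eq_gsub, Raw.subst_eq_gsub, Raw.gsub_gsub, Raw.gsub_gsub]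
      congr 1
      · funext ρ a
        simp only [Raw.weaken, Raw.gsub_rename]
        exact (Raw.gsub_id _).symm
      · funext ρ x
        cases x with
        | here => rfl
        | there x =>
          simp only [RawSub.lift, Raw.weaken, Raw.gsub_rename]
          exact (Raw.gsub_id _).symm
    rw [e]
    exact .beta _ _
  | eta t =>
    intro Δ f s
    have e : ∀ σ, (t.weaken σ).gsub (fun _ a => (f a).weaken _) (s.lift σ)
        = (t.gsub f s).weaken σ := by
      intro σ
      simp only [Raw.weaken, Raw.gsub_rename, Raw.rename_gsub]
      rfl
    simp only [Raw.gsub, e]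
    exact .eta _

theorem Raw.hasNom_rename {Γ : L.Ctx} {τ : L.Typ} (a : L.Nominal) (t : Raw L Γ τ) :
    ∀ {Δ : L.Ctx} (r : Ren L Γ Δ), (t.rename r).HasNom a ↔ t.HasNom a := by
  induction t with
  | lam t ih => intro Δ r; exact ih _
  | app t u iht ihu => intro Δ r; simp only [Raw.rename, Raw.HasNom, iht, ihu]
  | _ => intros; rfl

theorem Raw.hasNom_gsub {Γ : L.Ctx} {τ : L.Typ} (a : L.Nominal) (t : Raw L Γ τ) :
    ∀ {Δ : L.Ctx} {f : NomSub L Δ} {s : RawSub L Γ Δ}, (t.gsub f s).HasNom a →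
      (∃ b : L.Nominal, t.HasNom b ∧ (f b.2).HasNom a) ∨
        ∃ (ρ : L.Typ) (x : Var Γ ρ), (s x).HasNom a := by
  induction t with
  | var x => intro Δ f s h; exact .inr ⟨_, x, h⟩
  | nom b => intro Δ f s h; exact .inl ⟨⟨_, b⟩, rfl, h⟩
  | lam t ih =>
    intro Δ f s h
    rcases ih h with ⟨b, hb, h⟩ | ⟨ρ, x, h⟩
    · exact .inl ⟨b, hb, (Raw.hasNom_rename _ _ _).1 h⟩
    · cases x with
      | here => exact h.elim
      | there x => exact .inr ⟨ρ, x, (Raw.hasNom_rename _ _ _).1 h⟩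
  | app t u iht ihu =>
    intro Δ f s h
    rcases h with h | h
    · exact (iht h).imp (fun ⟨b, hb, h⟩ => ⟨b, .inl hb, h⟩) id
    · exact (ihu h).imp (fun ⟨b, hb, h⟩ => ⟨b, .inr hb, h⟩) id
  | _ => intro Δ f s h; exact h.elim

theorem Raw.finite_hasNom {Γ : L.Ctx} {τ : L.Typ} (t : Raw L Γ τ) :
    {a | t.HasNom a}.Finite := by
  induction t with
  | nom b => exact Set.finite_singleton (⟨_, b⟩ : L.Nominal)
  | lam t ih => exact ih
  | app t u iht ihu => exact iht.union ihu
  | _ => exact Set.finite_empty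

/-! ### Permutations of nominal constants -/

namespace NomPerm

/-- The action on nominal constants of all types. -/
def act (π : NomPerm L) (e : L.Nominal) : L.Nominal := ⟨e.1, π.perm e.1 e.2⟩

theorem act_ne_iff (π : NomPerm L) (e : L.Nominal) : π.act e ≠ e ↔ π.perm e.1 e.2 ≠ e.2 := by
  obtain ⟨τ, a⟩ := e
  simp [act]

theorem act_injective (π : NomPerm L) : Function.Injective π.act := by
  rintro ⟨τ, a⟩ ⟨σ, b⟩ h
  simp only [act, Sigma.mk.injEq] at h
  obtain ⟨rfl, h⟩ := h
  rw [(π.perm τ).injective (eq_of_heq h)]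

theorem finite_act (π : NomPerm L) : {e | π.act e ≠ e}.Finite := by
  simpa only [act_ne_iff] using π.finite

theorem act_moved (π : NomPerm L) {e : L.Nominal} (h : π.act e ≠ e) :
    π.act (π.act e) ≠ π.act e := fun h' => h (π.act_injective h')

def one : NomPerm L := ⟨fun _ => 1, by simp⟩

def inv (π : NomPerm L) : NomPerm L :=
  ⟨fun τ => (π.perm τ).symm, by
    refine π.finite.subset fun e h h' => h ?_
    exact (Equiv.symm_apply_eq _).2 h'.symm⟩

def comp (π π' : NomPerm L) : NomPerm L :=
  ⟨fun τ => π.perm τ * π'.perm τ, by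
    refine (π.finite.union π'.finite).subset fun e h => ?_
    by_contra h'
    simp only [Set.mem_union, Set.mem_ofPred_eq, not_or, not_not] at h'
    exact h (by simp [h'.1, h'.2])⟩

theorem act_one (e : L.Nominal) : (one : NomPerm L).act e = e := rfl

theorem act_comp (π π' : NomPerm L) (e : L.Nominal) : (π.comp π').act e = π.act (π'.act e) := rfl

theorem act_act_inv (π : NomPerm L) (e : L.Nominal) : π.act (π.inv.act e) = e :=
  Sigma.ext rfl (heq_of_eq ((π.perm e.1).apply_symm_apply e.2))

theorem act_inv_act (π : NomPerm L) (e : L.Nominal) : π.inv.act (π.act e) = e :=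
  Sigma.ext rfl (heq_of_eq ((π.perm e.1).symm_apply_apply e.2))

open Classical in
/-- The exchange of two nominal constants of the same type. -/
theorem exists_swap {τ : L.Typ} (a b : L.Nom τ) :
    ∃ π : NomPerm L, ∀ e, π.act e = Equiv.swap (⟨τ, a⟩ : L.Nominal) ⟨τ, b⟩ e := by
  let g : ∀ ρ : L.Typ, Equiv.Perm (L.Nom ρ) := fun ρ =>
    if h : ρ = τ then h ▸ Equiv.swap a b else 1
  have hg : ∀ e : L.Nominal,
      (⟨e.1, g e.1 e.2⟩ : L.Nominal) = Equiv.swap (⟨τ, a⟩ : L.Nominal) ⟨τ, b⟩ e := by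
    rintro ⟨ρ, e⟩
    by_cases h : ρ = τ
    · subst h
      simp only [g, dif_pos, Equiv.swap_apply_def]
      simp only [Sigma.mk.injEq, heq_eq_eq, true_and]
      split_ifs <;> rfl
    · rw [Equiv.swap_apply_of_ne_of_ne]
      · simp [g, h]
      · intro h'; exact h (congrArg Sigma.fst h')
      · intro h'; exact h (congrArg Sigma.fst h')
  refine ⟨⟨g, ?_⟩, hg⟩
  refine (Set.toFinite {(⟨τ, a⟩ : L.Nominal), ⟨τ, b⟩}).subset fun e he => ?_
  by_contra h
  simp only [Set.mem_insert_iff, Set.mem_singleton_iff, not_or] at h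
  have := hg e
  rw [Equiv.swap_apply_of_ne_of_ne h.1 h.2] at this
  obtain ⟨ρ, e⟩ := e
  simp at this
  exact he this

end NomPerm

theorem exists_nom_notMem (τ : L.Typ) {X : Set L.Nominal} (hX : X.Finite) :
    ∃ a : L.Nom τ, (⟨τ, a⟩ : L.Nominal) ∉ X := by
  have := L.nom_infinite τ
  have h : ((fun a : L.Nom τ => (⟨τ, a⟩ : L.Nominal)) ⁻¹' X).Finite :=
    hX.preimage fun a _ b _ h => by simpa using h
  obtain ⟨a, ha⟩ := h.exists_notMem
  exact ⟨a, ha⟩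

/-- Renaming away from `X` while fixing `F`. By induction on `Y`: if the image of the new element
falls into `X`, it is exchanged with a constant outside `F`, `X` and the image of the earlier
elements, which leaves what was achieved before intact. -/
theorem NomPerm.exists_avoiding {F X Y : Set L.Nominal} (hF : F.Finite) (hX : X.Finite)
    (hY : Y.Finite) :
    ∃ π : NomPerm L, (∀ e ∈ F, π.act e = e) ∧ ∀ e ∈ Y, e ∉ F → π.act e ∉ X := by
  classical
  induction Y, hY using Set.Finite.induction_on with
  | empty => exact ⟨.one, fun e _ => rfl, fun e he => he.elim⟩
  | @insert y Y _ hY ih =>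
    obtain ⟨π, hπF, hπX⟩ := ih
    by_cases hy : y ∉ F ∧ π.act y ∈ X
    · obtain ⟨z, hz⟩ := exists_nom_notMem (L := L) (π.act y).1
        ((hF.union hX).union (hY.image π.act))
      simp only [Set.mem_union, not_or] at hz
      obtain ⟨⟨hzF, hzX⟩, hzY⟩ := hz
      obtain ⟨σ, hσ⟩ := NomPerm.exists_swap (π.act y).2 z
      -- If `π y` were in `F` it would be fixed by `π`, and injectivity would give `π y = y`, which
      -- is not in `F`.
      have hyF : π.act y ∉ F := fun h => hy.1 (by
        rw [← π.act_injective (hπF _ h)]; exact h)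
      refine ⟨σ.comp π, fun e he => ?_, fun e he heF => ?_⟩
      · rw [NomPerm.act_comp, hπF e he, hσ]
        exact Equiv.swap_apply_of_ne_of_ne (fun h =>
          hyF (show (⟨(π.act y).1, (π.act y).2⟩ : L.Nominal) ∈ F from h ▸ he))
          (fun h => hzF (h ▸ he))
      · rw [NomPerm.act_comp, hσ]
        by_cases hey : e = y
        · subst hey
          have : Equiv.swap (⟨(π.act e).1, (π.act e).2⟩ : L.Nominal) ⟨_, z⟩ (π.act e) = ⟨_, z⟩ :=
            Equiv.swap_apply_left _ _
          rw [this]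
          exact hzX
        · have heY : e ∈ Y := he.resolve_left hey
          rw [Equiv.swap_apply_of_ne_of_ne]
          · exact hπX e heY heF
          · intro h
            exact hπX e heY heF (h ▸ hy.2)
          · intro h
            exact hzY (h ▸ Set.mem_image_of_mem _ heY)
    · refine ⟨π, hπF, fun e he heF => ?_⟩
      rcases he with rfl | he
      · exact fun h => hy ⟨heF, h⟩
      · exact hπX e he heF

/-! ### Action of permutations on preterms -/

theorem Raw.hasNom_permute (π : NomPerm L) {Γ : L.Ctx} {τ : L.Typ} (t : Raw L Γ τ)
    (a : L.Nominal) : (t.permute π).HasNom a ↔ ∃ b, t.HasNom b ∧ π.act b = a := by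
  constructor
  · intro h
    rw [Raw.permute_eq_gsub] at h
    rcases t.hasNom_gsub a h with ⟨b, hb, h⟩ | ⟨ρ, x, h⟩
    · exact ⟨b, hb, h.symm⟩
    · exact h.elim
  · rintro ⟨b, hb, rfl⟩
    induction t with
    | nom c => cases hb; rfl
    | lam t ih => exact ih hb
    | app t u iht ihu => exact hb.imp iht ihu
    | _ => exact hb.elim

theorem Raw.permute_eq_self (π : NomPerm L) {Γ : L.Ctx} {τ : L.Typ} (t : Raw L Γ τ)
    (h : ∀ a, t.HasNom a → π.act a = a) : t.permute π = t := by
  rw [Raw.permute_eq_gsub]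
  conv_rhs => rw [← t.gsub_id]
  refine t.gsub_congr (fun σ a ha => ?_) (fun _ _ _ => rfl)
  have := h ⟨σ, a⟩ ha
  simp only [NomPerm.act, Sigma.mk.injEq, heq_eq_eq, true_and] at this
  rw [this]

theorem Raw.permute_permute (π π' : NomPerm L) {Γ : L.Ctx} {τ : L.Typ} (t : Raw L Γ τ) :
    (t.permute π').permute π = t.permute (π.comp π') := by
  simp only [Raw.permute_eq_gsub, Raw.gsub_gsub]
  rfl

/-! ### Supports of terms -/

theorem Tm.exists_mk {Γ : L.Ctx} {τ : L.Typ} (t : Tm L Γ τ) : ∃ r, Tm.mk r = t :=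
  Quotient.exists_rep t

theorem Tm.mk_eq_of_conv {Γ : L.Ctx} {τ : L.Typ} {r r' : Raw L Γ τ} (h : Conv r r') :
    Tm.mk r = Tm.mk r' := Quotient.sound h

theorem Tm.permute_mk (π : NomPerm L) {Γ : L.Ctx} {τ : L.Typ} (r : Raw L Γ τ) :
    (Tm.mk r).permute π = Tm.mk (r.permute π) := rfl

theorem Tm.app_mk {Γ : L.Ctx} {σ τ : L.Typ} (r : Raw L Γ (.arr σ τ)) (r' : Raw L Γ σ) :
    (Tm.mk r).app (Tm.mk r') = Tm.mk (r.app r') := rfl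

theorem Tm.weaken_mk {Γ : L.Ctx} {τ : L.Typ} (σ : L.Typ) (r : Raw L Γ τ) :
    (Tm.mk r).weaken σ = Tm.mk (r.weaken σ) := rfl

theorem Tm.notMem_supp {Γ : L.Ctx} {τ : L.Typ} {t : Tm L Γ τ} {a : L.Nominal} :
    a ∉ t.supp ↔ ∃ r, Tm.mk r = t ∧ ¬ r.HasNom a := by
  simp [Tm.supp]

theorem Tm.supp_mk_subset {Γ : L.Ctx} {τ : L.Typ} (r : Raw L Γ τ) {a : L.Nominal}
    (h : a ∈ (Tm.mk r).supp) : r.HasNom a := h r rfl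

theorem Tm.finite_supp {Γ : L.Ctx} {τ : L.Typ} (t : Tm L Γ τ) : t.supp.Finite := by
  obtain ⟨r, rfl⟩ := t.exists_mk
  exact r.finite_hasNom.subset fun a => Tm.supp_mk_subset r

/-- A representative avoiding any given finite set of constants outside the support. -/
theorem Tm.exists_mk_avoiding {Γ : L.Ctx} {τ : L.Typ} (t : Tm L Γ τ) {G : Set L.Nominal}
    (hG : G.Finite) (h : ∀ a ∈ G, a ∉ t.supp) :
    ∃ r, Tm.mk r = t ∧ ∀ a ∈ G, ¬ r.HasNom a := by
  classical
  induction G, hG using Set.Finite.induction_on with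
  | empty =>
    obtain ⟨r, hr⟩ := t.exists_mk
    exact ⟨r, hr, fun a ha => ha.elim⟩
  | @insert a G _ hG ih =>
    obtain ⟨r, hr, hrG⟩ := ih fun b hb => h b (.inr hb)
    obtain ⟨q, hq, hqa⟩ := Tm.notMem_supp.1 (h a (.inl rfl))
    -- Here `r` avoids `G` and `q` avoids `a`. Exchanging `a` with a constant `b` new for `r`, `q`
    -- and `G` fixes `q`, hence the term; applied to `r` it removes `a` and brings in no constant of
    -- `G`.
    obtain ⟨b, hb⟩ := exists_nom_notMem (L := L) a.1
      ((r.finite_hasNom.union q.finite_hasNom).union hG)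
    simp only [Set.mem_union, Set.mem_ofPred_eq, not_or] at hb
    obtain ⟨⟨hbr, hbq⟩, hbG⟩ := hb
    obtain ⟨π, hπ⟩ := NomPerm.exists_swap a.2 b
    replace hπ : ∀ e, π.act e = Equiv.swap a ⟨a.1, b⟩ e := hπ
    refine ⟨r.permute π, ?_, fun c hc => ?_⟩
    · have e : q.permute π = q := by
        refine q.permute_eq_self π fun c hc => ?_
        rw [hπ, Equiv.swap_apply_of_ne_of_ne]
        · rintro rfl; exact hqa hc
        · rintro rfl; exact hbq hc
      rw [← hq, ← e, ← Tm.permute_mk, ← Tm.permute_mk, hr, hq]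
    · rw [Raw.hasNom_permute]
      rintro ⟨d, hd, rfl⟩
      rw [hπ] at hc
      rcases eq_or_ne d a with rfl | hda
      · rw [Equiv.swap_apply_left] at hc
        rcases hc with hc | hc
        · rw [hc] at hbr
          exact hbr hd
        · exact hbG hc
      · have hdb : d ≠ ⟨a.1, b⟩ := by rintro rfl; exact hbr hd
        rw [Equiv.swap_apply_of_ne_of_ne hda hdb] at hc
        rcases hc with hc | hc
        · exact hda hc
        · exact hrG d hc hd

/-- Only finitely many constants are moved, so a single representative avoids all of them, and it is
fixed literally. -/
theorem Tm.permute_eq_self (π : NomPerm L) {Γ : L.Ctx} {τ : L.Typ} (t : Tm L Γ τ)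
    (h : ∀ a ∈ t.supp, π.act a = a) : t.permute π = t := by
  obtain ⟨r, rfl, hr⟩ := t.exists_mk_avoiding π.finite_act fun a ha h' => ha (h a h')
  rw [Tm.permute_mk, r.permute_eq_self]
  intro a ha
  by_contra h'
  exact hr a h' ha

theorem Tm.permute_permute (π π' : NomPerm L) {Γ : L.Ctx} {τ : L.Typ} (t : Tm L Γ τ) :
    (t.permute π').permute π = t.permute (π.comp π') := by
  obtain ⟨r, rfl⟩ := t.exists_mk
  simp only [Tm.permute_mk, Raw.permute_permute]

theorem Tm.permute_inv_permute (π : NomPerm L) {Γ : L.Ctx} {τ : L.Typ} (t : Tm L Γ τ) :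
    (t.permute π).permute π.inv = t := by
  rw [Tm.permute_permute]
  exact t.permute_eq_self _ fun a _ => π.act_inv_act a

theorem Tm.mem_supp_of_permute (π : NomPerm L) {Γ : L.Ctx} {τ : L.Typ} (t : Tm L Γ τ)
    {a : L.Nominal} (h : a ∈ (t.permute π).supp) : ∃ b ∈ t.supp, π.act b = a := by
  refine ⟨π.inv.act a, ?_, π.act_act_inv a⟩
  by_contra h'
  obtain ⟨r, rfl, hr⟩ := Tm.notMem_supp.1 h'
  obtain ⟨b, hb, rfl⟩ := (r.hasNom_permute π a).1 (Tm.supp_mk_subset _ h)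
  rw [π.act_inv_act] at hr
  exact hr hb

theorem Tm.supp_var {Γ : L.Ctx} {τ : L.Typ} (x : Var Γ τ) : (Tm.var x : Tm L Γ τ).supp = ∅ :=
  Set.eq_empty_of_forall_notMem fun _ h => Tm.supp_mk_subset (Raw.var x) h

theorem Tm.supp_nom {Γ : L.Ctx} {τ : L.Typ} (b : L.Nom τ) {a : L.Nominal}
    (h : a ∈ (Tm.nom b : Tm L Γ τ).supp) : a = ⟨τ, b⟩ := Tm.supp_mk_subset (Raw.nom b) h

theorem Tm.supp_weaken {Γ : L.Ctx} {σ τ : L.Typ} (t : Tm L Γ τ) : (t.weaken σ).supp ⊆ t.supp := by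
  intro a h
  by_contra h'
  obtain ⟨r, rfl, hr⟩ := Tm.notMem_supp.1 h'
  exact hr ((Raw.hasNom_rename a r _).1 (Tm.supp_mk_subset _ h))

theorem Tm.supp_app {Γ : L.Ctx} {σ τ : L.Typ} (t : Tm L Γ (.arr σ τ)) (t' : Tm L Γ σ) :
    (t.app t').supp ⊆ t.supp ∪ t'.supp := by
  intro a h
  by_contra h'
  simp only [Set.mem_union, not_or] at h'
  obtain ⟨r, rfl, hr⟩ := Tm.notMem_supp.1 h'.1
  obtain ⟨r', rfl, hr'⟩ := Tm.notMem_supp.1 h'.2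
  exact (Tm.supp_mk_subset (r.app r') h).elim hr hr'

theorem Sub.exists_mk {Γ Δ : L.Ctx} (s : Sub L Γ Δ) :
    ∃ q : RawSub L Γ Δ, s = fun _ x => Tm.mk (q x) :=
  ⟨fun _ x => (s x).out, by funext τ x; exact (Quotient.out_eq (s x)).symm⟩

theorem Tm.supp_subst {Γ Δ : L.Ctx} {τ : L.Typ} (t : Tm L Γ τ) (s : Sub L Γ Δ) {a : L.Nominal}
    (h : a ∈ (t.subst s).supp) : a ∈ t.supp ∨ ∃ (ρ : L.Typ) (x : Var Γ ρ), a ∈ (s x).supp := by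
  by_contra h'
  simp only [not_or, not_exists] at h'
  obtain ⟨r, rfl, hr⟩ := Tm.notMem_supp.1 h'.1
  have := fun ρ x => Tm.notMem_supp.1 (h'.2 ρ x)
  choose q hq hqa using this
  have e : s = fun ρ x => Tm.mk (q ρ x) := by funext ρ x; exact (hq ρ x).symm
  rw [e, Tm.subst_mk] at h
  have := Tm.supp_mk_subset _ h
  rw [Raw.subst_eq_gsub] at this
  rcases r.hasNom_gsub a this with ⟨b, hb, h⟩ | ⟨ρ, x, h⟩
  · cases h; exact hr hb
  · exact hqa _ _ h

/-! ### Substitution algebra -/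

/-- Composition of substitutions. -/
noncomputable def Sub.comp {Γ Δ Θ : L.Ctx} (s : Sub L Γ Δ) (s' : Sub L Δ Θ) : Sub L Γ Θ :=
  fun _ x => (s x).subst s'

def Sub.permute (π : NomPerm L) {Γ Δ : L.Ctx} (s : Sub L Γ Δ) : Sub L Γ Δ :=
  fun _ x => (s x).permute π

theorem Tm.subst_var {Γ Δ : L.Ctx} {τ : L.Typ} (x : Var Γ τ) (s : Sub L Γ Δ) :
    (Tm.var x : Tm L Γ τ).subst s = s x := by
  obtain ⟨q, rfl⟩ := s.exists_mk
  exact Tm.subst_mk _ _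

theorem Tm.subst_nom {Γ Δ : L.Ctx} {τ : L.Typ} (a : L.Nom τ) (s : Sub L Γ Δ) :
    (Tm.nom a : Tm L Γ τ).subst s = Tm.nom a := by
  obtain ⟨q, rfl⟩ := s.exists_mk
  exact Tm.subst_mk _ _

theorem Tm.subst_app {Γ Δ : L.Ctx} {σ τ : L.Typ} (t : Tm L Γ (.arr σ τ)) (t' : Tm L Γ σ)
    (s : Sub L Γ Δ) : (t.app t').subst s = (t.subst s).app (t'.subst s) := by
  obtain ⟨q, rfl⟩ := s.exists_mk
  obtain ⟨r, rfl⟩ := t.exists_mk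
  obtain ⟨r', rfl⟩ := t'.exists_mk
  simp only [Tm.app_mk, Tm.subst_mk]
  rfl

theorem Tm.subst_zero {Γ Δ : L.Ctx} (s : Sub L Γ Δ) : (Tm.zero : Tm L Γ .nt).subst s = .zero := by
  obtain ⟨q, rfl⟩ := s.exists_mk
  exact Tm.subst_mk _ _

theorem Tm.subst_succ {Γ Δ : L.Ctx} (t : Tm L Γ .nt) (s : Sub L Γ Δ) :
    t.succ.subst s = (t.subst s).succ := by
  rw [Tm.succ, Tm.subst_app, Tm.succ]
  obtain ⟨q, rfl⟩ := s.exists_mk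
  rfl

theorem Tm.subst_subst {Γ Δ Θ : L.Ctx} {τ : L.Typ} (t : Tm L Γ τ) (s : Sub L Γ Δ)
    (s' : Sub L Δ Θ) : (t.subst s).subst s' = t.subst (s.comp s') := by
  obtain ⟨q, rfl⟩ := s.exists_mk
  obtain ⟨q', rfl⟩ := s'.exists_mk
  obtain ⟨r, rfl⟩ := t.exists_mk
  have e : Sub.comp (fun _ x => Tm.mk (q x)) (fun _ x => Tm.mk (q' x))
      = fun _ x => Tm.mk ((q x).subst q') := by
    funext ρ x
    exact Tm.subst_mk _ _
  rw [e]
  simp only [Tm.subst_mk, Raw.subst_subst]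

theorem Tm.permute_subst (π : NomPerm L) {Γ Δ : L.Ctx} {τ : L.Typ} (t : Tm L Γ τ)
    (s : Sub L Γ Δ) : (t.subst s).permute π = (t.permute π).subst (s.permute π) := by
  obtain ⟨q, rfl⟩ := s.exists_mk
  obtain ⟨r, rfl⟩ := t.exists_mk
  have e : Sub.permute π (fun _ x => Tm.mk (q x)) = fun _ x => Tm.mk ((q x).permute π) := rfl
  rw [e]
  simp only [Tm.subst_mk, Tm.permute_mk, Raw.permute_subst]

theorem Tm.weaken_eq_subst {Γ : L.Ctx} {τ : L.Typ} (σ : L.Typ) (t : Tm L Γ τ) :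
    t.weaken σ = t.subst (Sub.wk Γ σ) := by
  obtain ⟨r, rfl⟩ := t.exists_mk
  rw [Tm.weaken_mk, Raw.weaken, Raw.rename_eq_subst, ← Tm.subst_mk]
  rfl

theorem Tm.permute_weaken (π : NomPerm L) {Γ : L.Ctx} {σ τ : L.Typ} (t : Tm L Γ τ) :
    (t.weaken σ).permute π = (t.permute π).weaken σ := by
  obtain ⟨r, rfl⟩ := t.exists_mk
  simp only [Tm.weaken_mk, Tm.permute_mk, Raw.weaken, Raw.permute_rename]

theorem Sub.cons_comp {Γ Δ Θ : L.Ctx} {σ : L.Typ} (t : Tm L Δ σ) (s : Sub L Γ Δ)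
    (s' : Sub L Δ Θ) : (Sub.cons t s).comp s' = Sub.cons (t.subst s') (s.comp s') := by
  funext τ x; cases x <;> rfl

theorem Sub.permute_cons (π : NomPerm L) {Γ Δ : L.Ctx} {σ : L.Typ} (t : Tm L Δ σ)
    (s : Sub L Γ Δ) : (Sub.cons t s).permute π = Sub.cons (t.permute π) (s.permute π) := by
  funext τ x; cases x <;> rfl

theorem Sub.wk_comp_cons {Γ Δ : L.Ctx} {σ : L.Typ} (t : Tm L Δ σ) (s : Sub L Γ Δ) :
    (Sub.wk Γ σ).comp (Sub.cons t s) = s := by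
  funext τ x
  exact Tm.subst_var _ _

theorem Sub.var_comp {Γ Δ : L.Ctx} (s : Sub L Γ Δ) :
    Sub.comp (fun _ x => Tm.var x) s = s := by
  funext τ x
  exact Tm.subst_var _ _

theorem Sub.lift_comp_cons {Γ Δ Θ : L.Ctx} {σ : L.Typ} (s : Sub L Γ Δ) (t : Tm L Θ σ)
    (s' : Sub L Δ Θ) : (s.lift σ).comp (Sub.cons t s') = Sub.cons t (s.comp s') := by
  funext τ x
  cases x with
  | here => exact Tm.subst_var _ _
  | there x =>
    change ((s x).weaken σ).subst _ = (s x).subst s'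
    rw [Tm.weaken_eq_subst, Tm.subst_subst, Sub.wk_comp_cons]

theorem Sub.permute_lift (π : NomPerm L) {Γ Δ : L.Ctx} (s : Sub L Γ Δ) (σ : L.Typ) :
    (s.lift σ).permute π = (s.permute π).lift σ := by
  funext τ x
  cases x with
  | here => rfl
  | there x => exact Tm.permute_weaken π (s x)

theorem Sub.empty_comp {Δ Θ : L.Ctx} (s : Sub L Δ Θ) : (Sub.empty Δ).comp s = Sub.empty Θ := by
  funext τ x; cases x

theorem Sub.append_comp {Γ Δ Ξ : L.Ctx} : ∀ {Θ : L.Ctx} (s : Sub L Θ Δ) (s' : Sub L Γ Δ)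
    (r : Sub L Δ Ξ), (Sub.append s s').comp r = Sub.append (s.comp r) (s'.comp r)
  | [], _, _, _ => rfl
  | _ :: _, s, s', r => by
    simp only [Sub.append, Sub.cons_comp, Sub.append_comp]
    rfl

theorem Sub.permute_append (π : NomPerm L) {Γ Δ : L.Ctx} : ∀ {Θ : L.Ctx} (s : Sub L Θ Δ)
    (s' : Sub L Γ Δ),
    (Sub.append s s').permute π = Sub.append (s.permute π) (s'.permute π)
  | [], _, _ => rfl
  | _ :: _, s, s' => by
    simp only [Sub.append, Sub.permute_cons, Sub.permute_append]
    rfl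

/-- Two substitutions with the same part on `Θ` agree wherever their parts on `Γ` do. -/
theorem Sub.append_congr {Γ Δ : L.Ctx} : ∀ {Θ : L.Ctx} (s : Sub L Θ Δ) (s' s'' : Sub L Γ Δ)
    {P : ∀ ⦃τ : L.Typ⦄, Var (Θ ++ Γ) τ → Prop},
    (∀ ⦃τ⦄ (x : Var Γ τ), P (x.inr Θ) → s' x = s'' x) →
    ∀ ⦃τ⦄ (x : Var (Θ ++ Γ) τ), P x → Sub.append s s' x = Sub.append s s'' x
  | [], _, _, _, _, h, _, x, hx => h x hx
  | _ :: _, _, _, _, _, _, _, .here, _ => rfl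
  | _ :: _, s, s', s'', P, h, _, .there x, hx =>
    Sub.append_congr (fun _ x => s (.there x)) s' s'' (P := fun _ x => P (.there x)) h x hx

/-! ### Finiteness of signatures, dependence on the free variables -/

theorem finite_var : ∀ Γ : L.Ctx, Finite (Σ τ : L.Typ, Var Γ τ)
  | [] => by
    have : IsEmpty (Σ τ : L.Typ, Var ([] : L.Ctx) τ) := ⟨fun x => nomatch x.2⟩
    infer_instance
  | σ :: Γ => by
    have := finite_var Γ
    refine Finite.of_surjective
      (fun o : Option (Σ τ : L.Typ, Var Γ τ) => match o with
        | none => (⟨σ, .here⟩ : Σ τ : L.Typ, Var (σ :: Γ) τ)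
        | some x => ⟨x.1, .there x.2⟩) ?_
    rintro ⟨τ, x⟩
    cases x with
    | here => exact ⟨none, rfl⟩
    | there x => exact ⟨some ⟨_, x⟩, rfl⟩

/-- A variable that is not free is absent from some representative, but from different ones for
different variables. So `s` is changed into `s'` one variable at a time, by induction on the finite
set `V` outside which they already agree. -/
theorem Tm.subst_congr {Γ Δ : L.Ctx} {τ : L.Typ} (t : Tm L Γ τ) (s s' : Sub L Γ Δ)
    (h : ∀ ⦃σ⦄ (x : Var Γ σ), t.HasVar x → s x = s' x) : t.subst s = t.subst s' := by
  classical
  have := finite_var Γ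
  suffices H : ∀ V : Set (Σ τ : L.Typ, Var Γ τ), V.Finite → ∀ s : Sub L Γ Δ,
      (∀ ⦃σ⦄ (x : Var Γ σ), (⟨σ, x⟩ : Σ τ : L.Typ, Var Γ τ) ∉ V → s x = s' x) →
      (∀ ⦃σ⦄ (x : Var Γ σ), t.HasVar x → s x = s' x) → t.subst s = t.subst s' from
    H Set.univ (Set.toFinite _) s (fun σ x hx => (hx trivial).elim) h
  clear h s
  intro V hV
  induction V, hV using Set.Finite.induction_on with
  | empty =>
    intro s hs _
    have : s = s' := by funext σ x; exact hs x (fun h => h)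
    rw [this]
  | @insert y V _ _ ih =>
    intro s hs h
    -- `s₁` agrees with `s'` also at `y`, so the induction hypothesis applies to it. Passing from
    -- `s` to `s₁` is harmless: if `y` is free they coincide, otherwise a representative without `y`
    -- shows it.
    let s₁ : Sub L Γ Δ := fun σ x => if (⟨σ, x⟩ : Σ τ : L.Typ, Var Γ τ) = y then s' x else s x
    have e₁ : t.subst s₁ = t.subst s' := by
      refine ih s₁ (fun σ x hx => ?_) (fun σ x hx => ?_)
      · by_cases hxy : (⟨σ, x⟩ : Σ τ : L.Typ, Var Γ τ) = y
        · simp [s₁, hxy]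
        · simp only [s₁, hxy, if_false]
          exact hs x (fun h => h.elim hxy hx)
      · by_cases hxy : (⟨σ, x⟩ : Σ τ : L.Typ, Var Γ τ) = y
        · simp [s₁, hxy]
        · simp only [s₁, hxy, if_false]
          exact h x hx
    rw [← e₁]
    by_cases hy : t.HasVar y.2
    · congr 1
      funext σ x
      by_cases hxy : (⟨σ, x⟩ : Σ τ : L.Typ, Var Γ τ) = y
      · subst hxy; simp only [s₁, if_true]; exact h x hy
      · simp [s₁, hxy]
    · simp only [Tm.HasVar, not_forall] at hy
      obtain ⟨r, rfl, hr⟩ := hy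
      have key : ∀ s : Sub L Γ Δ, (Tm.mk r).subst s
          = Tm.mk (r.gsub (fun _ a => .nom a) (fun _ x => (s x).out)) := by
        intro s
        rw [← Raw.subst_eq_gsub, ← Tm.subst_mk]
        congr 1
        funext σ x
        exact (Quotient.out_eq (s x)).symm
      rw [key, key]
      congr 1
      refine r.gsub_congr (fun _ _ _ => rfl) (fun σ x hx => ?_)
      have hxy : (⟨σ, x⟩ : Σ τ : L.Typ, Var Γ τ) ≠ y := by rintro rfl; exact hr hx
      simp [s₁, hxy]

/-! ### Lists of nominal constants -/

namespace NomList

def permute (π : NomPerm L) : {αs : List L.Typ} → NomList L αs → NomList L αs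
  | _, .nil => .nil
  | _, .cons a as => .cons (π.perm _ a) (as.permute π)

theorem toList_permute (π : NomPerm L) : ∀ {αs : List L.Typ} (c : NomList L αs),
    (c.permute π).toList = c.toList.map π.act
  | _, .nil => rfl
  | _, .cons a as => by simp only [permute, toList, List.map_cons, toList_permute]; rfl

theorem toSub_permute (π : NomPerm L) (Δ : L.Ctx) : ∀ {αs : List L.Typ} (c : NomList L αs),
    (c.permute π).toSub Δ = (c.toSub Δ).permute π
  | _, .nil => by funext τ x; cases x
  | _, .cons a as => by
    simp only [permute, toSub, Sub.permute_cons, toSub_permute π Δ as]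
    rfl

theorem toSub_comp {Δ Θ : L.Ctx} (s : Sub L Δ Θ) : ∀ {αs : List L.Typ} (c : NomList L αs),
    (c.toSub Δ).comp s = c.toSub Θ
  | _, .nil => Sub.empty_comp s
  | _, .cons a as => by
    simp only [toSub, Sub.cons_comp, toSub_comp s as, Tm.subst_nom]

/-- The constant at a given position. -/
def get : {αs : List L.Typ} → NomList L αs → ∀ ⦃ρ : L.Typ⦄, Var αs ρ → L.Nom ρ
  | _, .cons a _, _, .here => a
  | _, .cons _ as, _, .there x => as.get x

theorem toSub_eq_get (Δ : L.Ctx) : ∀ {αs : List L.Typ} (c : NomList L αs),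
    c.toSub Δ = fun _ x => Tm.nom (c.get x)
  | _, .nil => by funext τ x; cases x
  | _, .cons a as => by
    funext τ x
    cases x with
    | here => rfl
    | there x => exact congrFun (congrFun (toSub_eq_get Δ as) _) x

theorem get_mem : ∀ {αs : List L.Typ} (c : NomList L αs) {ρ : L.Typ} (x : Var αs ρ),
    (⟨ρ, c.get x⟩ : L.Nominal) ∈ c.toList
  | _, .cons _ _, _, .here => List.mem_cons_self
  | _, .cons _ as, _, .there x => List.mem_cons_of_mem _ (get_mem as x)

theorem exists_get : ∀ {αs : List L.Typ} (c : NomList L αs) {ρ : L.Typ} {a : L.Nom ρ},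
    (⟨ρ, a⟩ : L.Nominal) ∈ c.toList → ∃ x : Var αs ρ, c.get x = a
  | _, .nil, _, _, h => by cases h
  | _, .cons a as, _, _, h => by
    rcases List.mem_cons.1 h with h | h
    · cases h; exact ⟨.here, rfl⟩
    · obtain ⟨x, hx⟩ := exists_get as h
      exact ⟨.there x, hx⟩

theorem permute_permute (π π' : NomPerm L) : ∀ {αs : List L.Typ} (c : NomList L αs),
    (c.permute π').permute π = c.permute (π.comp π')
  | _, .nil => rfl
  | _, .cons a as => by simp only [permute, permute_permute π π' as]; rfl

theorem permute_eq_self (π : NomPerm L) : ∀ {αs : List L.Typ} (c : NomList L αs),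
    (∀ a ∈ c.toList, π.act a = a) → c.permute π = c
  | _, .nil, _ => rfl
  | _, .cons a as, h => by
    have h₁ := h ⟨_, a⟩ List.mem_cons_self
    simp only [NomPerm.act, Sigma.mk.injEq, heq_eq_eq, true_and] at h₁
    simp only [permute, h₁, permute_eq_self π as fun b hb => h b (List.mem_cons_of_mem _ hb)]

/-- A permutation taking one list to another, moving only constants at positions where the lists
differ. -/
theorem exists_permute_eq : ∀ {αs : List L.Typ} (c e : NomList L αs) (M : Set L.Nominal),
    c.toList.Nodup → e.toList.Nodup →
    (∀ q ∈ c.toList.zip e.toList, q.1 ≠ q.2 → q.1 ∈ M ∧ q.2 ∈ M) →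
    ∃ π : NomPerm L, c.permute π = e ∧ ∀ b, π.act b ≠ b → b ∈ M
  | _, .nil, .nil, M, _, _, _ => ⟨.one, rfl, fun b h => (h rfl).elim⟩
  | _, .cons (α := α) c cs, .cons e es, M, hc, he, hM => by
    simp only [toList, List.nodup_cons] at hc he
    simp only [toList, List.zip_cons_cons, List.mem_cons, forall_eq_or_imp] at hM
    by_cases hce : c = e
    · subst hce
      -- The common head is removed from the set of movable constants, which forces the permutation
      -- of the tails to fix it.
      obtain ⟨π, hπ, hπM⟩ := exists_permute_eq cs es {b | b ∈ M ∧ b ≠ ⟨α, c⟩} hc.2 he.2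
        fun q hq hne => by
          have := List.of_mem_zip (a := q.1) (b := q.2) hq
          refine ⟨⟨(hM.2 q hq hne).1, fun h => hc.1 (h ▸ this.1)⟩,
            ⟨(hM.2 q hq hne).2, fun h => he.1 (h ▸ this.2)⟩⟩
      refine ⟨π, ?_, fun b hb => (hπM b hb).1⟩
      have h₁ : π.act ⟨α, c⟩ = ⟨α, c⟩ := by
        by_contra h
        exact (hπM _ h).2 rfl
      simp only [NomPerm.act, Sigma.mk.injEq, heq_eq_eq, true_and] at h₁
      simp only [permute, h₁, hπ]
    · obtain ⟨π, hπ, hπM⟩ := exists_permute_eq cs es M hc.2 he.2 hM.2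
      have hM₁ := hM.1 (by simpa using hce)
      classical
      -- After `π` has matched the tails, the image of the head is exchanged with `e`. Neither of
      -- the two lies in `es`: the former because `π` is injective, the latter because `e :: es` has
      -- no repetitions.
      obtain ⟨σ, hσ⟩ := NomPerm.exists_swap (π.perm α c) e
      refine ⟨σ.comp π, ?_, fun b hb => ?_⟩
      · have h₁ : σ.act (π.act ⟨α, c⟩) = ⟨α, e⟩ := by
          rw [hσ]
          exact Equiv.swap_apply_left _ _
        simp only [NomPerm.act, Sigma.mk.injEq, heq_eq_eq, true_and] at h₁
        have h₂ : es.permute σ = es := by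
          refine permute_eq_self σ es fun b hb => ?_
          rw [hσ, Equiv.swap_apply_of_ne_of_ne]
          · rintro rfl
            rw [← hπ, toList_permute, List.mem_map] at hb
            obtain ⟨d, hd, h⟩ := hb
            rw [π.act_injective (show π.act d = π.act ⟨α, c⟩ from h)] at hd
            exact hc.1 hd
          · rintro rfl
            exact he.1 hb
        rw [permute, ← permute_permute, hπ, h₂]
        exact congrArg (fun x => cons x es) h₁
      · by_contra hbM
        have h₁ : π.act b = b := by
          by_contra h
          exact hbM (hπM b h)
        rw [NomPerm.act_comp, h₁, hσ] at hb
        refine hb (Equiv.swap_apply_of_ne_of_ne ?_ fun h => hbM (h ▸ hM₁.2))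
        rintro rfl
        refine hbM ?_
        by_cases h₂ : π.act ⟨α, c⟩ = ⟨α, c⟩
        · exact (show (⟨α, π.perm α c⟩ : L.Nominal) = ⟨α, c⟩ from h₂) ▸ hM₁.1
        · exact hπM _ (π.act_moved h₂)

/-- Replace the constants of `e` outside `K` by those of `c` at the same positions. -/
theorem exists_replace (K : Set L.Nominal) : ∀ {αs : List L.Typ} (c e : NomList L αs),
    c.toList.Nodup → e.toList.Nodup → (∀ b ∈ c.toList, b ∉ K) →
    ∃ d : NomList L αs, d.toList.Nodup ∧
      (∀ b ∈ d.toList, (b ∈ K ∧ b ∈ e.toList) ∨ b ∈ c.toList) ∧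
      (∀ q ∈ e.toList.zip d.toList, q.1 ≠ q.2 → q.1 ∉ K ∧ q.2 ∈ c.toList) ∧
      ∀ q ∈ c.toList.zip d.toList, q.1 ≠ q.2 → q.2 ∈ K
  | _, .nil, .nil, _, _, _ => ⟨.nil, by simp [toList]⟩
  | _, .cons (α := α) c cs, .cons e es, hc, he, hK => by
    simp only [toList, List.nodup_cons] at hc he
    simp only [toList, List.mem_cons, forall_eq_or_imp] at hK
    obtain ⟨ds, h₁, h₂, h₃, h₄⟩ := exists_replace K cs es hc.2 he.2 hK.2
    by_cases heK : (⟨α, e⟩ : L.Nominal) ∈ K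
    · refine ⟨.cons e ds, ?_, ?_, ?_, ?_⟩
      · refine List.nodup_cons.2 ⟨fun h => ?_, h₁⟩
        rcases h₂ _ h with h | h
        · exact he.1 h.2
        · exact hK.2 _ h heK
      all_goals simp only [toList, List.zip_cons_cons, List.mem_cons, forall_eq_or_imp]
      · refine ⟨.inl ⟨heK, .inl trivial⟩, fun b hb => ?_⟩
        exact (h₂ b hb).imp (fun h => ⟨h.1, .inr h.2⟩) .inr
      · exact ⟨fun h => (h rfl).elim, fun q hq hne => ⟨(h₃ q hq hne).1, .inr (h₃ q hq hne).2⟩⟩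
      · exact ⟨fun _ => heK, h₄⟩
    · refine ⟨.cons c ds, ?_, ?_, ?_, ?_⟩
      · refine List.nodup_cons.2 ⟨fun h => ?_, h₁⟩
        rcases h₂ _ h with h | h
        · exact hK.1 h.1
        · exact hc.1 h
      all_goals simp only [toList, List.zip_cons_cons, List.mem_cons, forall_eq_or_imp]
      · refine ⟨.inr (.inl trivial), fun b hb => ?_⟩
        exact (h₂ b hb).imp (fun h => ⟨h.1, .inr h.2⟩) .inr
      · exact ⟨fun _ => ⟨heK, .inl trivial⟩,
          fun q hq hne => ⟨(h₃ q hq hne).1, .inr (h₃ q hq hne).2⟩⟩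
      · exact ⟨fun h => (h rfl).elim, h₄⟩

theorem finite_toList {αs : List L.Typ} (c : NomList L αs) : {a | a ∈ c.toList}.Finite :=
  List.finite_toSet _

theorem exists_of_list : ∀ l : List L.Nominal, ∃ (αs : List L.Typ) (c : NomList L αs),
    c.toList = l
  | [] => ⟨[], .nil, rfl⟩
  | a :: l => by
    obtain ⟨αs, c, rfl⟩ := exists_of_list l
    exact ⟨a.1 :: αs, .cons a.2 c, rfl⟩

end NomList

/-! ### Application to nominal constants and abstraction over them -/

theorem Tm.subst_applyNoms {Γ Δ : L.Ctx} {τ : L.Typ} (s : Sub L Γ Δ) :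
    ∀ {αs : List L.Typ} (c : NomList L αs) (t : Tm L Γ (raiseTy αs τ)),
      (Tm.applyNoms c t).subst s = Tm.applyNoms c (t.subst s)
  | _, .nil, _ => rfl
  | _, .cons a as, t => by
    refine (Tm.subst_applyNoms s as _).trans (congrArg (Tm.applyNoms as) ?_)
    refine (Tm.subst_app _ _ s).trans ?_
    rw [Tm.subst_nom]
    rfl

theorem Tm.permute_applyNoms (π : NomPerm L) {Γ : L.Ctx} {τ : L.Typ} :
    ∀ {αs : List L.Typ} (c : NomList L αs) (t : Tm L Γ (raiseTy αs τ)),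
      (Tm.applyNoms c t).permute π = Tm.applyNoms (c.permute π) (t.permute π)
  | _, .nil, _ => rfl
  | _, .cons a as, t => by
    simp only [Tm.applyNoms, NomList.permute]
    rw [Tm.permute_applyNoms π as]
    congr 1
    obtain ⟨r, rfl⟩ := t.exists_mk
    rfl

theorem Tm.supp_applyNoms {Γ : L.Ctx} {τ : L.Typ} {e : L.Nominal} :
    ∀ {αs : List L.Typ} (c : NomList L αs) (t : Tm L Γ (raiseTy αs τ)),
      e ∈ (Tm.applyNoms c t).supp → e ∈ t.supp ∨ e ∈ c.toList
  | _, .nil, _, h => .inl h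
  | _, .cons a as, t, h => by
    rcases Tm.supp_applyNoms as _ h with h | h
    · rcases Tm.supp_app _ _ h with h | h
      · exact .inl h
      · exact .inr (by rw [Tm.supp_nom a h]; exact List.mem_cons_self)
    · exact .inr (List.mem_cons_of_mem _ h)

/-- Abstraction of a term over a list of nominal constants. -/
theorem Raw.exists_applyNoms_eq {Γ : L.Ctx} {τ : L.Typ} (r : Raw L Γ τ) :
    ∀ {αs : List L.Typ} (c : NomList L αs), ∃ u : Raw L Γ (raiseTy αs τ),
      Tm.applyNoms c (Tm.mk u) = Tm.mk r ∧ ∀ e, u.HasNom e → r.HasNom e ∧ e ∉ c.toList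
  | _, .nil => ⟨r, rfl, fun e h => ⟨h, by simp [NomList.toList]⟩⟩
  | _, .cons (α := α) a as => by
    classical
    obtain ⟨u, hu, hu'⟩ := Raw.exists_applyNoms_eq r as
    -- The bound variable is put for the constant `a`, all other constants being kept; a beta step
    -- restores `u`.
    have hf : ∀ (ρ : L.Typ) (b : L.Nom ρ), ∃ v : Raw L (α :: Γ) ρ,
        v.subst (RawSub.single (.nom a)) = .nom b ∧
          ∀ e, v.HasNom e → e = ⟨ρ, b⟩ ∧ e ≠ ⟨α, a⟩ := by
      intro ρ b
      by_cases h : (⟨ρ, b⟩ : L.Nominal) = ⟨α, a⟩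
      · cases h
        exact ⟨.var .here, rfl, fun e h => h.elim⟩
      · exact ⟨.nom b, rfl, fun e he => ⟨he, by cases he; exact h⟩⟩
    choose f hf hf' using hf
    refine ⟨.lam (u.gsub (fun ρ b => f ρ b) (fun _ x => .var (.there x))), ?_, fun e he => ?_⟩
    · rw [← hu]
      simp only [Tm.applyNoms]
      congr 1
      refine Tm.mk_eq_of_conv ((Conv.beta _ _).trans ?_)
      have e : (u.gsub (fun ρ b => f ρ b) (fun _ x => .var (.there x))).subst
          (RawSub.single (.nom a)) = u := by
        rw [Raw.subst_eq_gsub, Raw.gsub_gsub]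
        conv_rhs => rw [← u.gsub_id]
        congr 1
        funext ρ b
        rw [← Raw.subst_eq_gsub, hf]
      rw [e]
      exact .refl _
    · rcases u.hasNom_gsub e he with ⟨b, hb, h⟩ | ⟨ρ, x, h⟩
      · obtain ⟨rfl, h⟩ := hf' _ _ _ h
        obtain ⟨h₁, h₂⟩ := hu' _ hb
        refine ⟨h₁, fun h₃ => ?_⟩
        exact (List.mem_cons.1 h₃).elim h h₂
      · exact h.elim

/-! ### Formulas: level, support, permutation -/

theorem Formula.level_subst (lvl : L.Pred → ℕ) (m : ℕ) {Γ : L.Ctx} (B : Formula L Γ) :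
    ∀ {Δ : L.Ctx} (s : Sub L Γ Δ), (B.subst s).level lvl m = B.level lvl m := by
  induction B with
  | and B C ihB ihC => intro Δ s; simp only [Formula.subst, Formula.level, ihB, ihC]
  | or B C ihB ihC => intro Δ s; simp only [Formula.subst, Formula.level, ihB, ihC]
  | imp B C ihB ihC => intro Δ s; simp only [Formula.subst, Formula.level, ihB, ihC]
  | all τ B ih => intro Δ s; exact ih _
  | ex τ B ih => intro Δ s; exact ih _
  | nabla τ B ih => intro Δ s; exact ih _
  | _ => intros; rfl

theorem Formula.level_permute (lvl : L.Pred → ℕ) (m : ℕ) (π : NomPerm L) {Γ : L.Ctx}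
    (B : Formula L Γ) : (B.permute π).level lvl m = B.level lvl m := by
  induction B with
  | and B C ihB ihC => simp only [Formula.permute, Formula.level, ihB, ihC]
  | or B C ihB ihC => simp only [Formula.permute, Formula.level, ihB, ihC]
  | imp B C ihB ihC => simp only [Formula.permute, Formula.level, ihB, ihC]
  | all τ B ih => exact ih
  | ex τ B ih => exact ih
  | nabla τ B ih => exact ih
  | _ => rfl

theorem Formula.finite_supp {Γ : L.Ctx} (B : Formula L Γ) : B.supp.Finite := by
  induction B with
  | nat t => exact t.finite_supp
  | atom p t =>
    have : (⋃ i, (t i).supp).Finite := Set.finite_iUnion fun i => (t i).finite_supp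
    refine this.subset ?_
    rintro a ⟨i, hi⟩
    exact Set.mem_iUnion.2 ⟨i, hi⟩
  | and B C ihB ihC => exact ihB.union ihC
  | or B C ihB ihC => exact ihB.union ihC
  | imp B C ihB ihC => exact ihB.union ihC
  | all τ B ih => exact ih
  | ex τ B ih => exact ih
  | nabla τ B ih => exact ih
  | _ => exact Set.finite_empty

theorem finite_ctxSupp {S : L.Ctx} (Γ : Multiset (Formula L S)) : (ctxSupp Γ).Finite := by
  classical
  have : (⋃ B ∈ Γ.toFinset, B.supp).Finite := Γ.toFinset.finite_toSet.biUnion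
    fun B _ => B.finite_supp
  refine this.subset ?_
  rintro a ⟨B, hB, ha⟩
  simp only [Set.mem_iUnion, Multiset.mem_toFinset]
  exact ⟨B, hB, ha⟩

theorem Formula.permute_eq_self (π : NomPerm L) {Γ : L.Ctx} (B : Formula L Γ) :
    (∀ a ∈ B.supp, π.act a = a) → B.permute π = B := by
  induction B with
  | nat t => intro h; simp only [Formula.permute, t.permute_eq_self π h]
  | atom p t =>
    intro h
    simp only [Formula.permute]
    congr 1
    funext i
    exact (t i).permute_eq_self π fun a ha => h a ⟨i, ha⟩
  | and B C ihB ihC =>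
    intro h
    simp only [Formula.permute, ihB fun a ha => h a (.inl ha), ihC fun a ha => h a (.inr ha)]
  | or B C ihB ihC =>
    intro h
    simp only [Formula.permute, ihB fun a ha => h a (.inl ha), ihC fun a ha => h a (.inr ha)]
  | imp B C ihB ihC =>
    intro h
    simp only [Formula.permute, ihB fun a ha => h a (.inl ha), ihC fun a ha => h a (.inr ha)]
  | all τ B ih => intro h; simp only [Formula.permute, ih h]
  | ex τ B ih => intro h; simp only [Formula.permute, ih h]
  | nabla τ B ih => intro h; simp only [Formula.permute, ih h]
  | _ => intros; rfl

theorem Formula.permute_permute (π π' : NomPerm L) {Γ : L.Ctx} (B : Formula L Γ) :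
    (B.permute π').permute π = B.permute (π.comp π') := by
  induction B with
  | nat t => simp only [Formula.permute, Tm.permute_permute]
  | atom p t => simp only [Formula.permute, Tm.permute_permute]
  | and B C ihB ihC => simp only [Formula.permute, ihB, ihC]
  | or B C ihB ihC => simp only [Formula.permute, ihB, ihC]
  | imp B C ihB ihC => simp only [Formula.permute, ihB, ihC]
  | all τ B ih => simp only [Formula.permute, ih]
  | ex τ B ih => simp only [Formula.permute, ih]
  | nabla τ B ih => simp only [Formula.permute, ih]
  | _ => rfl

theorem Formula.permute_inv_permute (π : NomPerm L) {Γ : L.Ctx} (B : Formula L Γ) :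
    (B.permute π).permute π.inv = B := by
  rw [Formula.permute_permute]
  exact B.permute_eq_self _ fun a _ => π.act_inv_act a

theorem Formula.permute_subst (π : NomPerm L) {Γ : L.Ctx} (B : Formula L Γ) :
    ∀ {Δ : L.Ctx} (s : Sub L Γ Δ),
      (B.subst s).permute π = (B.permute π).subst (s.permute π) := by
  induction B with
  | nat t => intro Δ s; simp only [Formula.subst, Formula.permute, Tm.permute_subst]
  | atom p t => intro Δ s; simp only [Formula.subst, Formula.permute, Tm.permute_subst]
  | and B C ihB ihC => intro Δ s; simp only [Formula.subst, Formula.permute, ihB, ihC]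
  | or B C ihB ihC => intro Δ s; simp only [Formula.subst, Formula.permute, ihB, ihC]
  | imp B C ihB ihC => intro Δ s; simp only [Formula.subst, Formula.permute, ihB, ihC]
  | all τ B ih => intro Δ s; simp only [Formula.subst, Formula.permute, ih, Sub.permute_lift]
  | ex τ B ih => intro Δ s; simp only [Formula.subst, Formula.permute, ih, Sub.permute_lift]
  | nabla τ B ih => intro Δ s; simp only [Formula.subst, Formula.permute, ih, Sub.permute_lift]
  | _ => intros; rfl

theorem Sub.supp_lift {Γ Δ : L.Ctx} (s : Sub L Γ Δ) {σ : L.Typ} {a : L.Nominal}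
    (h : ∃ (ρ : L.Typ) (x : Var (σ :: Γ) ρ), a ∈ (s.lift σ x).supp) :
    ∃ (ρ : L.Typ) (x : Var Γ ρ), a ∈ (s x).supp := by
  obtain ⟨ρ, x, h⟩ := h
  cases x with
  | here => exact ((Set.ext_iff.1 (Tm.supp_var _) a).1 h).elim
  | there x => exact ⟨ρ, x, Tm.supp_weaken _ h⟩

theorem Formula.supp_subst {a : L.Nominal} {Γ : L.Ctx} (B : Formula L Γ) :
    ∀ {Δ : L.Ctx} (s : Sub L Γ Δ), a ∈ (B.subst s).supp →
      a ∈ B.supp ∨ ∃ (ρ : L.Typ) (x : Var Γ ρ), a ∈ (s x).supp := by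
  induction B with
  | nat t => intro Δ s h; exact t.supp_subst s h
  | atom p t =>
    rintro Δ s ⟨i, h⟩
    exact ((t i).supp_subst s h).imp (fun h => ⟨i, h⟩) id
  | and B C ihB ihC =>
    intro Δ s h
    exact h.elim (fun h => (ihB s h).imp .inl id) (fun h => (ihC s h).imp .inr id)
  | or B C ihB ihC =>
    intro Δ s h
    exact h.elim (fun h => (ihB s h).imp .inl id) (fun h => (ihC s h).imp .inr id)
  | imp B C ihB ihC =>
    intro Δ s h
    exact h.elim (fun h => (ihB s h).imp .inl id) (fun h => (ihC s h).imp .inr id)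
  | all τ B ih => intro Δ s h; exact (ih _ h).imp id s.supp_lift
  | ex τ B ih => intro Δ s h; exact (ih _ h).imp id s.supp_lift
  | nabla τ B ih => intro Δ s h; exact (ih _ h).imp id s.supp_lift
  | _ => intro Δ s h; exact h.elim

/-! ### Truth of closed formulas -/

/-- Truth of a formula under a closing substitution, where `X` and `Y` interpret the atomic
formulas outside and inside the left-hand sides of implications. -/
def Formula.Sat : (X Y : Set (Formula L [])) → {Γ : L.Ctx} → Formula L Γ → Sub L Γ [] → Prop
  | _, _, _, .top, _ => True
  | _, _, _, .bot, _ => False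
  | _, _, _, .nat t, s => ∃ n : ℕ, t.subst s = Tm.succ^[n] Tm.zero
  | X, _, _, .atom p t, s => Formula.atom p (fun i => (t i).subst s) ∈ X
  | X, Y, _, .and B C, s => B.Sat X Y s ∧ C.Sat X Y s
  | X, Y, _, .or B C, s => B.Sat X Y s ∨ C.Sat X Y s
  | X, Y, _, .imp B C, s => B.Sat Y Y s → C.Sat X Y s
  | X, Y, _, .all _ B, s => ∀ t, B.Sat X Y (Sub.cons t s)
  | X, Y, _, .ex _ B, s => ∃ t, B.Sat X Y (Sub.cons t s)
  | X, Y, _, .nabla _ B, s => ∀ᶠ a in Filter.cofinite, B.Sat X Y (Sub.cons (Tm.nom a) s)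

namespace Formula

theorem sat_subst {Γ : L.Ctx} (B : Formula L Γ) :
    ∀ {Δ : L.Ctx} (X Y : Set (Formula L [])) (s : Sub L Γ Δ) (s' : Sub L Δ []),
      (B.subst s).Sat X Y s' ↔ B.Sat X Y (s.comp s') := by
  induction B with
  | nat t => intro Δ X Y s s'; simp only [subst, Sat, Tm.subst_subst]
  | atom p t => intro Δ X Y s s'; simp only [subst, Sat, Tm.subst_subst]
  | and B C ihB ihC => intro Δ X Y s s'; simp only [subst, Sat, ihB, ihC]
  | or B C ihB ihC => intro Δ X Y s s'; simp only [subst, Sat, ihB, ihC]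
  | imp B C ihB ihC => intro Δ X Y s s'; simp only [subst, Sat, ihB, ihC]
  | all τ B ih => intro Δ X Y s s'; simp only [subst, Sat, ih, Sub.lift_comp_cons]
  | ex τ B ih => intro Δ X Y s s'; simp only [subst, Sat, ih, Sub.lift_comp_cons]
  | nabla τ B ih => intro Δ X Y s s'; simp only [subst, Sat, ih, Sub.lift_comp_cons]
  | _ => intros; rfl

/-- Needed for `defR`, where the values at variables absent from a clause head are replaced by
harmless ones. -/
theorem sat_congr {Γ : L.Ctx} (B : Formula L Γ) :
    ∀ (X Y : Set (Formula L [])) (s s' : Sub L Γ []),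
      (∀ ⦃σ⦄ (x : Var Γ σ), B.HasVar x → s x = s' x) → (B.Sat X Y s ↔ B.Sat X Y s') := by
  have aux : ∀ {Γ : L.Ctx} {τ : L.Typ} {B : Formula L (τ :: Γ)} {s s' : Sub L Γ []} (t : Tm L [] τ),
      (∀ ⦃σ⦄ (x : Var Γ σ), B.HasVar (.there x) → s x = s' x) →
      ∀ ⦃σ⦄ (x : Var (τ :: Γ) σ), B.HasVar x → Sub.cons t s x = Sub.cons t s' x := by
    intro Γ τ B s s' t h σ x hx
    cases x with
    | here => rfl
    | there x => exact h x hx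
  induction B with
  | nat t => intro X Y s s' h; simp only [Sat, t.subst_congr s s' h]
  | atom p t =>
    intro X Y s s' h
    have e : ∀ i, (t i).subst s = (t i).subst s' := fun i =>
      (t i).subst_congr s s' fun σ x hx => h x ⟨i, hx⟩
    simp only [Sat, e]
  | and B C ihB ihC =>
    intro X Y s s' h
    exact and_congr (ihB _ _ _ _ fun _ x hx => h x (.inl hx)) (ihC _ _ _ _ fun _ x hx => h x (.inr hx))
  | or B C ihB ihC =>
    intro X Y s s' h
    exact or_congr (ihB _ _ _ _ fun _ x hx => h x (.inl hx)) (ihC _ _ _ _ fun _ x hx => h x (.inr hx))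
  | imp B C ihB ihC =>
    intro X Y s s' h
    exact imp_congr (ihB _ _ _ _ fun _ x hx => h x (.inl hx))
      (ihC _ _ _ _ fun _ x hx => h x (.inr hx))
  | all τ B ih => intro X Y s s' h; exact forall_congr' fun t => ih _ _ _ _ (aux t h)
  | ex τ B ih => intro X Y s s' h; exact exists_congr fun t => ih _ _ _ _ (aux t h)
  | nabla τ B ih =>
    intro X Y s s' h
    exact Filter.eventually_congr (Filter.Eventually.of_forall fun a => ih _ _ _ _ (aux _ h))
  | _ => intros; rfl

/-- This is where levels meet truth: a formula of level at most `n` consults `X` only up to level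
`n` and positively, and `Y` only strictly below `n`, where the two interpretations agree in both
directions. -/
theorem sat_mono_level (lvl : L.Pred → ℕ) (m : ℕ) {Γ : L.Ctx} (B : Formula L Γ) :
    ∀ (n : ℕ) (X Y X' Y' : Set (Formula L [])) (s : Sub L Γ []),
      (∀ A : Formula L [], A.level lvl m ≤ n → A ∈ X → A ∈ X') →
      (∀ A : Formula L [], A.level lvl m < n → (A ∈ Y ↔ A ∈ Y')) →
      B.level lvl m ≤ n → B.Sat X Y s → B.Sat X' Y' s := by
  induction B with
  | top => intros; trivial
  | bot => intro n X Y X' Y' s _ _ _ h; exact h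
  | nat t => intro n X Y X' Y' s _ _ _ h; exact h
  | atom p t => intro n X Y X' Y' s hX hY hn h; exact hX _ hn h
  | and B C ihB ihC =>
    intro n X Y X' Y' s hX hY hn h
    have := max_le_iff.1 hn
    exact ⟨ihB n _ _ _ _ s hX hY this.1 h.1, ihC n _ _ _ _ s hX hY this.2 h.2⟩
  | or B C ihB ihC =>
    intro n X Y X' Y' s hX hY hn h
    have := max_le_iff.1 hn
    exact h.imp (ihB n _ _ _ _ s hX hY this.1) (ihC n _ _ _ _ s hX hY this.2)
  | imp B C ihB ihC =>
    intro n X Y X' Y' s hX hY hn h hB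
    have := max_le_iff.1 hn
    refine ihC n _ _ _ _ s hX hY this.2 (h ?_)
    -- The antecedent has level at most `n - 1`, with `n` positive. It is read entirely in `Y` or
    -- `Y'`, and the two sides trade places.
    exact ihB (n - 1) _ _ _ _ s (fun A hA => (hY A (by omega)).2)
      (fun A hA => (hY A (by omega)).symm) (by omega) hB
  | all τ B ih => intro n X Y X' Y' s hX hY hn h t; exact ih n _ _ _ _ _ hX hY hn (h t)
  | ex τ B ih =>
    intro n X Y X' Y' s hX hY hn h
    exact h.imp fun t h => ih n _ _ _ _ _ hX hY hn h
  | nabla τ B ih =>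
    intro n X Y X' Y' s hX hY hn h
    exact h.mono fun t h => ih n _ _ _ _ _ hX hY hn h

/-- The previous lemma with the constant level assignment; it makes `step` monotone. -/
theorem sat_mono {Γ : L.Ctx} (B : Formula L Γ) {X X' : Set (Formula L [])} (h : X ⊆ X')
    (Y : Set (Formula L [])) (s : Sub L Γ []) : B.Sat X Y s → B.Sat X' Y s :=
  B.sat_mono_level (fun _ => 0) 0 (B.level (fun _ => 0) 0) X Y X' Y s (fun _ _ h' => h h')
    (fun _ _ => Iff.rfl) le_rfl

end Formula

/-- A set of closed formulas closed under permutations of the nominal constants. -/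
def Equivariant (X : Set (Formula L [])) : Prop := ∀ (π : NomPerm L), ∀ A ∈ X, A.permute π ∈ X

theorem Equivariant.permute_mem_iff {X : Set (Formula L [])} (hX : Equivariant X) (π : NomPerm L)
    (A : Formula L []) : A.permute π ∈ X ↔ A ∈ X :=
  ⟨fun h => by rw [← A.permute_inv_permute π]; exact hX _ _ h, hX π A⟩

theorem Tm.permute_numeral (π : NomPerm L) (n : ℕ) :
    (Tm.succ^[n] (Tm.zero : Tm L [] .nt)).permute π = Tm.succ^[n] Tm.zero := by
  induction n with
  | zero => rfl
  | succ n ih =>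
    rw [Function.iterate_succ_apply']
    conv_rhs => rw [← ih]
    obtain ⟨r, hr⟩ := (Tm.succ^[n] (Tm.zero : Tm L [] .nt)).exists_mk
    rw [← hr]
    rfl

/-- Equivariance of truth. A permutation acts bijectively on closed terms and on the constants of
each type, so it preserves all three quantifiers; numerals contain no nominal constants. -/
theorem Formula.sat_permute {X Y : Set (Formula L [])} (hX : Equivariant X) (hY : Equivariant Y)
    (π : NomPerm L) {Γ : L.Ctx} (B : Formula L Γ) : ∀ (s : Sub L Γ []),
      (B.permute π).Sat X Y (s.permute π) ↔ B.Sat X Y s := by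
  have surj : ∀ {τ : L.Typ} {P : Tm L [] τ → Prop}, (∀ t, P t) ↔ ∀ t : Tm L [] τ, P (t.permute π) := by
    refine fun {τ P} => ⟨fun h t => h _, fun h t => ?_⟩
    have := h (t.permute π.inv)
    rwa [Tm.permute_permute, Tm.permute_eq_self _ _ fun a _ => π.act_act_inv a] at this
  have surj' : ∀ {τ : L.Typ} {P : Tm L [] τ → Prop}, (∃ t, P t) ↔ ∃ t : Tm L [] τ, P (t.permute π) := by
    intro τ P
    rw [← not_iff_not]
    push Not
    exact surj
  induction B generalizing X with
  | top => intro s; rfl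
  | bot => intro s; rfl
  | nat t =>
    intro s
    simp only [Formula.permute, Sat, ← Tm.permute_subst]
    refine exists_congr fun n => ⟨fun h => ?_, fun h => by rw [h, Tm.permute_numeral]⟩
    rw [← (t.subst s).permute_inv_permute π, h, Tm.permute_numeral]
  | atom p t =>
    intro s
    simp only [Formula.permute, Sat, ← Tm.permute_subst]
    exact hX.permute_mem_iff π (Formula.atom p fun i => (t i).subst s)
  | and B C ihB ihC => intro s; exact and_congr (ihB hX s) (ihC hX s)
  | or B C ihB ihC => intro s; exact or_congr (ihB hX s) (ihC hX s)
  | imp B C ihB ihC => intro s; exact imp_congr (ihB hY s) (ihC hX s)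
  | all τ B ih =>
    intro s
    simp only [Formula.permute, Sat]
    rw [surj]
    simp only [← Sub.permute_cons, ih hX]
  | ex τ B ih =>
    intro s
    simp only [Formula.permute, Sat]
    rw [surj']
    simp only [← Sub.permute_cons, ih hX]
  | nabla τ B ih =>
    intro s
    simp only [Formula.permute, Sat]
    have e : ∀ a : L.Nom τ, B.Sat X Y (Sub.cons (Tm.nom a) s) ↔
        (B.permute π).Sat X Y (Sub.cons (Tm.nom (π.perm τ a)) (s.permute π)) := by
      intro a
      rw [← ih hX, Sub.permute_cons]
      rfl
    simp only [e]
    constructor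
    · intro h
      exact (π.perm τ).injective.tendsto_cofinite.eventually h
    · intro h
      have := (π.perm τ).symm.injective.tendsto_cofinite.eventually h
      refine this.mono fun a ha => ?_
      have e := (π.perm τ).apply_symm_apply a
      exact e ▸ ha

/-! ### The interpretation of the defined predicates -/

/-- `A` is the instance of the head of a clause with distinct nominal constants `e` for the
nabla-quantified variables and terms not containing these for the others, the corresponding
instance of the body being true. -/
def step (D : Set (Clause L)) (Y : Set (Formula L [])) : Set (Formula L []) →o Set (Formula L []) where
  toFun X := {A | ∃ cl ∈ D, ∃ (e : NomList L cl.nabs) (σ : Sub L cl.vars []), e.toList.Nodup ∧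
    (∀ ⦃τ⦄ (x : Var cl.vars τ), ∀ a ∈ e.toList, a ∉ (σ x).supp) ∧
    A = cl.head.subst (Sub.append (e.toSub []) σ) ∧ cl.body.Sat X Y σ}
  monotone' := by
    rintro X X' h A ⟨cl, hcl, e, σ, he, hσ, hA, hB⟩
    exact ⟨cl, hcl, e, σ, he, hσ, hA, cl.body.sat_mono h Y σ hB⟩

/-- The interpretations by iterated inductive definitions along the levels. -/
def interp (D : Set (Clause L)) : ℕ → Set (Formula L [])
  | 0 => (step D ∅).lfp
  | n + 1 => (step D (interp D n)).lfp

/-- Induction on the least fixed point for the property "if the level is at most `n`, then the atom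
lies in the other fixed point". The body of a clause has at most the level of its head, so it
consults `Y` only below `n`. -/
theorem lfp_step_agree {D : Set (Clause L)} {lvl : L.Pred → ℕ} {m : ℕ}
    (hD : ∀ cl ∈ D, cl.body.level lvl m ≤ cl.head.level lvl m) {n : ℕ}
    {Y Y' : Set (Formula L [])}
    (hY : ∀ A : Formula L [], A.level lvl m < n → (A ∈ Y ↔ A ∈ Y')) (A : Formula L [])
    (hA : A.level lvl m ≤ n) (h : A ∈ (step D Y).lfp) : A ∈ (step D Y').lfp := by
  have : (step D Y).lfp ≤ {A : Formula L [] | A.level lvl m ≤ n → A ∈ (step D Y').lfp} := by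
    refine OrderHom.lfp_le _ ?_
    rintro A ⟨cl, hcl, e, σ, he, hσ, rfl, hB⟩ hA
    rw [Formula.level_subst] at hA
    rw [← OrderHom.map_lfp]
    refine ⟨cl, hcl, e, σ, he, hσ, rfl, ?_⟩
    exact cl.body.sat_mono_level lvl m n
      {A : Formula L [] | A.level lvl m ≤ n → A ∈ (step D Y').lfp} Y _ Y' σ
      (fun A hA h => h hA) hY
      ((hD cl hcl).trans hA) hB
  exact this h hA

/-- Stage `n` already decides all atoms of level at most `n`. At `n = 0` there are no lower atoms,
so the choice of `Y` is irrelevant. -/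
theorem interp_agree {D : Set (Clause L)} {lvl : L.Pred → ℕ} {m : ℕ}
    (hD : ∀ cl ∈ D, cl.body.level lvl m ≤ cl.head.level lvl m) (n : ℕ) :
    ∀ k, n ≤ k → ∀ A : Formula L [], A.level lvl m ≤ n → (A ∈ interp D n ↔ A ∈ interp D k) := by
  induction n with
  | zero =>
    intro k _ A hA
    have : ∃ Y, interp D k = (step D Y).lfp := by cases k <;> exact ⟨_, rfl⟩
    obtain ⟨Y, hY⟩ := this
    rw [hY]
    exact ⟨lfp_step_agree hD (by simp) A hA, lfp_step_agree hD (by simp) A hA⟩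
  | succ n ih =>
    intro k hk A hA
    obtain ⟨k, rfl⟩ : ∃ j, k = j + 1 := ⟨k - 1, by omega⟩
    have := ih k (by omega)
    exact ⟨lfp_step_agree hD (fun A h => this A (by omega)) A hA,
      lfp_step_agree hD (fun A h => (this A (by omega)).symm) A hA⟩

theorem Clause.permute_head (π : NomPerm L) (cl : Clause L) : cl.head.permute π = cl.head := by
  refine cl.head.permute_eq_self π ?_
  rintro a ⟨i, h⟩
  rw [cl.args_supp i] at h
  exact h.elim

theorem Clause.permute_body (π : NomPerm L) (cl : Clause L) : cl.body.permute π = cl.body := by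
  refine cl.body.permute_eq_self π fun a h => ?_
  rw [cl.body_supp] at h
  exact h.elim

/-- Clause instances are stable under permutation. -/
theorem Clause.permute_instance (π : NomPerm L) (cl : Clause L) (e : NomList L cl.nabs)
    (σ : Sub L cl.vars []) (he : e.toList.Nodup)
    (hσ : ∀ ⦃τ⦄ (x : Var cl.vars τ), ∀ a ∈ e.toList, a ∉ (σ x).supp) :
    (e.permute π).toList.Nodup ∧
      (∀ ⦃τ⦄ (x : Var cl.vars τ), ∀ a ∈ (e.permute π).toList, a ∉ (σ.permute π x).supp) ∧
      (cl.head.subst (Sub.append (e.toSub []) σ)).permute π =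
        cl.head.subst (Sub.append ((e.permute π).toSub []) (σ.permute π)) := by
  refine ⟨?_, fun τ x a ha ha' => ?_, ?_⟩
  · rw [NomList.toList_permute]
    exact he.map π.act_injective
  · rw [NomList.toList_permute, List.mem_map] at ha
    obtain ⟨b, hb, rfl⟩ := ha
    obtain ⟨c, hc, h⟩ := (σ x).mem_supp_of_permute π ha'
    rw [π.act_injective h] at hc
    exact hσ x b hb hc
  · rw [Formula.permute_subst, cl.permute_head, Sub.permute_append, NomList.toSub_permute]

/-- Fixed-point induction for "all permutations of `A` lie in the fixed point": a permuted clause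
instance is an instance of the same clause, as clauses contain no nominal constants. -/
theorem equivariant_lfp_step (D : Set (Clause L)) {Y : Set (Formula L [])} (hY : Equivariant Y) :
    Equivariant (step D Y).lfp := by
  have : (step D Y).lfp ≤ {A : Formula L [] | ∀ π : NomPerm L, A.permute π ∈ (step D Y).lfp} := by
    refine OrderHom.lfp_le _ ?_
    rintro A ⟨cl, hcl, e, σ, he, hσ, rfl, hB⟩ π
    obtain ⟨he', hσ', h⟩ := cl.permute_instance π e σ he hσ
    rw [h, ← OrderHom.map_lfp]
    refine ⟨cl, hcl, _, _, he', hσ', rfl, ?_⟩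
    -- The induction predicate is itself equivariant, so truth of the body can be permuted before it
    -- is weakened to truth in the fixed point.
    have hX : Equivariant {A : Formula L [] | ∀ π : NomPerm L, A.permute π ∈ (step D Y).lfp} := by
      intro π A hA π'
      rw [Formula.permute_permute]
      exact hA _
    rw [← Formula.sat_permute hX hY π, cl.permute_body] at hB
    refine cl.body.sat_mono (fun A hA => ?_) Y _ hB
    have := hA .one
    rwa [A.permute_eq_self _ fun a _ => NomPerm.act_one a] at this
  intro π A hA
  exact this hA π

theorem equivariant_interp (D : Set (Clause L)) : ∀ n, Equivariant (interp D n)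
  | 0 => equivariant_lfp_step D (fun _ _ h => h.elim)
  | n + 1 => equivariant_lfp_step D (equivariant_interp D n)

/-- A stratified definition has an equivariant interpretation that is a fixed point. -/
theorem Stratified.exists_interpretation {D : Set (Clause L)} (hD : Stratified D) :
    ∃ X : Set (Formula L []), Equivariant X ∧ X = step D X X := by
  obtain ⟨lvl, m, hD⟩ := hD
  refine ⟨{A | A ∈ interp D (A.level lvl m)}, fun π A hA => ?_, ?_⟩
  · change A.permute π ∈ interp D _
    rw [A.level_permute]
    exact equivariant_interp D _ π A hA
  · have key : ∀ n (A : Formula L []), A.level lvl m ≤ n →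
        (A ∈ interp D (A.level lvl m) ↔ A ∈ interp D n) := fun n A h =>
      interp_agree hD _ n h A le_rfl
    ext A
    change A ∈ interp D _ ↔ _
    generalize hn : A.level lvl m = n
    -- `Y` reads the antecedents at stage `n`; it agrees below level `n` with the set being
    -- constructed, vacuously so for `n = 0`. After one unfolding of the fixed point only bodies of
    -- level at most `n` have to be compared.
    obtain ⟨Y, hY, hYX⟩ : ∃ Y, interp D n = (step D Y).lfp ∧
        ∀ A : Formula L [], A.level lvl m < n → (A ∈ Y ↔ A ∈ interp D (A.level lvl m)) := by
      cases n with
      | zero => exact ⟨_, rfl, fun A h => by omega⟩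
      | succ n => exact ⟨_, rfl, fun A h => (key n A (by omega)).symm⟩
    rw [hY, ← OrderHom.map_lfp]
    constructor
    · rintro ⟨cl, hcl, e, σ, he, hσ, rfl, hB⟩
      rw [Formula.level_subst] at hn
      refine ⟨cl, hcl, e, σ, he, hσ, rfl, ?_⟩
      refine cl.body.sat_mono_level lvl m n _ _ _ _ σ (fun A hA h => ?_) hYX
        (hn ▸ hD cl hcl) hB
      rw [← hY] at h
      exact (key n A hA).2 h
    · rintro ⟨cl, hcl, e, σ, he, hσ, rfl, hB⟩
      rw [Formula.level_subst] at hn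
      refine ⟨cl, hcl, e, σ, he, hσ, rfl, ?_⟩
      refine cl.body.sat_mono_level lvl m n _ _ _ _ σ (fun A hA h => ?_)
        (fun A hA => (hYX A hA).symm) (hn ▸ hD cl hcl) hB
      rw [← hY]
      exact (key n A hA).1 h

/-! ### Validity of sequents -/

/-- No term in the range of `s` contains a constant of `X`. -/
def Sub.Avoids {Γ Δ : L.Ctx} (s : Sub L Γ Δ) (X : Set L.Nominal) : Prop :=
  ∀ ⦃τ : L.Typ⦄ (x : Var Γ τ), ∀ a ∈ X, a ∉ (s x).supp

/-- `C` is true whenever `Γ` is, under all closing substitutions avoiding some finite set of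
nominal constants. -/
def Valid (T : Set (Formula L [])) (S : L.Ctx) (Γ : Multiset (Formula L S)) (C : Formula L S) :
    Prop :=
  ∃ X : Set L.Nominal, X.Finite ∧ ∀ s : Sub L S [], s.Avoids X → (∀ B ∈ Γ, B.Sat T T s) →
    C.Sat T T s

theorem Sub.Avoids.mono {Γ Δ : L.Ctx} {s : Sub L Γ Δ} {X Y : Set L.Nominal} (h : s.Avoids Y)
    (hXY : X ⊆ Y) : s.Avoids X := fun _ x a ha => h x a (hXY ha)

theorem Sub.Avoids.cons {Γ Δ : L.Ctx} {s : Sub L Γ Δ} {X : Set L.Nominal} (h : s.Avoids X)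
    {σ : L.Typ} {t : Tm L Δ σ} (ht : ∀ a ∈ X, a ∉ t.supp) : (Sub.cons t s).Avoids X := by
  intro τ x
  cases x with
  | here => exact ht
  | there x => exact h x

theorem Sub.avoids_empty {Δ : L.Ctx} (X : Set L.Nominal) :
    (Sub.empty Δ : Sub L [] Δ).Avoids X := fun _ x => nomatch x

theorem Sub.permute_eq_self (π : NomPerm L) {Γ Δ : L.Ctx} (s : Sub L Γ Δ)
    (h : ∀ ⦃τ⦄ (x : Var Γ τ), ∀ a ∈ (s x).supp, π.act a = a) : s.permute π = s := by
  funext τ x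
  exact (s x).permute_eq_self π (h x)

theorem Sub.Avoids.permute_eq_self {π : NomPerm L} {Γ Δ : L.Ctx} {s : Sub L Γ Δ}
    {X : Set L.Nominal} (h : s.Avoids X) (hX : ∀ a, π.act a ≠ a → a ∈ X) : s.permute π = s :=
  s.permute_eq_self π fun _ x a ha => by
    by_contra h'
    exact h x a (hX a h') ha

theorem finite_iUnion_var {Γ : L.Ctx} {F : ∀ ⦃τ : L.Typ⦄, Var Γ τ → Set L.Nominal}
    (hF : ∀ ⦃τ⦄ (x : Var Γ τ), (F x).Finite) :
    {a | ∃ (τ : L.Typ) (x : Var Γ τ), a ∈ F x}.Finite := by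
  have := finite_var Γ
  refine (Set.finite_iUnion fun x : (Σ τ : L.Typ, Var Γ τ) => hF x.2).subset ?_
  rintro a ⟨τ, x, h⟩
  exact Set.mem_iUnion.2 ⟨⟨τ, x⟩, h⟩

/-- Since such a `π` fixes `B`, constants outside `supp(B)` may be renamed in the substitution
alone. -/
theorem Formula.sat_permute_fixed {T : Set (Formula L [])} (hT : Equivariant T) (π : NomPerm L)
    {Γ : L.Ctx} (B : Formula L Γ) (s : Sub L Γ []) (h : ∀ a ∈ B.supp, π.act a = a) :
    B.Sat T T (s.permute π) ↔ B.Sat T T s := by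
  conv_lhs => rw [← B.permute_eq_self π h]
  exact Formula.sat_permute hT hT π B s

theorem subset_ctxSupp {S : L.Ctx} {Γ : Multiset (Formula L S)} {B : Formula L S} (h : B ∈ Γ) :
    B.supp ⊆ ctxSupp Γ := fun _ ha => ⟨B, h, ha⟩

/-- In a valid sequent it suffices to avoid the constants of the sequent. -/
theorem Valid.sat {T : Set (Formula L [])} (hT : Equivariant T) {S : L.Ctx}
    {Γ : Multiset (Formula L S)} {C : Formula L S} (h : Valid T S Γ C) {s : Sub L S []}
    (hs : s.Avoids (ctxSupp Γ ∪ C.supp)) (hΓ : ∀ B ∈ Γ, B.Sat T T s) : C.Sat T T s := by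
  obtain ⟨X, hX, h⟩ := h
  -- Every constant in the range of `s` lies outside the sequent, so all of them can be moved out of
  -- `X` without affecting any formula of it.
  obtain ⟨π, hπF, hπX⟩ := NomPerm.exists_avoiding ((finite_ctxSupp Γ).union C.finite_supp) hX
    (finite_iUnion_var fun τ x => (s x).finite_supp)
  rw [← C.sat_permute_fixed hT π s fun a ha => hπF a (.inr ha)]
  refine h _ (fun τ x a ha ha' => ?_) fun B hB => ?_
  · obtain ⟨b, hb, rfl⟩ := (s x).mem_supp_of_permute π ha'
    exact hπX b ⟨τ, x, hb⟩ (fun h => hs x b h hb) ha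
  · rw [B.sat_permute_fixed hT π s fun a ha => hπF a (.inl (subset_ctxSupp hB ha))]
    exact hΓ B hB

/-! ### Quantifiers -/

/-- Every term arises, up to a permutation not affecting `B`, from a term avoiding `X` applied to
the support of `B`. -/
theorem Formula.exists_raised_witness {T : Set (Formula L [])} (hT : Equivariant T) {S : L.Ctx}
    {τ : L.Typ} (B : Formula L (τ :: S)) {αs : List L.Typ} (c : NomList L αs)
    (hc : c.Lists B.supp) {X : Set L.Nominal} (hX : X.Finite) {s : Sub L S []} (hs : s.Avoids X)
    (t : Tm L [] τ) :
    ∃ h : Tm L [] (raiseTy αs τ), (∀ a ∈ X, a ∉ h.supp) ∧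
      (B.Sat T T (Sub.cons (Tm.applyNoms c h) s) ↔ B.Sat T T (Sub.cons t s)) := by
  -- `π` fixes `B` and `s` and pushes the remaining constants of `t` out of `X`. Constants of `X`
  -- that survive in the permuted term are therefore in `c`, and they disappear when the term is
  -- abstracted over `c`.
  obtain ⟨π, hπF, hπX⟩ := NomPerm.exists_avoiding
    (c.finite_toList.union (finite_iUnion_var fun τ x => (s x).finite_supp)) hX t.finite_supp
  obtain ⟨r, hr, hrX⟩ := (t.permute π).exists_mk_avoiding
    (G := X ∩ {a | a ∉ c.toList}) (hX.subset Set.inter_subset_left) (by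
      rintro a ⟨ha, hac⟩ ha'
      obtain ⟨b, hb, rfl⟩ := t.mem_supp_of_permute π ha'
      by_cases hbF : b ∈ {a | a ∈ c.toList} ∪ {a | ∃ (τ : L.Typ) (x : Var S τ), a ∈ (s x).supp}
      · rw [hπF b hbF] at ha hac
        rcases hbF with h | ⟨ρ, x, h⟩
        · exact hac h
        · exact hs x b ha h
      · exact hπX b hb hbF ha)
  obtain ⟨u, hu, hu'⟩ := r.exists_applyNoms_eq c
  refine ⟨Tm.mk u, fun a ha h => ?_, ?_⟩
  · obtain ⟨h₁, h₂⟩ := hu' a (Tm.supp_mk_subset u h)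
    exact hrX a ⟨ha, h₂⟩ h₁
  · rw [hu, hr, ← B.sat_permute_fixed hT π (Sub.cons t s), Sub.permute_cons,
      s.permute_eq_self π]
    · exact fun ρ x a ha => hπF a (.inr ⟨ρ, x, ha⟩)
    · exact fun a ha => hπF a (.inl ((hc.2 a).2 ha))

theorem Formula.sat_raised {T : Set (Formula L [])} {S : L.Ctx} {τ : L.Typ}
    (B : Formula L (τ :: S)) {αs : List L.Typ} (c : NomList L αs) (s : Sub L S [])
    (h : Tm L [] (raiseTy αs τ)) :
    (B.subst (Sub.cons (Tm.applyNoms c (Tm.var .here)) (Sub.wk S (raiseTy αs τ)))).Sat T T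
      (Sub.cons h s) ↔ B.Sat T T (Sub.cons (Tm.applyNoms c h) s) := by
  rw [Formula.sat_subst, Sub.cons_comp, Sub.wk_comp_cons, Tm.subst_applyNoms, Tm.subst_var]
  rfl

theorem Formula.sat_weaken {T : Set (Formula L [])} {S : L.Ctx} {σ : L.Typ}
    (B : Formula L S) (s : Sub L S []) (h : Tm L [] σ) :
    (B.weaken σ).Sat T T (Sub.cons h s) ↔ B.Sat T T s := by
  rw [Formula.weaken, Formula.sat_subst, Sub.wk_comp_cons]

theorem Formula.sat_inst {T : Set (Formula L [])} {S : L.Ctx} {τ : L.Typ}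
    (B : Formula L (τ :: S)) (t : Tm L S τ) (s : Sub L S []) :
    (B.inst t).Sat T T s ↔ B.Sat T T (Sub.cons (t.subst s) s) := by
  rw [Formula.inst, Formula.sat_subst, Sub.single, Sub.cons_comp, Sub.var_comp]

/-- The transposition of `a` and `b` fixes both `B` and `s`. -/
theorem Formula.sat_nom_iff {T : Set (Formula L [])} (hT : Equivariant T) {S : L.Ctx} {τ : L.Typ}
    (B : Formula L (τ :: S)) (s : Sub L S []) {a b : L.Nom τ}
    (haB : (⟨τ, a⟩ : L.Nominal) ∉ B.supp) (hbB : (⟨τ, b⟩ : L.Nominal) ∉ B.supp)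
    (ha : s.Avoids {⟨τ, a⟩}) (hb : s.Avoids {⟨τ, b⟩}) :
    B.Sat T T (Sub.cons (Tm.nom a) s) ↔ B.Sat T T (Sub.cons (Tm.nom b) s) := by
  classical
  obtain ⟨π, hπ⟩ := NomPerm.exists_swap a b
  have fix : ∀ X : Set L.Nominal, (⟨τ, a⟩ : L.Nominal) ∉ X → (⟨τ, b⟩ : L.Nominal) ∉ X →
      ∀ e ∈ X, π.act e = e := by
    intro X ha hb e he
    rw [hπ]
    exact Equiv.swap_apply_of_ne_of_ne (fun h => ha (h ▸ he)) (fun h => hb (h ▸ he))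
  have h₁ : π.perm τ a = b := by
    have h : π.act ⟨τ, a⟩ = ⟨τ, b⟩ := by rw [hπ]; exact Equiv.swap_apply_left _ _
    simpa [NomPerm.act] using h
  rw [← B.sat_permute_fixed hT π (Sub.cons (Tm.nom a) s) (fix _ haB hbB), Sub.permute_cons,
    s.permute_eq_self π fun ρ x => fix _ (ha x _ rfl) (hb x _ rfl)]
  have h₂ : (Tm.nom a : Tm L [] τ).permute π = Tm.nom b := by
    change Tm.nom (π.perm τ a) = _
    rw [h₁]
  rw [h₂]

/-- All fresh constants give the same truth value, and they form a cofinite, nonempty set, so a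
single one decides the cofinite quantifier. -/
theorem Formula.sat_nabla_iff {T : Set (Formula L [])} (hT : Equivariant T) {S : L.Ctx} {τ : L.Typ}
    (B : Formula L (τ :: S)) (s : Sub L S []) {a : L.Nom τ}
    (haB : (⟨τ, a⟩ : L.Nominal) ∉ B.supp) (ha : s.Avoids {⟨τ, a⟩}) :
    (Formula.nabla τ B).Sat T T s ↔ B.Sat T T (Sub.cons (Tm.nom a) s) := by
  have := L.nom_infinite τ
  have hfin := B.finite_supp.union (finite_iUnion_var fun τ x => (s x).finite_supp)
  have hev : ∀ᶠ b : L.Nom τ in Filter.cofinite, (⟨τ, b⟩ : L.Nominal) ∉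
      B.supp ∪ {a | ∃ (τ : L.Typ) (x : Var S τ), a ∈ (s x).supp} := by
    have : Function.Injective fun b : L.Nom τ => (⟨τ, b⟩ : L.Nominal) := fun b c h => by
      simpa using h
    exact this.tendsto_cofinite.eventually hfin.eventually_cofinite_notMem
  have key : ∀ b : L.Nom τ, (⟨τ, b⟩ : L.Nominal) ∉
      B.supp ∪ {a | ∃ (τ : L.Typ) (x : Var S τ), a ∈ (s x).supp} →
      (B.Sat T T (Sub.cons (Tm.nom b) s) ↔ B.Sat T T (Sub.cons (Tm.nom a) s)) := by
    intro b hb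
    simp only [Set.mem_union, not_or] at hb
    refine B.sat_nom_iff hT s hb.1 haB ?_ ha
    rintro ρ x _ rfl h
    exact hb.2 ⟨ρ, x, h⟩
  constructor
  · intro h
    obtain ⟨b, hb, hb'⟩ := (Filter.Eventually.and h hev).exists
    exact (key b hb').1 hb
  · intro h
    exact hev.mono fun b hb => (key b hb).2 h

/-! ### Raising -/

/-- A substitution on a raised signature is prescribed through the variables of the original one;
`P` carries along the condition on nominal constants. -/
theorem Sub.exists_map {Δ : L.Ctx} (f : L.Typ → L.Typ) (P : ∀ ⦃τ : L.Typ⦄, Tm L Δ τ → Prop) :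
    ∀ {Γ : L.Ctx} (g : ∀ ⦃τ : L.Typ⦄, Var Γ τ → Tm L Δ (f τ)), (∀ ⦃τ⦄ (x : Var Γ τ), P (g x)) →
      ∃ s : Sub L (Γ.map f) Δ, (∀ ⦃τ⦄ (x : Var Γ τ), s (x.map f) = g x) ∧
        ∀ ⦃τ⦄ (x : Var (Γ.map f) τ), P (s x)
  | [], _, _ => by
    refine ⟨Sub.empty Δ, fun τ x => ?_, fun τ x => ?_⟩
    · cases x
    · change Var [] τ at x
      cases x
  | σ :: Γ, g, hg => by
    obtain ⟨s, h₁, h₂⟩ := Sub.exists_map f P (fun _ x => g (.there x)) (fun _ x => hg (.there x))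
    refine ⟨Sub.cons (g .here) s, fun τ x => ?_, fun τ x => ?_⟩
    · cases x with
      | here => rfl
      | there x => exact h₁ x
    · cases x with
      | here => exact hg .here
      | there x => exact h₂ x

theorem raiseSub_comp {αs : List L.Typ} (c : NomList L αs) {S Δ : L.Ctx}
    (s : Sub L (raiseCtx αs S) Δ) :
    (raiseSub c S).comp s = fun _ x => Tm.applyNoms c (s (x.map (raiseTy αs))) := by
  funext τ x
  change (Tm.applyNoms c _).subst s = _
  rw [Tm.subst_applyNoms, Tm.subst_var]

theorem raiseSub_permute (π : NomPerm L) {αs : List L.Typ} (c : NomList L αs) (S : L.Ctx) :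
    (raiseSub c S).permute π = raiseSub (c.permute π) S := by
  funext τ x
  exact Tm.permute_applyNoms π c _

theorem supp_raiseSub {αs : List L.Typ} (c : NomList L αs) {S : L.Ctx} {τ : L.Typ} (x : Var S τ)
    {a : L.Nominal} (h : a ∈ (raiseSub c S x).supp) : a ∈ c.toList := by
  rcases Tm.supp_applyNoms c _ h with h | h
  · rw [Tm.supp_var] at h
    exact h.elim
  · exact h

theorem Sub.lift_comp_lift {Γ Δ Θ : L.Ctx} (s : Sub L Γ Δ) (s' : Sub L Δ Θ) (σ : L.Typ) :
    (s.lift σ).comp (s'.lift σ) = (s.comp s').lift σ := by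
  have e : (Sub.wk Δ σ).comp (s'.lift σ) = s'.comp (Sub.wk Θ σ) := by
    funext τ x
    exact (Tm.subst_var _ _).trans (Tm.weaken_eq_subst σ (s' x))
  funext τ x
  cases x with
  | here => exact Tm.subst_var _ _
  | there x =>
    change ((s x).weaken σ).subst _ = ((s x).subst s').weaken σ
    rw [Tm.weaken_eq_subst, Tm.subst_subst, e, Tm.weaken_eq_subst, Tm.subst_subst]

theorem Formula.subst_subst {Γ : L.Ctx} (B : Formula L Γ) :
    ∀ {Δ Θ : L.Ctx} (s : Sub L Γ Δ) (s' : Sub L Δ Θ),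
      (B.subst s).subst s' = B.subst (s.comp s') := by
  induction B with
  | nat t => intro Δ Θ s s'; simp only [Formula.subst, Tm.subst_subst]
  | atom p t => intro Δ Θ s s'; simp only [Formula.subst, Tm.subst_subst]
  | and B C ihB ihC => intro Δ Θ s s'; simp only [Formula.subst, ihB, ihC]
  | or B C ihB ihC => intro Δ Θ s s'; simp only [Formula.subst, ihB, ihC]
  | imp B C ihB ihC => intro Δ Θ s s'; simp only [Formula.subst, ihB, ihC]
  | all τ B ih => intro Δ Θ s s'; simp only [Formula.subst, ih, Sub.lift_comp_lift]
  | ex τ B ih => intro Δ Θ s s'; simp only [Formula.subst, ih, Sub.lift_comp_lift]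
  | nabla τ B ih => intro Δ Θ s s'; simp only [Formula.subst, ih, Sub.lift_comp_lift]
  | _ => intros; rfl

/-- As the clause itself contains no nominal constants, permuting its raised head only permutes the
lists `a` and `c`. -/
theorem Clause.permute_raisedHead (π : NomPerm L) (cl : Clause L) {αs : List L.Typ}
    (a : NomList L αs) (c : NomList L cl.nabs) {U : L.Ctx} (θ : Sub L (raiseCtx αs cl.vars) U) :
    ((cl.raisedHead a c).permute π).subst θ = cl.head.subst (Sub.append ((c.permute π).toSub U)
      (fun _ x => Tm.applyNoms (a.permute π) (θ (x.map (raiseTy αs))))) := by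
  rw [Clause.raisedHead, Formula.permute_subst, cl.permute_head, Sub.permute_append,
    Formula.subst_subst, Sub.append_comp, raiseSub_permute, raiseSub_comp,
    ← NomList.toSub_permute, NomList.toSub_comp]

theorem Clause.permute_raisedBody (π : NomPerm L) (cl : Clause L) {αs : List L.Typ}
    (a : NomList L αs) :
    (cl.raisedBody a).permute π = cl.body.subst (raiseSub (a.permute π) cl.vars) := by
  rw [Clause.raisedBody, Formula.permute_subst, cl.permute_body, raiseSub_permute]

/-- Constants of `a⃗ c⃗` are taken to constants of `a⃗ c⃗`. -/
theorem NomPerm.Permutes.act_mem {αs βs : List L.Typ} {π : NomPerm L} {a : NomList L αs}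
    {c : NomList L βs} (h : π.Permutes a c) {e : L.Nominal} (he : e ∈ a.toList ∨ e ∈ c.toList) :
    π.act e ∈ a.toList ∨ π.act e ∈ c.toList := by
  by_cases h' : π.act e = e
  · rwa [h']
  · exact h _ ((π.act_ne_iff _).1 (π.act_moved h'))

theorem NomPerm.Permutes.mem_permute {αs βs : List L.Typ} {π : NomPerm L} {a : NomList L αs}
    {c : NomList L βs} (h : π.Permutes a c) {e : L.Nominal} (he : e ∈ a.toList ∨ e ∈ c.toList) :
    e ∈ (a.permute π).toList ∨ e ∈ (c.permute π).toList := by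
  have h' : π.inv.act e ∈ a.toList ∨ π.inv.act e ∈ c.toList := by
    by_cases h₁ : π.act (π.inv.act e) = π.inv.act e
    · rwa [← h₁, π.act_act_inv]
    · exact h _ ((π.act_ne_iff _).1 h₁)
  simp only [NomList.toList_permute]
  rw [← π.act_act_inv e]
  exact h'.imp (List.mem_map_of_mem) (List.mem_map_of_mem)

/-- The closed term `t` for the arguments of a raised variable. -/
theorem Sub.exists_raised {S : L.Ctx} {αs : List L.Typ} (c : NomList L αs) (s : Sub L S [])
    {X : Set L.Nominal} (hX : X.Finite) (hs : s.Avoids X) :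
    ∃ s' : Sub L (raiseCtx αs S) [], (raiseSub c S).comp s' = s ∧ s'.Avoids X := by
  have : ∀ (τ : L.Typ) (x : Var S τ), ∃ t : Tm L [] (raiseTy αs τ),
      Tm.applyNoms c t = s x ∧ ∀ a ∈ X, a ∉ t.supp := by
    intro τ x
    obtain ⟨r, hr, hrX⟩ := (s x).exists_mk_avoiding hX (hs x)
    obtain ⟨u, hu, hu'⟩ := r.exists_applyNoms_eq c
    exact ⟨Tm.mk u, hu.trans hr, fun a ha h => hrX a ha (hu' a (Tm.supp_mk_subset u h)).1⟩
  choose g hg hgX using this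
  obtain ⟨s', h₁, h₂⟩ := Sub.exists_map (raiseTy αs) (fun _ t => ∀ a ∈ X, a ∉ t.supp)
    (fun τ x => g τ x) (fun τ x => hgX τ x)
  refine ⟨s', ?_, h₂⟩
  rw [raiseSub_comp]
  funext τ x
  rw [h₁, hg]

/-! ### Soundness of the rules for atoms -/

/-- The unifier, closed by a raised form `κ'` of the given substitution, yields a ground instance of
the clause with the constants `π.c` for the `∇`-variables, and the premise makes its body true. It
remains to see that the other values avoid `π.c`. -/
theorem Valid.defR {D : Set (Clause L)} {T : Set (Formula L [])} (hT' : T = step D T T)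
    {S : L.Ctx} {Γ : Multiset (Formula L S)} (p : L.Pred)
    (t : ∀ i : Fin (L.arity p).length, Tm L S ((L.arity p).get i))
    {αs : List L.Typ} (a : NomList L αs) (cl : Clause L) (c : NomList L cl.nabs)
    (π : NomPerm L) (θ : Sub L (raiseCtx αs cl.vars) (raiseCtx cl.nabs S))
    (ha : a.Lists (Formula.atom p t).supp) (hcl : cl ∈ D)
    (hc : c.Fresh ((Formula.atom p t).supp ∪ ctxSupp Γ)) (hπ : π.Permutes a c)
    (hθ : ∀ ⦃τ : L.Typ⦄ (x : Var cl.vars τ), cl.head.HasVar (x.inr cl.nabs) →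
      (θ (x.map (raiseTy αs))).supp = ∅)
    (hH : ((cl.raisedHead a c).permute π).subst θ = (Formula.atom p t).subst (raiseSub c S))
    (h : Valid T (raiseCtx cl.nabs S) (Γ.map (fun B => B.subst (raiseSub c S)))
      (((cl.raisedBody a).permute π).subst θ)) :
    Valid T S Γ (.atom p t) := by
  classical
  obtain ⟨X, hX, h⟩ := h
  -- Avoiding `a` and `c` as well keeps the constants of `π.c`, which lie among them, out of `κ'`.
  have hX' := hX.union (a.finite_toList.union c.finite_toList)
  refine ⟨_, hX', fun κ hκ hΓ => ?_⟩
  obtain ⟨κ', hκκ', hκ'⟩ := κ.exists_raised c hX' hκ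
  have hB := h κ' (hκ'.mono Set.subset_union_left) (by
    intro B hB
    obtain ⟨B', hB', rfl⟩ := Multiset.mem_map.1 hB
    rw [Formula.sat_subst, hκκ']
    exact hΓ B' hB')
  have hA := congrArg (fun F => F.subst κ') hH
  beta_reduce at hA
  rw [cl.permute_raisedHead, Formula.subst_subst, Formula.subst_subst, hκκ', Sub.append_comp,
    NomList.toSub_comp] at hA
  rw [cl.permute_raisedBody, Formula.subst_subst, Formula.sat_subst, raiseSub_comp] at hB
  set σ₀ : Sub L cl.vars [] := Sub.comp
    (fun τ x => Tm.applyNoms (a.permute π) (θ (x.map (raiseTy αs)))) κ' with hσ₀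
  -- At variables free in the head, the value is a term without nominal constants applied to `π.a`
  -- and closed by `κ'`; `π.a` is disjoint from `π.c` because `c` is fresh for the atom listed by
  -- `a`. At the other variables `θ` is unrestricted, so a constant outside `π.c` is substituted
  -- instead; neither head nor body notices.
  obtain ⟨σ, hσ, hσ'⟩ : ∃ σ : Sub L cl.vars [],
      (∀ ⦃τ⦄ (x : Var cl.vars τ), cl.head.HasVar (x.inr cl.nabs) → σ₀ x = σ x) ∧
      ∀ ⦃τ⦄ (x : Var cl.vars τ), ∀ b ∈ (c.permute π).toList, b ∉ (σ x).supp := by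
    have hfresh := fun τ => exists_nom_notMem (L := L) τ (c.permute π).finite_toList
    choose d hd using hfresh
    refine ⟨fun τ x => if cl.head.HasVar (x.inr cl.nabs) then σ₀ x else Tm.nom (d τ),
      fun τ x hx => by beta_reduce; rw [if_pos hx], fun τ x b hb hb' => ?_⟩
    beta_reduce at hb'
    by_cases hx : cl.head.HasVar (x.inr cl.nabs)
    · rw [if_pos hx, hσ₀] at hb'
      change b ∈ ((Tm.applyNoms _ _).subst κ').supp at hb'
      rw [Tm.subst_applyNoms] at hb'
      rw [NomList.toList_permute, List.mem_map] at hb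
      obtain ⟨e, he, rfl⟩ := hb
      rcases Tm.supp_applyNoms _ _ hb' with hb' | hb'
      · rcases Tm.supp_subst _ _ hb' with hb' | ⟨ρ, y, hb'⟩
        · rw [hθ x hx] at hb'
          exact hb'
        · exact hκ' y _ (.inr (hπ.act_mem (.inr he))) hb'
      · rw [NomList.toList_permute, List.mem_map] at hb'
        obtain ⟨e', he', hee⟩ := hb'
        rw [π.act_injective hee] at he'
        exact hc.2 e he (.inl ((ha.2 e).1 he'))
    · rw [if_neg hx] at hb'
      rw [Tm.supp_nom _ hb'] at hb
      exact hd τ hb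
  change (Formula.atom p t).subst κ ∈ T
  rw [hT', ← hA]
  refine ⟨cl, hcl, c.permute π, σ, ?_, hσ', ?_, ?_⟩
  · rw [NomList.toList_permute]
    exact hc.1.map π.act_injective
  · simp only [Clause.head, Formula.subst]
    congr 1
    funext i
    refine (cl.args i).subst_congr _ _ fun τ x hx => ?_
    exact Sub.append_congr (P := fun τ x => cl.head.HasVar x) _ _ _ hσ x ⟨i, hx⟩
  · exact (cl.body.sat_congr _ _ _ _ fun τ x hx => hσ x (cl.body_free x hx)).1 hB

/-! ### Exchanging nominal constants for variables, and lifting ground instances -/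

/-- Replacement of the nominal constants in a closed term. -/
def Tm.replace {Δ : L.Ctx} (f : NomSub L Δ) {τ : L.Typ} : Tm L [] τ → Tm L Δ τ :=
  Quotient.map (fun r => r.gsub f (fun _ x => nomatch x)) (fun _ _ h => h.gsub _ _)

theorem Tm.replace_mk {Δ : L.Ctx} (f : NomSub L Δ) {τ : L.Typ} (r : Raw L [] τ) :
    (Tm.mk r).replace f = Tm.mk (r.gsub f (fun _ x => nomatch x)) := rfl

/-- `t` has a representative free of the constants in `W`, so the replacement acts only through the
values of `s`. -/
theorem Tm.replace_subst {Γ Δ : L.Ctx} (f : NomSub L Δ) {W : Set L.Nominal} (hW : W.Finite)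
    (hf : ∀ ⦃ρ⦄ (b : L.Nom ρ), (⟨ρ, b⟩ : L.Nominal) ∉ W → f b = .nom b) {τ : L.Typ} (t : Tm L Γ τ)
    (ht : ∀ b ∈ W, b ∉ t.supp) (s : Sub L Γ []) :
    (t.subst s).replace f = t.subst (fun _ x => (s x).replace f) := by
  obtain ⟨r, rfl, hr⟩ := t.exists_mk_avoiding hW ht
  obtain ⟨q, rfl⟩ := s.exists_mk
  simp only [Tm.subst_mk, Tm.replace_mk]
  congr 1
  rw [Raw.subst_eq_gsub, Raw.subst_eq_gsub, Raw.gsub_gsub]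
  exact r.gsub_congr (fun ρ b hb => hf b fun h => hr _ h hb) fun _ _ _ => rfl

/-- The atomic formula with all arguments changed by `g`. -/
def Formula.mapAtom {Γ Δ : L.Ctx} (g : ∀ ⦃τ : L.Typ⦄, Tm L Γ τ → Tm L Δ τ) :
    Formula L Γ → Formula L Δ
  | .atom p t => .atom p (fun i => g (t i))
  -- An arbitrary value: the map serves only to apply `g` to both sides of an equation between
  -- atoms.
  | _ => .top

theorem Sub.map_append {Γ Δ Ξ : L.Ctx} (g : ∀ ⦃τ : L.Typ⦄, Tm L Δ τ → Tm L Ξ τ) :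
    ∀ {Θ : L.Ctx} (s : Sub L Θ Δ) (s' : Sub L Γ Δ),
      (fun _ x => g (Sub.append s s' x) : Sub L (Θ ++ Γ) Ξ) =
        Sub.append (fun _ x => g (s x)) (fun _ x => g (s' x))
  | [], _, _ => rfl
  | _ :: _, s, s' => by
    funext τ x
    cases x with
    | here => rfl
    | there x => exact congrFun (congrFun (Sub.map_append g (fun _ x => s (.there x)) s') τ) x

/-- Nominal constants can be replaced by variables. -/
theorem NomList.exists_replacement {U : List L.Typ} (w : NomList L U) :
    ∃ f : NomSub L U, (∀ ⦃ρ⦄ (b : L.Nom ρ), (⟨ρ, b⟩ : L.Nominal) ∉ w.toList → f b = .nom b) ∧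
      (∀ ⦃ρ⦄ (b : L.Nom ρ) e, (f b).HasNom e → e = ⟨ρ, b⟩ ∧ e ∉ w.toList) ∧
      ∀ ⦃τ⦄ (t : Tm L [] τ), (t.replace f).subst (w.toSub []) = t := by
  classical
  have : ∀ (ρ : L.Typ) (b : L.Nom ρ), ∃ v : Raw L U ρ,
      ((⟨ρ, b⟩ : L.Nominal) ∉ w.toList → v = .nom b) ∧
      (∀ e, v.HasNom e → e = ⟨ρ, b⟩ ∧ e ∉ w.toList) ∧
      v.subst (fun _ x => .nom (w.get x)) = (.nom b : Raw L [] ρ) := by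
    intro ρ b
    by_cases h : (⟨ρ, b⟩ : L.Nominal) ∈ w.toList
    · obtain ⟨x, hx⟩ := w.exists_get h
      exact ⟨.var x, fun h' => (h' h).elim, fun e he => he.elim, by rw [← hx]; rfl⟩
    · exact ⟨.nom b, fun _ => rfl, fun e he => by cases he; exact ⟨rfl, h⟩, rfl⟩
  choose f h₁ h₂ h₃ using this
  refine ⟨fun ρ b => f ρ b, fun ρ b => h₁ ρ b, fun ρ b => h₂ ρ b, fun τ t => ?_⟩
  obtain ⟨r, rfl⟩ := t.exists_mk
  have e : w.toSub [] = fun _ x => Tm.mk (.nom (w.get x)) := w.toSub_eq_get []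
  rw [Tm.replace_mk, e, Tm.subst_mk]
  congr 1
  rw [Raw.subst_eq_gsub, Raw.gsub_gsub]
  conv_rhs => rw [← r.gsub_id]
  refine r.gsub_congr (fun ρ b _ => ?_) fun _ x => nomatch x
  rw [← Raw.subst_eq_gsub, h₃]

/-- A closed term, all of whose constants are in `c` or are replaced by variables, abstracted to a
term without nominal constants. -/
theorem Raw.exists_raised_replace {U : List L.Typ} {W : Set L.Nominal} {f : NomSub L U}
    (hf : ∀ ⦃ρ⦄ (b : L.Nom ρ) e, (f b).HasNom e → e = ⟨ρ, b⟩ ∧ e ∉ W) {αs : List L.Typ}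
    (c : NomList L αs) {τ : L.Typ} (r : Raw L [] τ)
    (hr : ∀ e, r.HasNom e → e ∉ W → e ∈ c.toList) :
    ∃ u : Tm L U (raiseTy αs τ), Tm.applyNoms c u = (Tm.mk r).replace f ∧ u.supp = ∅ := by
  obtain ⟨u, hu, hu'⟩ := (r.gsub f (fun _ x => nomatch x)).exists_applyNoms_eq c
  refine ⟨Tm.mk u, hu, Set.eq_empty_of_forall_notMem fun e he => ?_⟩
  obtain ⟨h₁, h₂⟩ := hu' e (Tm.supp_mk_subset u he)
  rcases r.hasNom_gsub e h₁ with ⟨b, hb, h⟩ | ⟨ρ, x, h⟩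
  · obtain ⟨rfl, h⟩ := hf _ _ h
    exact h₂ (hr _ hb h)
  · cases x

/-- A true instance of an atom is, up to a permutation not affecting `s` and `K`, an instance of a
clause in which all constants outside `K` avoid `G`. -/
theorem exists_separated_instance {T : Set (Formula L [])} (hT : Equivariant T) {S : L.Ctx}
    (cl : Clause L) {A : Formula L S} {G : Set L.Nominal} (hG : G.Finite) {s : Sub L S []}
    (hs : s.Avoids G) (e : NomList L cl.nabs) (σ : Sub L cl.vars []) (he : e.toList.Nodup)
    (hσ : ∀ ⦃τ⦄ (x : Var cl.vars τ), ∀ a ∈ e.toList, a ∉ (σ x).supp)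
    (hA : A.subst s = cl.head.subst (Sub.append (e.toSub []) σ)) (hB : cl.body.Sat T T σ) :
    ∃ (e' : NomList L cl.nabs) (σ' : Sub L cl.vars []), e'.toList.Nodup ∧
      (∀ ⦃τ⦄ (x : Var cl.vars τ), ∀ a ∈ e'.toList, a ∉ (σ' x).supp) ∧
      A.subst s = cl.head.subst (Sub.append (e'.toSub []) σ') ∧ cl.body.Sat T T σ' ∧
      (∀ b ∈ e'.toList, b ∈ A.supp ∨ b ∉ G) ∧
      ∀ ⦃τ⦄ (x : Var cl.vars τ), ∀ b ∈ (σ' x).supp, b ∈ A.supp ∨ b ∉ G := by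
  obtain ⟨π, hπF, hπG⟩ := NomPerm.exists_avoiding
    (A.finite_supp.union (finite_iUnion_var fun τ x => (s x).finite_supp)) hG
    (e.finite_toList.union (finite_iUnion_var fun τ x => (σ x).finite_supp))
  have key : ∀ b, (b ∈ e.toList ∨ ∃ (ρ : L.Typ) (x : Var cl.vars ρ), b ∈ (σ x).supp) →
      π.act b ∈ A.supp ∨ π.act b ∉ G := by
    intro b hb
    by_cases hF : b ∈ A.supp ∪ {a | ∃ (τ : L.Typ) (x : Var S τ), a ∈ (s x).supp}
    · rw [hπF b hF]
      rcases hF with h | ⟨ρ, x, h⟩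
      · exact .inl h
      · exact .inr fun h' => hs x b h' h
    · exact .inr (hπG b hb hF)
  obtain ⟨h₁, h₂, h₃⟩ := cl.permute_instance π e σ he hσ
  refine ⟨e.permute π, σ.permute π, h₁, h₂, ?_, ?_, fun b hb => ?_, fun τ x b hb => ?_⟩
  · rw [← h₃, ← hA, Formula.permute_subst, A.permute_eq_self π fun a ha => hπF a (.inl ha),
      s.permute_eq_self π fun ρ x a ha => hπF a (.inr ⟨ρ, x, ha⟩)]
  · rw [← Formula.sat_permute hT hT π, cl.permute_body] at hB
    exact hB
  · rw [NomList.toList_permute, List.mem_map] at hb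
    obtain ⟨d, hd, rfl⟩ := hb
    exact key d (.inl hd)
  · obtain ⟨d, hd, rfl⟩ := (σ x).mem_supp_of_permute π hb
    exact key d (.inr ⟨τ, x, hd⟩)

/-- A true instance of the atom comes from a ground instance of some clause. Renaming brings its
constants into the form demanded by the rule, the leftover constants `w` become the variables of a
signature `U`, and abstraction over `c` and `π.a` yields a unifier without nominal constants.
Evaluating the corresponding premise at `w` recovers the original situation. -/
theorem Valid.defL {D : Set (Clause L)} {T : Set (Formula L [])} (hT : Equivariant T)
    (hT' : T = step D T T) {S : L.Ctx} {Γ : Multiset (Formula L S)} {C : Formula L S} (p : L.Pred)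
    (t : ∀ i : Fin (L.arity p).length, Tm L S ((L.arity p).get i))
    {αs : List L.Typ} (a : NomList L αs) (c : ∀ cl : Clause L, NomList L cl.nabs)
    (ha : a.Lists (Formula.atom p t).supp)
    (hc : ∀ cl ∈ D, (c cl).Fresh ((Formula.atom p t).supp ∪ ctxSupp Γ ∪ C.supp))
    (h : ∀ cl ∈ D, ∀ (π : NomPerm L) (U : L.Ctx) (θ₁ : Sub L (raiseCtx αs cl.vars) U)
        (θ₂ : Sub L (raiseCtx cl.nabs S) U),
        π.Permutes a (c cl) → θ₁.NomFree → θ₂.NomFree →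
        ((cl.raisedHead a (c cl)).permute π).subst θ₁
          = ((Formula.atom p t).subst (raiseSub (c cl) S)).subst θ₂ →
        Valid T U
          (((cl.raisedBody a).permute π).subst θ₁ ::ₘ
            Γ.map (fun B => (B.subst (raiseSub (c cl) S)).subst θ₂))
          ((C.subst (raiseSub (c cl) S)).subst θ₂)) :
    Valid T S (.atom p t ::ₘ Γ) C := by
  classical
  set A : Formula L S := Formula.atom p t with hAdef
  set G : Set L.Nominal := A.supp ∪ ctxSupp Γ ∪ C.supp with hGdef
  have hG : G.Finite := (A.finite_supp.union (finite_ctxSupp Γ)).union C.finite_supp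
  refine ⟨G, hG, fun s hs hΓ => ?_⟩
  have hA : A.Sat T T s := hΓ A (Multiset.mem_cons_self _ _)
  replace hΓ : ∀ B ∈ Γ, B.Sat T T s := fun B hB => hΓ B (Multiset.mem_cons_of_mem hB)
  change A.subst s ∈ T at hA
  rw [hT'] at hA
  obtain ⟨cl, hcl, e₀, σ₀, he₀, hσ₀, hAs₀, hB₀⟩ := hA
  obtain ⟨e₁, σ₁, he₁, hσ₁, hAs₁, hB₁, heG, hσG⟩ :=
    exists_separated_instance hT cl hG hs e₀ σ₀ he₀ hσ₀ hAs₀ hB₀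
  obtain ⟨hcnd, hcG⟩ := hc cl hcl
  have hcA : ∀ b ∈ (c cl).toList, b ∉ A.supp := fun b hb h => hcG b hb (.inl (.inl h))
  -- The rule allows only `π.c` for the `∇`-variables. So the constants of `e₁` in the support of
  -- `A` are kept and the others are replaced by those of `c` at the same positions.
  obtain ⟨e, he, he_mem, he_zip, hc_zip⟩ :=
    NomList.exists_replace A.supp (c cl) e₁ hcnd he₁ hcA
  -- `π₂` realises this replacement by moving only constants outside `G`, so it leaves `A`, `Γ` and
  -- `C` alone.
  obtain ⟨π₂, hπ₂, hπ₂M⟩ := e₁.exists_permute_eq e {b | b ∉ G} he₁ he fun q hq hne => by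
    obtain ⟨h₁, h₂⟩ := he_zip q hq hne
    have := List.of_mem_zip (a := q.1) (b := q.2) hq
    exact ⟨(heG _ this.1).resolve_left h₁, hcG _ h₂⟩
  -- The permutation required by the rule: `c` and `e` differ only where `e` has a constant of the
  -- support of `A`, that is, of `a`.
  obtain ⟨π, hπ, hπM⟩ := (c cl).exists_permute_eq e {b | b ∈ a.toList ∨ b ∈ (c cl).toList}
    hcnd he fun q hq hne => by
      have := List.of_mem_zip (a := q.1) (b := q.2) hq
      exact ⟨.inr this.1, .inl ((ha.2 _).2 (hc_zip q hq hne))⟩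
  have hπP : π.Permutes a (c cl) := fun b hb => hπM b ((π.act_ne_iff b).2 hb)
  have fix : ∀ b ∈ G, π₂.act b = b := fun b hb => by
    by_contra h'
    exact hπ₂M b h' hb
  have notG : ∀ b, b ∉ G → π₂.act b ∉ G := fun b hb h' => by
    rw [← π₂.act_injective (fix _ h')] at hb
    exact hb h'
  -- the permuted situation
  have hAG : A.supp ⊆ G := fun b hb => .inl (.inl hb)
  set s₂ := s.permute π₂ with hs₂def
  set σ := σ₁.permute π₂ with hσdef
  have hs₂ : s₂.Avoids G := by
    intro τ x b hb hb'
    obtain ⟨d, hd, rfl⟩ := (s x).mem_supp_of_permute π₂ hb'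
    exact notG d (fun h => hs x d h hd) hb
  obtain ⟨-, hσe, hAs⟩ := cl.permute_instance π₂ e₁ σ₁ he₁ hσ₁
  rw [← hAs₁, Formula.permute_subst, A.permute_eq_self π₂ fun b hb => fix b (hAG hb), hπ₂] at hAs
  rw [hπ₂] at hσe
  have hσG₂ : ∀ ⦃τ⦄ (x : Var cl.vars τ), ∀ b ∈ (σ x).supp, b ∈ A.supp ∨ b ∉ G := by
    intro τ x b hb
    obtain ⟨d, hd, rfl⟩ := (σ₁ x).mem_supp_of_permute π₂ hb
    rcases hσG x d hd with h | h
    · rw [fix d (hAG h)]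
      exact .inl h
    · exact .inr (notG d h)
  have hB : cl.body.Sat T T σ := by
    rw [← Formula.sat_permute hT hT π₂, cl.permute_body] at hB₁
    exact hB₁
  have hΓ₂ : ∀ B ∈ Γ, B.Sat T T s₂ := fun B hB =>
    (B.sat_permute_fixed hT π₂ s fun b hb => fix b (.inl (.inr (subset_ctxSupp hB hb)))).2 (hΓ B hB)
  rw [← C.sat_permute_fixed hT π₂ s fun b hb => fix b (.inr hb)]
  -- representatives, and the constants to be replaced by variables
  have hq := fun (τ : L.Typ) (x : Var S τ) => (s₂ x).exists_mk_avoiding hG (hs₂ x)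
  choose q hq hqG using hq
  have hr := fun (τ : L.Typ) (x : Var cl.vars τ) => (σ x).exists_mk_avoiding
    (G := (G ∩ {b | b ∉ A.supp}) ∪ {b | b ∈ e.toList})
    ((hG.subset Set.inter_subset_left).union e.finite_toList) (by
      rintro b (⟨h₁, h₂⟩ | hb) hb'
      · exact (hσG₂ x b hb').elim h₂ fun h => h h₁
      · exact hσe x b hb hb')
  choose r hr hrG using hr
  have hN : ({b | ∃ (τ : L.Typ) (x : Var S τ), b ∈ {b | (q τ x).HasNom b}} ∪
      {b | ∃ (τ : L.Typ) (x : Var cl.vars τ), b ∈ {b | (r τ x).HasNom b}}).Finite :=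
    (finite_iUnion_var fun τ x => (q τ x).finite_hasNom).union
      (finite_iUnion_var fun τ x => (r τ x).finite_hasNom)
  -- `w` lists the constants of the chosen representatives outside `a` and `c`; these cannot be
  -- raised over and become the variables of `U`.
  obtain ⟨U, w, hw⟩ := NomList.exists_of_list
    (hN.subset (Set.inter_subset_left
      (t := {b | ¬ (b ∈ a.toList ∨ b ∈ (c cl).toList)}))).toFinset.toList
  have hw' : ∀ b, b ∈ w.toList ↔ ((∃ (τ : L.Typ) (x : Var S τ), (q τ x).HasNom b) ∨
      ∃ (τ : L.Typ) (x : Var cl.vars τ), (r τ x).HasNom b) ∧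
      ¬ (b ∈ a.toList ∨ b ∈ (c cl).toList) := by
    intro b
    rw [hw]
    simp
  clear hw
  have hwG : ∀ b ∈ w.toList, b ∉ G := by
    intro b hb hbG
    obtain ⟨⟨τ, x, h⟩ | ⟨τ, x, h⟩, hb'⟩ := (hw' b).1 hb
    · exact hqG τ x b hbG h
    · exact hrG τ x b (.inl ⟨hbG, fun h => hb' (.inl ((ha.2 b).2 h))⟩) h
  have hwe : ∀ b ∈ e.toList, b ∉ w.toList := by
    intro b hb hbw
    refine ((hw' b).1 hbw).2 ((he_mem b hb).imp (fun h => (ha.2 b).2 h.1) id)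
  obtain ⟨f, hf, hf', hfw⟩ := w.exists_replacement
  -- the unifier
  have hθ₂ := fun (τ : L.Typ) (x : Var S τ) => Raw.exists_raised_replace
    (W := {b | b ∈ w.toList}) hf' (c cl) (q τ x) (by
      intro b hb hbw
      by_contra hbc
      refine hbw ((hw' b).2 ⟨.inl ⟨τ, x, hb⟩, ?_⟩)
      rintro (h | h)
      · exact hqG τ x b (hAG ((ha.2 b).1 h)) hb
      · exact hbc h)
  choose g₂ hg₂ hg₂' using hθ₂
  -- The constants left over are in `a` or `c`, hence in `π.a` or `π.c`; the latter is `e`, which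
  -- `r` avoids, so abstraction over `π.a` suffices.
  have hθ₁ := fun (τ : L.Typ) (x : Var cl.vars τ) => Raw.exists_raised_replace
    (W := {b | b ∈ w.toList}) hf' (a.permute π) (r τ x) (by
      intro b hb hbw
      by_contra hba
      refine hbw ((hw' b).2 ⟨.inr ⟨τ, x, hb⟩, fun hac => ?_⟩)
      rcases hπP.mem_permute hac with h | h
      · exact hba h
      · rw [hπ] at h
        exact hrG τ x b (.inr h) hb)
  choose g₁ hg₁ hg₁' using hθ₁
  obtain ⟨θ₂, hθ₂, hθ₂'⟩ := Sub.exists_map (raiseTy cl.nabs) (fun _ t => t.supp = ∅)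
    (fun τ x => g₂ τ x) (fun τ x => hg₂' τ x)
  obtain ⟨θ₁, hθ₁, hθ₁'⟩ := Sub.exists_map (raiseTy αs) (fun _ t => t.supp = ∅)
    (fun τ x => g₁ τ x) (fun τ x => hg₁' τ x)
  have hs₂θ : (raiseSub (c cl) S).comp θ₂ = fun _ x => (s₂ x).replace f := by
    rw [raiseSub_comp]
    funext τ x
    rw [hθ₂, hg₂, hq]
  have hσθ : (raiseSub (a.permute π) cl.vars).comp θ₁ = fun _ x => (σ x).replace f := by
    rw [raiseSub_comp]
    funext τ x
    rw [hθ₁, hg₁, hr]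
  have hs₂w : ((raiseSub (c cl) S).comp θ₂).comp (w.toSub []) = s₂ := by
    rw [hs₂θ]
    funext τ x
    exact hfw _
  have hσw : ((raiseSub (a.permute π) cl.vars).comp θ₁).comp (w.toSub []) = σ := by
    rw [hσθ]
    funext τ x
    exact hfw _
  have hH : ((cl.raisedHead a (c cl)).permute π).subst θ₁
      = (A.subst (raiseSub (c cl) S)).subst θ₂ := by
    -- The unification equation is the ground equation with `w` turned into variables: the
    -- replacement leaves `A`, the clause head and `e` unchanged.
    have h₁ := congrArg (Formula.mapAtom fun _ t => t.replace f) hAs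
    have h₂ : Formula.mapAtom (fun _ t => t.replace f) (A.subst s₂)
        = A.subst (fun _ x => (s₂ x).replace f) := by
      simp only [hAdef, Formula.subst, Formula.mapAtom]
      congr 1
      funext i
      exact Tm.replace_subst f w.finite_toList (fun ρ b hb => hf b hb) (t i)
        (fun b hb hb' => hwG b hb (hAG ⟨i, hb'⟩)) s₂
    have h₃ : Formula.mapAtom (fun _ t => t.replace f)
        (cl.head.subst (Sub.append (e.toSub []) σ))
        = cl.head.subst (Sub.append (e.toSub U) fun _ x => (σ x).replace f) := by
      simp only [Clause.head, Formula.subst, Formula.mapAtom]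
      congr 1
      funext i
      rw [Tm.replace_subst f w.finite_toList (fun ρ b hb => hf b hb) (cl.args i)
        (fun b hb hb' => by rw [cl.args_supp] at hb'; exact hb')]
      rw [Sub.map_append (fun _ t => t.replace f)]
      congr 2
      rw [e.toSub_eq_get, e.toSub_eq_get]
      funext τ x
      exact congrArg Tm.mk (hf _ (hwe _ (e.get_mem x)))
    rw [cl.permute_raisedHead, hπ, Formula.subst_subst, hs₂θ, ← h₂, ← raiseSub_comp, hσθ, ← h₃]
    exact h₁.symm
  have hmain := h cl hcl π U θ₁ θ₂ hπP hθ₁' hθ₂' hH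
  have supp₂ : ∀ (B : Formula L S), ∀ b ∈ ((B.subst (raiseSub (c cl) S)).subst θ₂).supp,
      b ∈ B.supp ∨ b ∈ (c cl).toList := by
    intro B b hb
    rcases Formula.supp_subst _ _ hb with hb | ⟨ρ, x, hb⟩
    · rcases Formula.supp_subst _ _ hb with hb | ⟨ρ, x, hb⟩
      · exact .inl hb
      · exact .inr (supp_raiseSub _ x hb)
    · rw [hθ₂'] at hb
      exact hb.elim
  -- The exceptional set of this premise is not known in advance and may vary with the instance, so
  -- it could not be included in `G`. `Valid.sat` disposes of it: `w` has only to avoid the support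
  -- of the premise, whose constants lie in `G`, `a` or `c`.
  have hres := hmain.sat hT (s := w.toSub []) ?_ ?_
  · rwa [Formula.subst_subst, Formula.sat_subst, hs₂w] at hres
  · intro τ x b hb hbx
    have hbw : b ∈ w.toList := by
      rw [w.toSub_eq_get] at hbx
      rw [Tm.supp_nom _ hbx]
      exact w.get_mem x
    have hbac := ((hw' b).1 hbw).2
    rcases hb with ⟨B, hB, hb⟩ | hb
    · rcases Multiset.mem_cons.1 hB with rfl | hB
      · rw [cl.permute_raisedBody] at hb
        rcases Formula.supp_subst _ _ hb with hb | ⟨ρ, y, hb⟩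
        · rcases Formula.supp_subst _ _ hb with hb | ⟨ρ, y, hb⟩
          · rw [cl.body_supp] at hb
            exact hb
          · have hb := supp_raiseSub _ y hb
            rw [NomList.toList_permute, List.mem_map] at hb
            obtain ⟨d, hd, rfl⟩ := hb
            exact hbac (hπP.act_mem (.inl hd))
        · rw [hθ₁'] at hb
          exact hb
      · obtain ⟨B', hB', rfl⟩ := Multiset.mem_map.1 hB
        rcases supp₂ B' b hb with hb | hb
        · exact hwG b hbw (.inl (.inr (subset_ctxSupp hB' hb)))
        · exact hbac (.inr hb)
    · rcases supp₂ C b hb with hb | hb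
      · exact hwG b hbw (.inr hb)
      · exact hbac (.inr hb)
  · intro B hB'
    rcases Multiset.mem_cons.1 hB' with rfl | hB'
    · rw [cl.permute_raisedBody, Formula.subst_subst, Formula.sat_subst, hσw]
      exact hB
    · obtain ⟨B₁, hB₁, rfl⟩ := Multiset.mem_map.1 hB'
      rw [Formula.subst_subst, Formula.sat_subst, hs₂w]
      exact hΓ₂ B₁ hB₁

/-! ### Soundness -/

/-- Induction on the numeral denoted by `t`. Numerals contain no nominal constants, so they avoid
the exceptional sets of the two invariant premises, whatever these are. -/
theorem Valid.natL {T : Set (Formula L [])} {S : L.Ctx} {Γ : Multiset (Formula L S)}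
    {C : Formula L S} (I : Formula L [.nt]) (t : Tm L S .nt)
    (h₀ : Valid T [] 0 (I.inst Tm.zero))
    (h₁ : Valid T [.nt] {I} (I.subst (Sub.cons (Tm.succ (Tm.var .here)) (Sub.empty _))))
    (h : Valid T S (I.subst (Sub.cons t (Sub.empty S)) ::ₘ Γ) C) :
    Valid T S (.nat t ::ₘ Γ) C := by
  obtain ⟨X₀, -, h₀⟩ := h₀
  obtain ⟨X₁, -, h₁⟩ := h₁
  obtain ⟨X, hX, h⟩ := h
  refine ⟨X, hX, fun s hs hΓ => h s hs fun B hB => ?_⟩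
  rcases Multiset.mem_cons.1 hB with rfl | hB
  · obtain ⟨n, hn⟩ := hΓ _ (Multiset.mem_cons_self _ _)
    rw [Formula.sat_subst, Sub.cons_comp, Sub.empty_comp, hn]
    clear hn
    have hsupp : ∀ n : ℕ, (Tm.succ^[n] (Tm.zero : Tm L [] .nt)).supp = ∅ := by
      intro n
      induction n with
      | zero => exact Set.eq_empty_of_forall_notMem fun _ h => Tm.supp_mk_subset Raw.zero h
      | succ n ih =>
        rw [Function.iterate_succ_apply']
        refine Set.eq_empty_of_forall_notMem fun a h => ?_
        rcases Tm.supp_app _ _ h with h | h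
        · exact Tm.supp_mk_subset Raw.succ h
        · rw [ih] at h
          exact h
    induction n with
    | zero =>
      have := h₀ (Sub.empty []) (Sub.avoids_empty _) (fun B hB => by simp at hB)
      rwa [Formula.sat_inst, Tm.subst_zero] at this
    | succ n ih =>
      have := h₁ (Sub.cons (Tm.succ^[n] Tm.zero) (Sub.empty []))
        ((Sub.avoids_empty _).cons fun a _ => by rw [hsupp]; exact fun h => h)
        (fun B hB => by rw [Multiset.mem_singleton.1 hB]; exact ih)
      rw [Formula.sat_subst, Sub.cons_comp, Sub.empty_comp, Tm.subst_succ, Tm.subst_var] at this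
      rw [Function.iterate_succ_apply']
      exact this
  · exact hΓ B (Multiset.mem_cons_of_mem hB)

/-- Soundness, by induction on the derivation. Rules with finitely many premises join the
exceptional sets where necessary. -/
theorem Derivable.valid {D : Set (Clause L)} {T : Set (Formula L [])} (hT : Equivariant T)
    (hT' : T = step D T T) {S : L.Ctx} {Γ : Multiset (Formula L S)} {C : Formula L S}
    (h : Derivable D S Γ C) : Valid T S Γ C := by
  induction h with
  | id π π' e =>
    -- A substitution avoiding the constants moved by `π` and `π'` is fixed by both, so they act on
    -- the formulas alone.
    refine ⟨_, π.finite_act.union π'.finite_act, fun s hs hΓ => ?_⟩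
    have hB := hΓ _ (Multiset.mem_cons_self _ _)
    rwa [← Formula.sat_permute hT hT π, hs.permute_eq_self fun a h => .inl h, e,
      ← hs.permute_eq_self (π := π') fun a h => .inr h, Formula.sat_permute hT hT π'] at hB
  | cut B _ _ ih₁ ih₂ =>
    obtain ⟨X₁, hX₁, h₁⟩ := ih₁
    obtain ⟨X₂, hX₂, h₂⟩ := ih₂
    refine ⟨_, hX₁.union hX₂, fun s hs hΓ => h₂ s (hs.mono Set.subset_union_right) ?_⟩
    simp only [Multiset.mem_add, Multiset.mem_cons, forall_eq_or_imp] at hΓ ⊢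
    exact ⟨h₁ s (hs.mono Set.subset_union_left) fun B hB => hΓ B (.inl hB),
      fun B hB => hΓ B (.inr hB)⟩
  | contrL _ ih =>
    obtain ⟨X, hX, h⟩ := ih
    refine ⟨X, hX, fun s hs hΓ => h s hs ?_⟩
    simp only [Multiset.mem_cons, forall_eq_or_imp] at hΓ ⊢
    exact ⟨hΓ.1, hΓ.1, hΓ.2⟩
  | botL => exact ⟨∅, Set.finite_empty, fun s _ hΓ => (hΓ _ (Multiset.mem_cons_self _ _)).elim⟩
  | topR => exact ⟨∅, Set.finite_empty, fun s _ _ => trivial⟩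
  | orL _ _ ih₁ ih₂ =>
    obtain ⟨X₁, hX₁, h₁⟩ := ih₁
    obtain ⟨X₂, hX₂, h₂⟩ := ih₂
    refine ⟨_, hX₁.union hX₂, fun s hs hΓ => ?_⟩
    simp only [Multiset.mem_cons, forall_eq_or_imp] at hΓ h₁ h₂
    exact hΓ.1.elim (fun h => h₁ s (hs.mono Set.subset_union_left) ⟨h, hΓ.2⟩)
      (fun h => h₂ s (hs.mono Set.subset_union_right) ⟨h, hΓ.2⟩)
  | orR₁ _ ih =>
    obtain ⟨X, hX, h⟩ := ih
    exact ⟨X, hX, fun s hs hΓ => .inl (h s hs hΓ)⟩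
  | orR₂ _ ih =>
    obtain ⟨X, hX, h⟩ := ih
    exact ⟨X, hX, fun s hs hΓ => .inr (h s hs hΓ)⟩
  | andL₁ _ ih =>
    obtain ⟨X, hX, h⟩ := ih
    refine ⟨X, hX, fun s hs hΓ => h s hs ?_⟩
    simp only [Multiset.mem_cons, forall_eq_or_imp] at hΓ ⊢
    exact ⟨hΓ.1.1, hΓ.2⟩
  | andL₂ _ ih =>
    obtain ⟨X, hX, h⟩ := ih
    refine ⟨X, hX, fun s hs hΓ => h s hs ?_⟩
    simp only [Multiset.mem_cons, forall_eq_or_imp] at hΓ ⊢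
    exact ⟨hΓ.1.2, hΓ.2⟩
  | andR _ _ ih₁ ih₂ =>
    obtain ⟨X₁, hX₁, h₁⟩ := ih₁
    obtain ⟨X₂, hX₂, h₂⟩ := ih₂
    exact ⟨_, hX₁.union hX₂, fun s hs hΓ => ⟨h₁ s (hs.mono Set.subset_union_left) hΓ,
      h₂ s (hs.mono Set.subset_union_right) hΓ⟩⟩
  | impL _ _ ih₁ ih₂ =>
    obtain ⟨X₁, hX₁, h₁⟩ := ih₁
    obtain ⟨X₂, hX₂, h₂⟩ := ih₂
    refine ⟨_, hX₁.union hX₂, fun s hs hΓ => h₂ s (hs.mono Set.subset_union_right) ?_⟩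
    simp only [Multiset.mem_cons, forall_eq_or_imp] at hΓ ⊢
    exact ⟨hΓ.1 (h₁ s (hs.mono Set.subset_union_left) hΓ.2), hΓ.2⟩
  | impR _ ih =>
    obtain ⟨X, hX, h⟩ := ih
    refine ⟨X, hX, fun s hs hΓ hB => h s hs ?_⟩
    simp only [Multiset.mem_cons, forall_eq_or_imp]
    exact ⟨hB, hΓ⟩
  | allL t _ ih =>
    obtain ⟨X, hX, h⟩ := ih
    refine ⟨X, hX, fun s hs hΓ => h s hs ?_⟩
    simp only [Multiset.mem_cons, forall_eq_or_imp] at hΓ ⊢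
    exact ⟨(Formula.sat_inst _ _ _).2 (hΓ.1 _), hΓ.2⟩
  | @allR S Γ τ B αs c hc _ ih =>
    obtain ⟨X, hX, h⟩ := ih
    refine ⟨X, hX, fun s hs hΓ t => ?_⟩
    obtain ⟨u, hu, hut⟩ := B.exists_raised_witness hT c hc hX hs t
    rw [← hut, ← Formula.sat_raised]
    refine h _ (hs.cons hu) fun B' hB' => ?_
    obtain ⟨B'', hB'', rfl⟩ := Multiset.mem_map.1 hB'
    exact (B''.sat_weaken s u).2 (hΓ B'' hB'')
  | @nablaL S Γ C τ B a ha _ ih =>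
    obtain ⟨X, hX, h⟩ := ih
    refine ⟨X ∪ {⟨τ, a⟩}, hX.union (Set.finite_singleton _), fun s hs hΓ =>
      h s (hs.mono Set.subset_union_left) ?_⟩
    simp only [Multiset.mem_cons, forall_eq_or_imp] at hΓ ⊢
    rw [Formula.sat_inst, Tm.subst_nom,
      ← B.sat_nabla_iff hT s ha (hs.mono Set.subset_union_right)]
    exact hΓ
  | @nablaR S Γ τ B a ha _ ih =>
    obtain ⟨X, hX, h⟩ := ih
    refine ⟨X ∪ {⟨τ, a⟩}, hX.union (Set.finite_singleton _), fun s hs hΓ => ?_⟩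
    rw [B.sat_nabla_iff hT s ha (hs.mono Set.subset_union_right)]
    have := h s (hs.mono Set.subset_union_left) hΓ
    rwa [Formula.sat_inst, Tm.subst_nom] at this
  | @exL S Γ C τ B αs c hc _ ih =>
    obtain ⟨X, hX, h⟩ := ih
    refine ⟨X, hX, fun s hs hΓ => ?_⟩
    simp only [Multiset.mem_cons, forall_eq_or_imp] at hΓ
    obtain ⟨⟨t, ht⟩, hΓ⟩ := hΓ
    obtain ⟨u, hu, hut⟩ := B.exists_raised_witness hT c hc hX hs t
    rw [← C.sat_weaken s u]
    refine h _ (hs.cons hu) fun B' hB' => ?_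
    rcases Multiset.mem_cons.1 hB' with rfl | hB'
    · rw [Formula.sat_raised, hut]
      exact ht
    · obtain ⟨B'', hB'', rfl⟩ := Multiset.mem_map.1 hB'
      exact (B''.sat_weaken s u).2 (hΓ B'' hB'')
  | exR t _ ih =>
    obtain ⟨X, hX, h⟩ := ih
    exact ⟨X, hX, fun s hs hΓ => ⟨_, (Formula.sat_inst _ _ _).1 (h s hs hΓ)⟩⟩
  | defL p t a c ha hc _ ih => exact Valid.defL hT hT' p t a c ha hc ih
  | defR p t a cl c π θ ha hcl hc hπ hθ hH _ ih =>
    exact Valid.defR hT' p t a cl c π θ ha hcl hc hπ hθ hH ih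
  | natL I t _ _ _ ih₀ ih₁ ih => exact Valid.natL I t ih₀ ih₁ ih
  | natR_zero => exact ⟨∅, Set.finite_empty, fun s _ _ => ⟨0, Tm.subst_zero s⟩⟩
  | natR_succ _ ih =>
    obtain ⟨X, hX, h⟩ := ih
    refine ⟨X, hX, fun s hs hΓ => ?_⟩
    obtain ⟨n, hn⟩ := h s hs hΓ
    exact ⟨n + 1, by rw [Tm.subst_succ, hn, Function.iterate_succ_apply']⟩

/-- Validity could be vacuous only without avoiding closing substitutions; sending each variable to
a nominal constant of its type outside `X` gives one. -/
theorem not_valid_bot {T : Set (Formula L [])} (S : L.Ctx) : ¬ Valid T S 0 .bot := by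
  rintro ⟨X, hX, h⟩
  choose d hd using fun τ => exists_nom_notMem (L := L) τ hX
  refine h (fun τ _ => Tm.nom (d τ)) (fun τ _ a ha ha' => ?_) (fun B hB => by simp at hB)
  rw [Tm.supp_nom _ ha'] at ha
  exact hd τ ha

end GLogic

theorem mainTheorem2 (L : GLogic.Lang.{u}) (D : Set (GLogic.Clause L))
    (hD : GLogic.Stratified D) (S : L.Ctx) (A : GLogic.Formula L S) :
    ¬ (GLogic.Provable D A ∧ GLogic.Provable D (GLogic.Formula.imp A GLogic.Formula.bot)) := by
  rintro ⟨h₁, h₂⟩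
  obtain ⟨T, hT, hT'⟩ := hD.exists_interpretation
  obtain ⟨X₁, hX₁, h₁⟩ := GLogic.Derivable.valid hT hT' h₁
  obtain ⟨X₂, hX₂, h₂⟩ := GLogic.Derivable.valid hT hT' h₂
  exact GLogic.not_valid_bot (T := T) S ⟨_, hX₁.union hX₂, fun s hs hΓ =>
    h₂ s (hs.mono Set.subset_union_right) hΓ (h₁ s (hs.mono Set.subset_union_left) hΓ)⟩
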